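/- Let $G$ be a noncompact connected Lie group with identity $e$ and Lie algebra $\mathfrak g$ (identified with the left-invariant vector fields), and let $\mu$ be a left Haar measure on $G$. Fix a scalar product on $\mathfrak g$ and a linear subspace $\mathcal H\subseteq\mathfrak g$ which generates $\mathfrak g$ as a Lie algebra, and let $X_1,\dots,X_\nu$ be an orthonormal basis of $\mathcal H$. Let $d$ be the associated left-invariant Carnot--Carathéodory distance, i.e. $d(x,y)$ is the infimum of $\int_0^1|\gamma'(t)|\,\mathrm dt$ over the absolutely continuous curves $\gamma\colon[0,1]\to G$ from $x$ to $y$ with $\gamma'(t)\in\mathcal H_{\gamma(t)}$ for almost every $t$, and let $B(x,r)=\{y\in G: d(x,y)<r\}$. Let $V\colon G\to\mathbb R$ be in $L^1_{\mathrm{loc}}(\mu)$ and essentially bounded from below, and let $\mathcal H_V$ be the self-adjoint operator on $L^2(\mu)$ (complex-valued functions) induced by the form \[ Q(f,g)=\int_G\Big(\sum_{j=1}^\nu (X_jf)\,\overline{X_jg}+Vf\overline g\Big)\,\mathrm d\mu,\qquad \mathrm{Dom}(Q)=\big\{f\in L^2: X_1f,\dots,X_\nu f\in L^2,\ |V|^{1/2}f\in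 L^2\big\}, \] where $X_jf$ is meant in the sense of distributions; that is, $f\in\mathrm{Dom}(\mathcal H_V)$ and $\mathcal H_Vf=h$ if and only if $f\in\mathrm{Dom}(Q)$, $h\in L^2$ and $Q(f,g)=\int_G h\overline g\,\mathrm d\mu$ for all $g\in\mathrm{Dom}(Q)$. If $\mathcal H_V$ has purely discrete spectrum, i.e. its spectrum is a discrete set and consists of eigenvalues of finite multiplicity, then for every $r>0$ \[ \lim_{x\to\infty}\int_{B(x,r)}V\,\mathrm d\mu=\infty , \] where $x\to\infty$ means that $x$ eventually leaves every compact subset of $G$. -/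

import Mathlib

open MeasureTheory Set Filter Topology
open scoped Manifold ContDiff ENNReal ComplexConjugate

noncomputable section

/-! ### Spectrum of an unbounded operator -/

namespace LinearPMap

variable {H : Type*} [NormedAddCommGroup H] [InnerProductSpace ℂ H]

/-- The resolvent set of an unbounded operator `T`: the `z : ℂ` such that
`T - z : Dom T → H` is a bijection whose inverse `R` is bounded on `H`. -/
def resolventSet (T : H →ₗ.[ℂ] H) : Set ℂ :=
  {z | ∃ R : H →L[ℂ] H,
    (∀ u : H, ∃ hu : R u ∈ T.domain, T ⟨R u, hu⟩ - z • R u = u) ∧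
    ∀ f : T.domain, R (T f - z • (f : H)) = f}

/-- The spectrum of an unbounded operator. -/
def unboundedSpectrum (T : H →ₗ.[ℂ] H) : Set ℂ := T.resolventSetᶜ

/-- The eigenspace `{f ∈ Dom T | T f = z f}`, as a subspace of the domain. -/
def eigenspace (T : H →ₗ.[ℂ] H) (z : ℂ) : Submodule ℂ T.domain :=
  LinearMap.ker (T.toFun - z • T.domain.subtype)

/-- The spectrum of `T` is purely discrete: it is a discrete set and consists of eigenvalues of
finite multiplicity. -/
def HasPurelyDiscreteSpectrum (T : H →ₗ.[ℂ] H) : Prop :=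
  DiscreteTopology T.unboundedSpectrum ∧
    ∀ z ∈ T.unboundedSpectrum, T.eigenspace z ≠ ⊥ ∧ FiniteDimensional ℂ (T.eigenspace z)

end LinearPMap

namespace SubRiem

/-- A smooth Lie group is regular enough to carry Mathlib's Lie algebra structure on the tangent
space at the identity. -/
instance instLEInftyMinSmoothness : ENat.LEInfty (minSmoothness ℝ 3) :=
  ⟨by rw [minSmoothness_of_isRCLikeNormedField]; exact ENat.LEInfty.out⟩

variable {n : ℕ} {G : Type*} [TopologicalSpace G] [ChartedSpace (EuclideanSpace ℝ (Fin n)) G]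
  [Group G]

/-! ### The Carnot–Carathéodory distance -/

/-- `γ : [0,1] → G` is an absolutely continuous curve (i.e. continuous, and absolutely continuous
when read through smooth functions) which for almost every `t` is differentiable with
`γ'(t) = (X_{u(t)})_{γ(t)}`, where `u(t) ∈ 𝓗` and `X_v` is the left-invariant vector field
with value `v` at the identity. In particular `u` is a.e. determined by `γ`. -/
structure IsHorizontalCurve (𝓗 : Submodule ℝ (GroupLieAlgebra (𝓡 n) G))
    (γ : ℝ → G) (u : ℝ → GroupLieAlgebra (𝓡 n) G) : Prop where
  continuousOn : ContinuousOn γ (Icc 0 1)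
  absolutelyContinuous : ∀ φ : G → ℝ, ContMDiff (𝓡 n) 𝓘(ℝ, ℝ) ∞ φ →
    AbsolutelyContinuousOnInterval (φ ∘ γ) 0 1
  velocity : ∀ᵐ t ∂(volume.restrict (Icc (0 : ℝ) 1)), u t ∈ 𝓗 ∧
    HasMFDerivAt 𝓘(ℝ, ℝ) (𝓡 n) γ t
      ((1 : ℝ →L[ℝ] ℝ).smulRight (mulInvariantVectorField (I := 𝓡 n) (u t) (γ t)))

/-- The length `∫₀¹ |γ'(t)| dt` of a horizontal curve with velocity `u` (read in the Lie algebra by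
left translation), for the left-invariant metric induced by the scalar product `ip`. -/
def curveLength (ip : InnerProductSpace.Core ℝ (GroupLieAlgebra (𝓡 n) G))
    (u : ℝ → GroupLieAlgebra (𝓡 n) G) : ℝ≥0∞ :=
  ∫⁻ t in Icc (0 : ℝ) 1, ENNReal.ofReal (√(ip.inner (u t) (u t)))

/-- The Carnot–Carathéodory distance, with values in `[0,∞]` (`∞` if there is no horizontal curve
from `x` to `y`). -/
def ccDist (ip : InnerProductSpace.Core ℝ (GroupLieAlgebra (𝓡 n) G))
    (𝓗 : Submodule ℝ (GroupLieAlgebra (𝓡 n) G)) (x y : G) : ℝ≥0∞ :=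
  ⨅ (γ : ℝ → G) (u : ℝ → GroupLieAlgebra (𝓡 n) G)
    (_ : IsHorizontalCurve 𝓗 γ u ∧ γ 0 = x ∧ γ 1 = y), curveLength ip u

/-- The open ball `B(x,r)` of the Carnot–Carathéodory distance. -/
def ccBall (ip : InnerProductSpace.Core ℝ (GroupLieAlgebra (𝓡 n) G))
    (𝓗 : Submodule ℝ (GroupLieAlgebra (𝓡 n) G)) (x : G) (r : ℝ) : Set G :=
  {y | ccDist ip 𝓗 x y < ENNReal.ofReal r}

/-! ### Left-invariant derivatives, classical and weak -/

/-- `(X φ)(x)`, for `X` in the Lie algebra seen as a left-invariant vector field. -/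
def fieldDeriv (X : GroupLieAlgebra (𝓡 n) G) (φ : G → ℂ) (x : G) : ℂ :=
  mfderiv (𝓡 n) 𝓘(ℝ, ℂ) φ x (mulInvariantVectorField (I := 𝓡 n) X x)

/-- The space `C_c^∞(G)` of complex-valued test functions. -/
def IsTestFun (n : ℕ) {G : Type*} [TopologicalSpace G]
    [ChartedSpace (EuclideanSpace ℝ (Fin n)) G] (φ : G → ℂ) : Prop :=
  ContMDiff (𝓡 n) 𝓘(ℝ, ℂ) ∞ φ ∧ HasCompactSupport φ

theorem IsTestFun.continuous {n : ℕ} {G : Type*} [TopologicalSpace G]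
    [ChartedSpace (EuclideanSpace ℝ (Fin n)) G] {φ : G → ℂ} (h : IsTestFun n φ) :
    Continuous φ := h.1.continuous

theorem IsTestFun.hasCompactSupport_fieldDeriv {φ : G → ℂ} (h : IsTestFun n φ)
    (X : GroupLieAlgebra (𝓡 n) G) : HasCompactSupport (fieldDeriv X φ) := by
  refine h.2.mono' fun x hx => ?_
  by_contra hx'
  apply hx
  have : φ =ᶠ[𝓝 x] fun _ => 0 := notMem_tsupport_iff_eventuallyEq.1 hx'
  simp only [fieldDeriv]
  rw [this.mfderiv_eq, mfderiv_const]
  rfl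

variable [LieGroup (𝓡 n) ∞ G]

/-- The modular function `δ`, normalised by `μ(A x) = δ(x) μ(A)` for left Haar measures `μ`
(Mathlib's `modularCharacterFun g` is the ratio `μ(A g⁻¹) / μ(A)`). -/
def modularFun (n : ℕ) {G : Type*} [TopologicalSpace G]
    [ChartedSpace (EuclideanSpace ℝ (Fin n)) G] [Group G] [LieGroup (𝓡 n) ∞ G] (x : G) : ℝ :=
  haveI : IsTopologicalGroup G := topologicalGroup_of_lieGroup (𝓡 n) ∞
  haveI : LocallyCompactSpace G := Manifold.locallyCompact_of_finiteDimensional (𝓡 n)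
  (Measure.modularCharacterFun x⁻¹ : ℝ)

/-- The constant `c_X = (X δ)(e)`; the formal adjoint of `X` in `L²(μ)` is `-(X + c_X)`. -/
def modularDeriv (X : GroupLieAlgebra (𝓡 n) G) : ℝ :=
  mfderiv (𝓡 n) 𝓘(ℝ, ℝ) (modularFun n : G → ℝ) 1 X

theorem IsTestFun.continuous_fieldDeriv {φ : G → ℂ} (h : IsTestFun n φ)
    (X : GroupLieAlgebra (𝓡 n) G) : Continuous (fieldDeriv X φ) := by
  have h1 := h.1.continuous_tangentMap (by simp)
  have h2 := (contMDiff_mulInvariantVectorField (I := 𝓡 n) (G := G) X).continuous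
  have h3 := (tangentBundleModelSpaceHomeomorph 𝓘(ℝ, ℂ)).continuous
  exact (continuous_snd.comp (h3.comp (h1.comp h2)) :)

variable [MeasurableSpace G] [BorelSpace G] (μ : Measure G) [μ.IsHaarMeasure]

theorem integrable_Lp_mul {φ : G → ℂ} (h : Continuous φ) (h' : HasCompactSupport φ)
    (f : Lp ℂ 2 μ) : Integrable (fun x => f x * φ x) μ :=
  (Lp.memLp f).integrable_mul (q := 2) (h.memLp_of_hasCompactSupport h')

/-- The graph of the weak derivative along `X` on `L²(μ)`: the pairs `(f, g)` with `X f = g` in the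
sense of distributions, i.e. `∫ g φ dμ = -∫ f (X φ + c_X φ) dμ` for all `φ ∈ C_c^∞(G)`. -/
def weakDerivGraph (X : GroupLieAlgebra (𝓡 n) G) : Submodule ℂ (Lp ℂ 2 μ × Lp ℂ 2 μ) where
  carrier := {p | ∀ φ : G → ℂ, IsTestFun n φ →
    ∫ x, p.2 x * φ x ∂μ = -∫ x, p.1 x * (fieldDeriv X φ x + modularDeriv X * φ x) ∂μ}
  zero_mem' := by
    intro φ _
    have h0 : ∀ ψ : G → ℂ, ∫ x, (0 : Lp ℂ 2 μ) x * ψ x ∂μ = 0 := fun ψ => by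
      rw [← integral_zero G ℂ (μ := μ)]
      refine integral_congr_ae ?_
      filter_upwards [Lp.coeFn_zero ℂ 2 μ] with x hx
      rw [hx, Pi.zero_apply, zero_mul]
    simp only [Prod.fst_zero, Prod.snd_zero]
    rw [h0, h0, neg_zero]
  add_mem' := by
    intro p q hp hq φ hφ
    have hadd : ∀ (f g : Lp ℂ 2 μ) (ψ : G → ℂ), Continuous ψ → HasCompactSupport ψ →
        ∫ x, (f + g) x * ψ x ∂μ = ∫ x, f x * ψ x ∂μ + ∫ x, g x * ψ x ∂μ := by
      intro f g ψ h h'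
      rw [← integral_add (integrable_Lp_mul μ h h' f) (integrable_Lp_mul μ h h' g)]
      refine integral_congr_ae ?_
      filter_upwards [Lp.coeFn_add f g] with x hx
      rw [hx, Pi.add_apply, add_mul]
    simp only [Prod.fst_add, Prod.snd_add]
    rw [hadd _ _ _ hφ.continuous hφ.2, hadd _ _
      (fun x => fieldDeriv X φ x + modularDeriv X * φ x) ((hφ.continuous_fieldDeriv X).add (continuous_const.mul hφ.continuous))
      ((hφ.hasCompactSupport_fieldDeriv X).add hφ.2.mul_left), hp φ hφ, hq φ hφ, neg_add]
  smul_mem' := by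
    intro c p hp φ hφ
    have hsmul : ∀ (f : Lp ℂ 2 μ) (ψ : G → ℂ),
        ∫ x, (c • f) x * ψ x ∂μ = c * ∫ x, f x * ψ x ∂μ := by
      intro f ψ
      rw [← integral_const_mul]
      refine integral_congr_ae ?_
      filter_upwards [Lp.coeFn_smul c f] with x hx
      simp [hx, mul_assoc]
    simp only [Prod.smul_fst, Prod.smul_snd]
    rw [hsmul, hsmul, hp φ hφ, mul_neg]

/-- The weak derivative along the left-invariant field `X`, as an unbounded operator on `L²(μ)`
with its maximal domain `{f ∈ L² | X f ∈ L²}`. -/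
def weakDeriv (X : GroupLieAlgebra (𝓡 n) G) : Lp ℂ 2 μ →ₗ.[ℂ] Lp ℂ 2 μ :=
  (weakDerivGraph μ X).toLinearPMap

/-! ### The form `Q` and the Schrödinger operator -/

variable {ν : ℕ} (X : Fin ν → GroupLieAlgebra (𝓡 n) G) (V : G → ℝ)

/-- `Dom(Q) = {f ∈ L² | ∇f ∈ L², |V|^{1/2} f ∈ L²}`, the horizontal gradient being
`∇f = ∑ j, (X j f) X j`. -/
def formDomain : Submodule ℂ (Lp ℂ 2 μ) where
  carrier := {f | (∀ j, f ∈ (weakDeriv μ (X j)).domain) ∧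
    MemLp (fun x => (√|V x| : ℂ) * f x) 2 μ}
  zero_mem' := by
    refine ⟨fun j => Submodule.zero_mem _, (memLp_congr_ae ?_).2 (MemLp.zero (μ := μ))⟩
    filter_upwards [Lp.coeFn_zero ℂ 2 μ] with x hx
    rw [hx, Pi.zero_apply, mul_zero]
  add_mem' := by
    intro f g hf hg
    refine ⟨fun j => Submodule.add_mem _ (hf.1 j) (hg.1 j),
      (memLp_congr_ae ?_).2 (hf.2.add hg.2)⟩
    filter_upwards [Lp.coeFn_add f g] with x hx
    rw [hx]
    simp only [Pi.add_apply, mul_add]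
  smul_mem' := by
    intro c f hf
    refine ⟨fun j => Submodule.smul_mem _ c (hf.1 j), (memLp_congr_ae ?_).2 (hf.2.const_smul c)⟩
    filter_upwards [Lp.coeFn_smul c f] with x hx
    simp [hx]
    ring

/-- The component `X j f` of the weak horizontal gradient, on `Dom(Q)`. -/
def weakGrad (j : Fin ν) : formDomain μ X V →ₗ[ℂ] Lp ℂ 2 μ :=
  (weakDeriv μ (X j)).toFun ∘ₗ Submodule.inclusion (fun _ hf => hf.1 j)

/-- The form `Q(f,g) = ∫ (∇f · ∇ḡ + V f ḡ) dμ` on `Dom(Q)`. -/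
def form (f g : formDomain μ X V) : ℂ :=
  ∫ x, ((∑ j, weakGrad μ X V j f x * conj (weakGrad μ X V j g x)) +
    (V x : ℂ) * (f : Lp ℂ 2 μ) x * conj ((g : Lp ℂ 2 μ) x)) ∂μ

theorem form_integrable (hV : AEStronglyMeasurable V μ) (f g : formDomain μ X V) :
    Integrable (fun x => (∑ j, weakGrad μ X V j f x * conj (weakGrad μ X V j g x)) +
      (V x : ℂ) * (f : Lp ℂ 2 μ) x * conj ((g : Lp ℂ 2 μ) x)) μ := by
  refine Integrable.add (integrable_finsetSum _ fun j _ => ?_) ?_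
  · exact (Lp.memLp (weakGrad μ X V j f)).integrable_mul (Lp.memLp (weakGrad μ X V j g)).star
  · have h := f.2.2.integrable_mul g.2.2.star
    refine h.norm.mono' ?_ (Eventually.of_forall fun x => le_of_eq ?_)
    · exact ((Complex.continuous_ofReal.comp_aestronglyMeasurable hV).mul
        (Lp.aestronglyMeasurable _)).mul (Lp.memLp _).star.1
    · have hs : √|V x| * √|V x| = |V x| := Real.mul_self_sqrt (abs_nonneg _)
      simp only [Pi.mul_apply, Pi.star_apply, norm_mul, norm_star, RCLike.norm_conj,
        Complex.norm_real, Real.norm_eq_abs, abs_of_nonneg (Real.sqrt_nonneg _)]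
      linear_combination -(‖(f : Lp ℂ 2 μ) x‖ * ‖(g : Lp ℂ 2 μ) x‖) * hs

theorem form_add_left (hV : AEStronglyMeasurable V μ) (f f' g : formDomain μ X V) :
    form μ X V (f + f') g = form μ X V f g + form μ X V f' g := by
  rw [form, form, form, ← integral_add (form_integrable μ X V hV f g)
    (form_integrable μ X V hV f' g)]
  refine integral_congr_ae ?_
  have h := ae_all_iff.2 fun j => Lp.coeFn_add (weakGrad μ X V j f) (weakGrad μ X V j f')
  filter_upwards [h, Lp.coeFn_add (f : Lp ℂ 2 μ) f'] with x hx hx'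
  simp only [map_add, Submodule.coe_add, hx, hx', Pi.add_apply, add_mul, mul_add,
    Finset.sum_add_distrib]
  ring

theorem form_smul_left (c : ℂ) (f g : formDomain μ X V) :
    form μ X V (c • f) g = c * form μ X V f g := by
  rw [form, form, ← integral_const_mul]
  refine integral_congr_ae ?_
  have h := ae_all_iff.2 fun j => Lp.coeFn_smul c (weakGrad μ X V j f)
  filter_upwards [h, Lp.coeFn_smul c (f : Lp ℂ 2 μ)] with x hx hx'
  simp only [map_smul, Submodule.coe_smul, hx, hx', Pi.smul_apply, smul_eq_mul, mul_add,
    Finset.mul_sum, mul_assoc, mul_left_comm c]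

variable {V} [SecondCountableTopology G] (hV : LocallyIntegrable V μ)

/-- The graph of the operator induced by `Q`: the pairs `(f, h)` with `f ∈ Dom(Q)`, `h ∈ L²` and
`Q(f,g) = ⟨h,g⟩ = ∫ h ḡ dμ` for all `g ∈ Dom(Q)`. -/
def schrodingerGraph : Submodule ℂ (Lp ℂ 2 μ × Lp ℂ 2 μ) where
  carrier := {p | ∃ f : formDomain μ X V, (f : Lp ℂ 2 μ) = p.1 ∧
    ∀ g : formDomain μ X V, form μ X V f g = inner ℂ (g : Lp ℂ 2 μ) p.2}
  zero_mem' := by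
    refine ⟨0, rfl, fun g => ?_⟩
    rw [← zero_smul ℂ (0 : formDomain μ X V), form_smul_left]
    simp
  add_mem' := by
    rintro p q ⟨f, hf, hf'⟩ ⟨f₁, hf₁, hf₁'⟩
    refine ⟨f + f₁, by simp [hf, hf₁], fun g => ?_⟩
    rw [form_add_left μ X V hV.aestronglyMeasurable, hf', hf₁', Prod.snd_add, inner_add_right]
  smul_mem' := by
    rintro c p ⟨f, hf, hf'⟩
    refine ⟨c • f, by simp [hf], fun g => ?_⟩
    rw [form_smul_left, hf', Prod.smul_snd, inner_smul_right]

/-- The Schrödinger operator `H_V` induced by the form `Q` on `L²(μ)`. -/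
def schrodinger : Lp ℂ 2 μ →ₗ.[ℂ] Lp ℂ 2 μ := (schrodingerGraph μ X hV).toLinearPMap

end SubRiem

end

/-!
A discrete spectrum lying above `c - 1` makes the resolvent `R = (H_V - (c - 1))⁻¹` a norm limit of
operators of finite rank, so that `⟨e_k, R e_k⟩ → 0` along any orthonormal sequence. For `e_k` in
the form domain, the Cauchy–Schwarz inequality of the form `Q - (c - 1)` bounds
`(Q(e_k, e_k) - (c - 1)) ⟨e_k, R e_k⟩` from below by `1`, hence `Q(e_k, e_k) → ∞`.

If `x k` leaves every compact set, the left translates by `x k` of a bump function `φ` supported in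
the ball `B(1, r)` have, after passing to a subsequence, disjoint supports, so that they are
orthogonal. As `V ≥ c`, `0 ≤ φ ≤ 1` and the fields are left-invariant, `Q` of the translate by `x`
is at most `∫ V` over `B(x, r) = x • B(1, r)` plus a constant independent of `x`.

Two facts on the distance enter. By Chow's theorem `B(1, r)` is a neighbourhood of the identity,
which makes room for `φ`. By compactness of small balls and a chaining argument, `B(1, r)` is
relatively compact, which makes `∫ V` over it finite. Finally, test functions belong to the form
domain by integration by parts; the divergence of a left-invariant field is constant, its value
being the derivative of the modular function.
-/

namespace SubRiem

/-! ### Resolvents of operators with purely discrete spectrum -/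

section Spectral

variable {H : Type*} [NormedAddCommGroup H] [InnerProductSpace ℂ H]

theorem tendsto_inner_orthonormal_right {e : ℕ → H} (he : Orthonormal ℂ e) (v : H) :
    Tendsto (fun k => inner ℂ (e k) v) atTop (𝓝 0) := by
  have hsq : Tendsto (fun k => ‖inner ℂ (e k) v‖ ^ 2) atTop (𝓝 0) :=
    (he.inner_products_summable v).tendsto_atTop_zero
  rw [tendsto_zero_iff_norm_tendsto_zero]
  simpa [Real.sqrt_sq (norm_nonneg _)] using hsq.sqrt

theorem tendsto_inner_apply_of_finiteDimensional_range {e : ℕ → H} (he : Orthonormal ℂ e)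
    (F : H →L[ℂ] H) [FiniteDimensional ℂ (LinearMap.range (F : H →ₗ[ℂ] H))] :
    Tendsto (fun k => inner ℂ (e k) (F (e k))) atTop (𝓝 0) := by
  let b := stdOrthonormalBasis ℂ (LinearMap.range (F : H →ₗ[ℂ] H))
  have expand : ∀ u : H, F u = ∑ i, inner ℂ (b i : H) (F u) • (b i : H) := fun u => by
    simpa using (congrArg Subtype.val (b.sum_repr' ⟨F u, u, rfl⟩)).symm
  have bound : ∀ i k, ‖inner ℂ (b i : H) (F (e k))‖ ≤ ‖F‖ := fun i k =>
    calc ‖inner ℂ (b i : H) (F (e k))‖ ≤ ‖(b i : H)‖ * ‖F (e k)‖ := norm_inner_le_norm _ _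
      _ ≤ 1 * (‖F‖ * ‖e k‖) := by
        gcongr
        exacts [(b.orthonormal.1 i).le, F.le_opNorm _]
      _ = ‖F‖ := by rw [he.1 k, one_mul, mul_one]
  have hsum : Tendsto (fun k => ∑ i, ‖F‖ * ‖inner ℂ (e k) (b i : H)‖) atTop (𝓝 0) := by
    simpa using tendsto_finsetSum Finset.univ fun i _ =>
      (tendsto_inner_orthonormal_right he (b i : H)).norm.const_mul ‖F‖
  refine squeeze_zero_norm (fun k => ?_) hsum
  rw [expand (e k), inner_sum]
  refine (norm_sum_le _ _).trans (Finset.sum_le_sum fun i _ => ?_)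
  rw [inner_smul_right, norm_mul]
  exact mul_le_mul_of_nonneg_right (bound i k) (norm_nonneg _)

theorem tendsto_inner_apply_of_finiteRank_approx {e : ℕ → H} (he : Orthonormal ℂ e)
    {A : H →L[ℂ] H}
    (hA : ∀ ε > 0, ∃ F : H →L[ℂ] H, ‖A - F‖ ≤ ε ∧
      FiniteDimensional ℂ (LinearMap.range (F : H →ₗ[ℂ] H))) :
    Tendsto (fun k => inner ℂ (e k) (A (e k))) atTop (𝓝 0) := by
  rw [Metric.tendsto_atTop]
  intro ε hε
  obtain ⟨F, hF, _⟩ := hA (ε / 2) (half_pos hε)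
  obtain ⟨N, hN⟩ := Metric.tendsto_atTop.1
    (tendsto_inner_apply_of_finiteDimensional_range he F) _ (half_pos hε)
  refine ⟨N, fun k hk => ?_⟩
  have hFk := hN k hk
  rw [dist_zero_right] at hFk ⊢
  have hAF : ‖inner ℂ (e k) ((A - F) (e k))‖ ≤ ε / 2 :=
    calc ‖inner ℂ (e k) ((A - F) (e k))‖ ≤ ‖e k‖ * ‖(A - F) (e k)‖ := norm_inner_le_norm _ _
      _ ≤ ‖e k‖ * (‖A - F‖ * ‖e k‖) := by gcongr; exact (A - F).le_opNorm _
      _ ≤ ε / 2 := by rwa [he.1 k, mul_one, one_mul]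
  have split : inner ℂ (e k) (A (e k)) =
      inner ℂ (e k) ((A - F) (e k)) + inner ℂ (e k) (F (e k)) := by
    rw [← inner_add_right]; simp
  rw [split]
  exact (norm_add_le _ _).trans_lt (by linarith)

/-- The soft thresholding function: the odd function with value `max (x - ε) 0` at `x ≥ 0`. -/
def softThreshold (ε x : ℝ) : ℝ := x - max (-ε) (min x ε)

theorem continuous_softThreshold (ε : ℝ) : Continuous (softThreshold ε) := by
  unfold softThreshold; fun_prop

theorem abs_sub_softThreshold_le {ε : ℝ} (hε : 0 ≤ ε) (x : ℝ) : |x - softThreshold ε x| ≤ ε := by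
  rw [softThreshold, sub_sub_cancel]
  exact abs_le.2 ⟨le_max_left _ _, max_le (by linarith) (min_le_right _ _)⟩

theorem softThreshold_eq_zero {ε x : ℝ} (hx : |x| ≤ ε) : softThreshold ε x = 0 := by
  rw [softThreshold, min_eq_left (abs_le.1 hx).2, max_eq_right (abs_le.1 hx).1, sub_self]

section CFC

variable [CompleteSpace H] {A : H →L[ℂ] H}

theorem norm_sub_cfc_softThreshold_le (hA : IsSelfAdjoint A) {ε : ℝ} (hε : 0 ≤ ε) :
    ‖A - cfc (softThreshold ε) A‖ ≤ ε := by
  have hk := (continuous_softThreshold ε).continuousOn (s := spectrum ℝ A)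
  calc ‖A - cfc (softThreshold ε) A‖ = ‖cfc (fun x => x - softThreshold ε x) A‖ := by
        rw [cfc_sub (fun x : ℝ => x) (softThreshold ε) A (by fun_prop) hk, cfc_id' ℝ A]
    _ ≤ ε := norm_cfc_le hε fun x _ => abs_sub_softThreshold_le hε x

theorem finiteDimensional_ker_cfc_prod (hA : IsSelfAdjoint A) (S : Finset ℝ)
    (hS : ∀ w ∈ S,
      FiniteDimensional ℂ (LinearMap.ker ((A - (w : ℂ) • 1 : H →L[ℂ] H) : H →ₗ[ℂ] H))) :
    FiniteDimensional ℂ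
      (LinearMap.ker ((cfc (fun x => ∏ w ∈ S, (x - w)) A : H →L[ℂ] H) : H →ₗ[ℂ] H)) := by
  induction S using Finset.induction_on with
  | empty =>
    have hone : cfc (fun x : ℝ => ∏ w ∈ (∅ : Finset ℝ), (x - w)) A = 1 := by
      simpa using cfc_const_one ℝ A
    have hker : LinearMap.ker ((1 : H →L[ℂ] H) : H →ₗ[ℂ] H) = ⊥ := LinearMap.ker_id
    rw [hone, hker]
    infer_instance
  | insert a s ha ih =>
    have hs := ih fun w hw => hS w (Finset.mem_insert_of_mem hw)
    have ha' := hS a (Finset.mem_insert_self a s)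
    have hmul : cfc (fun x => ∏ w ∈ insert a s, (x - w)) A =
        (A - (a : ℂ) • 1) * cfc (fun x => ∏ w ∈ s, (x - w)) A := by
      simp only [Finset.prod_insert ha]
      rw [cfc_mul (fun x : ℝ => x - a) _ A (by fun_prop) (by fun_prop),
        cfc_sub (fun x : ℝ => x) (fun _ => a) A (by fun_prop) (by fun_prop), cfc_id' ℝ A,
        cfc_const a A, Algebra.algebraMap_eq_smul_one]
      rfl
    rw [hmul, ContinuousLinearMap.mul_def, ContinuousLinearMap.toLinearMap_comp,
      LinearMap.ker_comp]
    infer_instance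

theorem finiteDimensional_range_cfc_softThreshold (hA : IsSelfAdjoint A) {ε : ℝ}
    (hfin : {w ∈ spectrum ℝ A | ε ≤ |w|}.Finite)
    (hker : ∀ w ∈ spectrum ℝ A, ε ≤ |w| →
      FiniteDimensional ℂ (LinearMap.ker ((A - (w : ℂ) • 1 : H →L[ℂ] H) : H →ₗ[ℂ] H))) :
    FiniteDimensional ℂ
      (LinearMap.range ((cfc (softThreshold ε) A : H →L[ℂ] H) : H →ₗ[ℂ] H)) := by
  have hprod := finiteDimensional_ker_cfc_prod hA hfin.toFinset fun w hw =>
    hker w (hfin.mem_toFinset.1 hw).1 (hfin.mem_toFinset.1 hw).2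
  have hmul : cfc (fun x => ∏ w ∈ hfin.toFinset, (x - w)) A * cfc (softThreshold ε) A = 0 := by
    rw [← cfc_mul _ _ A (by fun_prop) (continuous_softThreshold ε).continuousOn,
      cfc_congr (g := fun _ => (0 : ℝ)), cfc_const_zero ℝ A]
    intro x hx
    rcases le_or_gt ε |x| with hxε | hxε
    · simp only [Finset.prod_eq_zero (hfin.mem_toFinset.2 ⟨hx, hxε⟩) (sub_self x), zero_mul]
    · simp only [softThreshold_eq_zero hxε.le, mul_zero]
  refine Submodule.finiteDimensional_of_le (S₂ := LinearMap.ker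
    ((cfc (fun x => ∏ w ∈ hfin.toFinset, (x - w)) A : H →L[ℂ] H) : H →ₗ[ℂ] H)) ?_
  rintro _ ⟨u, rfl⟩
  exact congrArg (fun B : H →L[ℂ] H => B u) hmul

end CFC

/-- `R` is the bounded, everywhere defined inverse of `T - z`. -/
def IsResolvent (T : H →ₗ.[ℂ] H) (z : ℂ) (R : H →L[ℂ] H) : Prop :=
  (∀ u : H, ∃ hu : R u ∈ T.domain, T ⟨R u, hu⟩ - z • R u = u) ∧
    ∀ f : T.domain, R (T f - z • (f : H)) = f

namespace IsResolvent

variable {T : H →ₗ.[ℂ] H}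

theorem resolvent_identity {z w : ℂ} {R S : H →L[ℂ] H} (hR : IsResolvent T z R)
    (hS : IsResolvent T w S) : (w - z) • (R * S) = S - R := by
  ext u
  obtain ⟨hu, h⟩ := hS.1 u
  have hTS : T ⟨S u, hu⟩ - z • S u = u + (w - z) • S u := by
    rw [sub_eq_iff_eq_add.1 h]; module
  have hRS : R u + (w - z) • R (S u) = S u := by
    simpa only [hTS, map_add, map_smul] using hR.2 ⟨S u, hu⟩
  exact eq_sub_of_add_eq' hRS

theorem notMem_spectrum {z : ℂ} {R : H →L[ℂ] H} (hR : IsResolvent T z R) {w : ℂ}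
    (hw : w ≠ 0) (hmem : z + w⁻¹ ∈ T.resolventSet) : w ∉ spectrum ℂ R := by
  obtain ⟨S, hS : IsResolvent T (z + w⁻¹) S⟩ := hmem
  have hRS : R * S = w • (S - R) := by
    rw [← hR.resolvent_identity hS, smul_smul]; simp [hw]
  have hSR : S * R = w • (S - R) := by
    rw [← neg_sub R S, ← hS.resolvent_identity hR, ← neg_smul, smul_smul]; simp [hw]
  have hww : w⁻¹ * w⁻¹ * w = w⁻¹ := by field_simp
  rw [spectrum.notMem_iff, Algebra.algebraMap_eq_smul_one]
  refine ⟨⟨w • 1 - R, w⁻¹ • 1 + (w⁻¹ * w⁻¹) • S, ?_, ?_⟩, rfl⟩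
  · simp only [sub_mul, mul_add, smul_mul_assoc, mul_smul_comm, one_mul, mul_one, hRS, smul_smul,
      smul_sub, hww, inv_mul_cancel₀ hw]
    module
  · simp only [mul_sub, add_mul, smul_mul_assoc, mul_smul_comm, one_mul, mul_one, hSR, smul_smul,
      smul_sub, smul_add, mul_comm w, hww, inv_mul_cancel₀ hw]
    module

theorem isSymmetric {z : ℝ} {R : H →L[ℂ] H} (hR : IsResolvent T (z : ℂ) R)
    (hT : ∀ f g : T.domain, inner ℂ (T f) (g : H) = inner ℂ (f : H) (T g)) :
    (R : H →ₗ[ℂ] H).IsSymmetric := by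
  intro u v
  obtain ⟨hu, hTu⟩ := hR.1 u
  obtain ⟨hv, hTv⟩ := hR.1 v
  have hsymm : inner ℂ (T ⟨R u, hu⟩) (R v) = inner ℂ (R u) (T ⟨R v, hv⟩) :=
    hT ⟨R u, hu⟩ ⟨R v, hv⟩
  calc inner ℂ (R u) v = inner ℂ (R u) (T ⟨R v, hv⟩ - (z : ℂ) • R v) := by rw [hTv]
    _ = inner ℂ (T ⟨R u, hu⟩ - (z : ℂ) • R u) (R v) := by
      rw [inner_sub_left, inner_sub_right, inner_smul_left, inner_smul_right,
        Complex.conj_ofReal, hsymm]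
    _ = inner ℂ u (R v) := by rw [hTu]

theorem finiteDimensional_ker {z : ℂ} {R : H →L[ℂ] H} (hR : IsResolvent T z R) {w : ℂ}
    (hw : w ≠ 0) [FiniteDimensional ℂ (T.eigenspace (z + w⁻¹))] :
    FiniteDimensional ℂ (LinearMap.ker ((R - w • 1 : H →L[ℂ] H) : H →ₗ[ℂ] H)) := by
  refine Submodule.finiteDimensional_of_le
    (S₂ := (T.eigenspace (z + w⁻¹)).map T.domain.subtype) fun f hf => ?_
  have hRf : R f = w • f := by simpa [sub_eq_zero] using hf
  have hRwf : R (w⁻¹ • f) = f := by rw [map_smul, hRf, smul_smul, inv_mul_cancel₀ hw, one_smul]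
  obtain ⟨hu, hT⟩ := hR.1 (w⁻¹ • f)
  refine ⟨⟨R (w⁻¹ • f), hu⟩, ?_, hRwf⟩
  have heigen : T ⟨R (w⁻¹ • f), hu⟩ - (z + w⁻¹) • R (w⁻¹ • f) = 0 := by
    rw [sub_eq_iff_eq_add.1 hT, hRwf]; module
  exact LinearMap.mem_ker.2 heigen

variable [CompleteSpace H]

/-- The map `w ↦ z + w⁻¹` sends the compact set in question injectively into the discrete spectrum
of `T`. -/
theorem finite_spectrum {z : ℝ} {R : H →L[ℂ] H} (hR : IsResolvent T (z : ℂ) R)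
    [DiscreteTopology T.unboundedSpectrum] {ε : ℝ} (hε : 0 < ε) :
    {w ∈ spectrum ℝ R | ε ≤ |w|}.Finite := by
  set K := {w ∈ spectrum ℝ R | ε ≤ |w|}
  have hK : IsCompact K :=
    (spectrum.isCompact (𝕜 := ℝ) R).inter_right (isClosed_le continuous_const continuous_abs)
  have hne : ∀ w : K, (w : ℂ) ≠ 0 := fun w =>
    Complex.ofReal_ne_zero.2 (abs_pos.1 (hε.trans_le w.2.2))
  have hmem : ∀ w : K, (z : ℂ) + (w : ℂ)⁻¹ ∈ T.unboundedSpectrum := fun w hw =>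
    hR.notMem_spectrum (hne w) hw ((spectrum.algebraMap_mem_iff ℂ (R := ℝ)).2 w.2.1)
  let φ : K → T.unboundedSpectrum := fun w => ⟨_, hmem w⟩
  have hφ : Continuous φ :=
    (continuous_const.add (Continuous.inv₀ (by fun_prop) hne)).subtype_mk _
  have hinj : Function.Injective φ := fun v w hvw => by
    have hval := congrArg Subtype.val hvw
    simp only [φ, add_right_inj, inv_inj, Complex.ofReal_inj] at hval
    exact Subtype.ext hval
  exact hK.finite ⟨DiscreteTopology.of_continuous_injective hφ hinj⟩

theorem exists_finiteRank_approx {z : ℝ} {R : H →L[ℂ] H} (hR : IsResolvent T (z : ℂ) R)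
    (hT : ∀ f g : T.domain, inner ℂ (T f) (g : H) = inner ℂ (f : H) (T g))
    (hdisc : T.HasPurelyDiscreteSpectrum) {ε : ℝ} (hε : 0 < ε) :
    ∃ F : H →L[ℂ] H, ‖R - F‖ ≤ ε ∧ FiniteDimensional ℂ (LinearMap.range (F : H →ₗ[ℂ] H)) := by
  have := hdisc.1
  have hsa : IsSelfAdjoint R :=
    ContinuousLinearMap.isSelfAdjoint_iff_isSymmetric.2 (hR.isSymmetric hT)
  refine ⟨cfc (softThreshold ε) R, norm_sub_cfc_softThreshold_le hsa hε.le,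
    finiteDimensional_range_cfc_softThreshold hsa (hR.finite_spectrum hε) fun w hw hεw => ?_⟩
  have hw0 : (w : ℂ) ≠ 0 := Complex.ofReal_ne_zero.2 (abs_pos.1 (hε.trans_le hεw))
  have hmem : (z : ℂ) + (w : ℂ)⁻¹ ∈ T.unboundedSpectrum := fun h =>
    hR.notMem_spectrum hw0 h ((spectrum.algebraMap_mem_iff ℂ (R := ℝ)).2 hw)
  have := (hdisc.2 _ hmem).2
  exact hR.finiteDimensional_ker hw0

end IsResolvent

end Spectral

/-! ### Conjugation in a local group -/

section LocalGroup

theorem tendsto_prodMk_left {E : Type*} [TopologicalSpace E] (a b : E) :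
    Tendsto (fun x => (x, b)) (𝓝 a) (𝓝 (a, b)) :=
  (continuous_id.prodMk continuous_const).tendsto a

theorem tendsto_prodMk_right {E : Type*} [TopologicalSpace E] (a b : E) :
    Tendsto (fun x => (a, x)) (𝓝 b) (𝓝 (a, b)) :=
  (continuous_const.prodMk continuous_id).tendsto b

variable {E : Type*} [NormedAddCommGroup E] [NormedSpace ℝ E] {m k : E × E → E} {o : E}

theorem fderiv_eq_id_of_eventuallyEq {f : E → E} {x : E} (h : ∀ᶠ y in 𝓝 x, f y = y) :
    fderiv ℝ f x = ContinuousLinearMap.id ℝ E := by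
  have h' : f =ᶠ[𝓝 x] id := h
  rw [h'.fderiv_eq, fderiv_id]

theorem fderiv_partial_fst {a b : E} (hm : DifferentiableAt ℝ m (a, b)) (v : E) :
    fderiv ℝ (fun y => m (y, b)) a v = fderiv ℝ m (a, b) (v, 0) := by
  have h : fderiv ℝ (fun y => m (y, b)) a = _ := (hm.hasFDerivAt.comp (f := fun y => (y, b)) a
    ((hasFDerivAt_id a).prodMk (hasFDerivAt_const b a))).fderiv
  rw [h]
  simp

theorem fderiv_partial_snd {a b : E} (hm : DifferentiableAt ℝ m (a, b)) (v : E) :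
    fderiv ℝ (fun y => m (a, y)) b v = fderiv ℝ m (a, b) (0, v) := by
  have h : fderiv ℝ (fun y => m (a, y)) b = _ := (hm.hasFDerivAt.comp (f := fun y => (a, y)) b
    ((hasFDerivAt_const a b).prodMk (hasFDerivAt_id b))).fderiv
  rw [h]
  simp

theorem fderiv_apply_fst_of_right_one (hm : DifferentiableAt ℝ m (o, o))
    (h : ∀ᶠ a in 𝓝 o, m (a, o) = a) (v : E) : fderiv ℝ m (o, o) (v, 0) = v := by
  rw [← fderiv_partial_fst hm, fderiv_eq_id_of_eventuallyEq h]
  rfl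

theorem fderiv_apply_snd_of_left_one (hm : DifferentiableAt ℝ m (o, o))
    (h : ∀ᶠ a in 𝓝 o, m (o, a) = a) (v : E) : fderiv ℝ m (o, o) (0, v) = v := by
  rw [← fderiv_partial_snd hm, fderiv_eq_id_of_eventuallyEq h]
  rfl

theorem hasFDerivAt_fderiv_left (hm : ContDiffAt ℝ 2 m (o, o)) (v : E × E) :
    HasFDerivAt (fun a => fderiv ℝ m (a, o) v)
      (((fderiv ℝ (fderiv ℝ m) (o, o)).flip v).comp (ContinuousLinearMap.inl ℝ E E)) o := by
  have hm' : HasFDerivAt (fderiv ℝ m) (fderiv ℝ (fderiv ℝ m) (o, o)) (o, o) :=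
    ((hm.fderiv_right (m := 1) le_rfl).differentiableAt one_ne_zero).hasFDerivAt
  have hleft := HasFDerivAt.comp (f := fun y => (y, o)) o hm'
    ((hasFDerivAt_id o).prodMk (hasFDerivAt_const o o))
  refine (hleft.clm_apply (hasFDerivAt_const v o)).congr_fderiv ?_
  ext w
  simp

theorem hasFDerivAt_fderiv_right (hm : ContDiffAt ℝ 2 m (o, o)) {A : E → E} {A' : E →L[ℝ] E}
    (hA : HasFDerivAt A A' o) :
    HasFDerivAt (fun a => fderiv ℝ m (o, a) (A a, 0))
      ((((fderiv ℝ (fderiv ℝ m) (o, o)).flip (A o, 0)).comp (ContinuousLinearMap.inr ℝ E E)) +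
        ((fderiv ℝ m (o, o)).comp (ContinuousLinearMap.inl ℝ E E)).comp A') o := by
  have hm' : HasFDerivAt (fderiv ℝ m) (fderiv ℝ (fderiv ℝ m) (o, o)) (o, o) :=
    ((hm.fderiv_right (m := 1) le_rfl).differentiableAt one_ne_zero).hasFDerivAt
  have hright := hm'.comp o ((hasFDerivAt_const o o).prodMk (hasFDerivAt_id o))
  refine (hright.clm_apply (hA.prodMk (hasFDerivAt_const (0 : E) o))).congr_fderiv ?_
  ext w
  simp [add_comm]

/-- `k` is, near `(o, o)`, the conjugation `k (a, b) = a b a⁻¹` of the local group law `m` with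
neutral element `o`. Inverses are avoided by asking for `k (a, b) a = a b`. -/
structure IsLocalConjugation (m k : E × E → E) (o : E) : Prop where
  contDiffAt_mul : ContDiffAt ℝ 2 m (o, o)
  contDiffAt_conj : ContDiffAt ℝ 2 k (o, o)
  mul_one : ∀ᶠ a in 𝓝 o, m (a, o) = a
  one_conj : ∀ᶠ a in 𝓝 o, k (o, a) = a
  conj_one : ∀ a, k (a, o) = o
  conj_mul : ∀ᶠ p in 𝓝 (o, o), m (k p, p.1) = m p

namespace IsLocalConjugation

theorem eventually_differentiableAt_mul (h : IsLocalConjugation m k o) :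
    ∀ᶠ p in 𝓝 (o, o), DifferentiableAt ℝ m p :=
  (h.contDiffAt_mul.eventually (by simp)).mono fun _ hp => hp.differentiableAt two_ne_zero

theorem eventually_differentiableAt_conj (h : IsLocalConjugation m k o) :
    ∀ᶠ p in 𝓝 (o, o), DifferentiableAt ℝ k p :=
  (h.contDiffAt_conj.eventually (by simp)).mono fun _ hp => hp.differentiableAt two_ne_zero

/-- The identity `Ad(a) v · a = a · v`, obtained by differentiating `k (a, b) a = a b` in `b`. -/
theorem eventually_fderiv_mul_adjoint (h : IsLocalConjugation m k o) (v : E) :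
    ∀ᶠ a in 𝓝 o, fderiv ℝ m (o, a) (fderiv ℝ k (a, o) (0, v), 0) = fderiv ℝ m (a, o) (0, v) := by
  filter_upwards [(tendsto_prodMk_left o o).eventually h.eventually_differentiableAt_mul,
    (tendsto_prodMk_right o o).eventually h.eventually_differentiableAt_mul,
    (tendsto_prodMk_left o o).eventually h.eventually_differentiableAt_conj,
    (tendsto_prodMk_left o o).eventually h.conj_mul.eventually_nhds] with a hma hmo hka hconj
  have hmk : HasFDerivAt m (fderiv ℝ m (o, a)) (k (a, o), a) := by
    rw [h.conj_one a]; exact hmo.hasFDerivAt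
  have hk := hka.hasFDerivAt.comp o ((hasFDerivAt_const a o).prodMk (hasFDerivAt_id o))
  have hcomp := (hmk.comp o (hk.prodMk (hasFDerivAt_const a o))).fderiv
  have heq : (fun b => m (k (a, b), a)) =ᶠ[𝓝 o] fun b => m (a, b) :=
    (tendsto_prodMk_right a o).eventually hconj
  rw [← fderiv_partial_snd hma v, ← heq.fderiv_eq (𝕜 := ℝ)]
  refine ((congrArg (fun L => L v) hcomp).trans ?_).symm
  simp

theorem hasFDerivAt_adjoint (h : IsLocalConjugation m k o) (v : E) :
    HasFDerivAt (fun a => fderiv ℝ k (a, o) (0, v))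
      (((fderiv ℝ (fderiv ℝ k) (o, o)).flip (0, v)).comp (ContinuousLinearMap.inl ℝ E E)) o :=
  hasFDerivAt_fderiv_left h.contDiffAt_conj (0, v)

theorem fderiv_adjoint (h : IsLocalConjugation m k o) (v x : E) :
    fderiv ℝ (fun a => fderiv ℝ k (a, o) (0, v)) o x =
      fderiv ℝ (fderiv ℝ m) (o, o) (x, 0) (0, v) -
        fderiv ℝ (fderiv ℝ m) (o, o) (v, 0) (0, x) := by
  set A : E → E := fun a => fderiv ℝ k (a, o) (0, v)
  have hA : HasFDerivAt A (fderiv ℝ A o) o := (h.hasFDerivAt_adjoint v).differentiableAt.hasFDerivAt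
  have hAo : A o = v :=
    fderiv_apply_snd_of_left_one h.eventually_differentiableAt_conj.self_of_nhds h.one_conj v
  have hderiv := congrArg (fun L : E →L[ℝ] E => L x)
    ((hasFDerivAt_fderiv_right h.contDiffAt_mul hA).unique
      ((hasFDerivAt_fderiv_left h.contDiffAt_mul (0, v)).congr_of_eventuallyEq
        (h.eventually_fderiv_mul_adjoint v)))
  simp only [add_apply, ContinuousLinearMap.comp_apply, ContinuousLinearMap.flip_apply,
    ContinuousLinearMap.inr_apply, ContinuousLinearMap.inl_apply, hAo,
    fderiv_apply_fst_of_right_one h.eventually_differentiableAt_mul.self_of_nhds h.mul_one]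
    at hderiv
  have hsymm : IsSymmSndFDerivAt ℝ m (o, o) := h.contDiffAt_mul.isSymmSndFDerivAt (by simp)
  rw [hsymm.eq (v, 0) (0, x), ← hderiv]
  abel

end IsLocalConjugation

end LocalGroup

/-! ### The group law in the chart at the identity -/

section ChartCalculus

variable {n : ℕ} {G : Type*} [TopologicalSpace G] [ChartedSpace (EuclideanSpace ℝ (Fin n)) G]
  [Group G]

variable (n G) in
/-- The chart at the identity, as a map to the model vector space. -/
noncomputable def chartOne (x : G) : EuclideanSpace ℝ (Fin n) := extChartAt (𝓡 n) (1 : G) x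

variable (G) in
/-- The inverse of the chart at the identity. -/
noncomputable def chartInv (p : EuclideanSpace ℝ (Fin n)) : G := (extChartAt (𝓡 n) (1 : G)).symm p

variable (n G) in
/-- The image of the identity in the chart; it need not be `0`. -/
noncomputable def chartOrigin : EuclideanSpace ℝ (Fin n) := chartOne n G 1

variable (n G) in
/-- The group law in the chart at the identity, meaningful near `(chartOrigin, chartOrigin)`. -/
noncomputable def chartMul (p : EuclideanSpace ℝ (Fin n) × EuclideanSpace ℝ (Fin n)) :
    EuclideanSpace ℝ (Fin n) := chartOne n G (chartInv G p.1 * chartInv G p.2)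

variable (n G) in
/-- The conjugation `(a, b) ↦ a b a⁻¹` in the chart at the identity, meaningful near
`(chartOrigin, chartOrigin)`. -/
noncomputable def chartConj (p : EuclideanSpace ℝ (Fin n) × EuclideanSpace ℝ (Fin n)) :
    EuclideanSpace ℝ (Fin n) :=
  chartOne n G (chartInv G p.1 * chartInv G p.2 * (chartInv G p.1)⁻¹)

theorem chartInv_origin : chartInv G (chartOrigin n G) = 1 :=
  extChartAt_to_inv (I := 𝓡 n) (1 : G)

variable (n G) in
theorem eventually_chartInv_chartOne : ∀ᶠ x in 𝓝 (1 : G), chartInv G (chartOne n G x) = x := by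
  filter_upwards [extChartAt_source_mem_nhds (I := 𝓡 n) (1 : G)] with x hx
  exact (extChartAt (𝓡 n) (1 : G)).left_inv hx

variable (n G) in
theorem eventually_chartOne_chartInv :
    ∀ᶠ p in 𝓝 (chartOrigin n G), chartOne n G (chartInv G p) = p := by
  filter_upwards [extChartAt_target_mem_nhds (I := 𝓡 n) (1 : G)] with p hp
  exact (extChartAt (𝓡 n) (1 : G)).right_inv hp

theorem chartMul_origin_left :
    ∀ᶠ b in 𝓝 (chartOrigin n G), chartMul n G (chartOrigin n G, b) = b := by
  filter_upwards [eventually_chartOne_chartInv n G] with b hb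
  simpa [chartMul, chartInv_origin] using hb

theorem chartMul_origin_right :
    ∀ᶠ a in 𝓝 (chartOrigin n G), chartMul n G (a, chartOrigin n G) = a := by
  filter_upwards [eventually_chartOne_chartInv n G] with b hb
  simpa [chartMul, chartInv_origin] using hb

theorem contMDiffAt_chartOne :
    ContMDiffAt (𝓡 n) 𝓘(ℝ, EuclideanSpace ℝ (Fin n)) ∞ (chartOne n G) 1 := contMDiffAt_extChartAt

variable (n G) in
theorem tendsto_chartOne : Tendsto (chartOne n G) (𝓝 1) (𝓝 (chartOrigin n G)) :=
  contMDiffAt_chartOne.continuousAt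

theorem contDiffAt_chartOne_comp {F : Type*} [NormedAddCommGroup F] [NormedSpace ℝ F]
    {f : F → G} {x : F} (hf : ContMDiffAt 𝓘(ℝ, F) (𝓡 n) ∞ f x) (hx : f x = 1) :
    ContDiffAt ℝ ∞ (fun y => chartOne n G (f y)) x := by
  have h : ContMDiffAt (𝓡 n) 𝓘(ℝ, EuclideanSpace ℝ (Fin n)) ∞ (chartOne n G) (f x) :=
    hx ▸ contMDiffAt_chartOne
  exact contMDiffAt_iff_contDiffAt.1 (h.comp x hf)

variable [LieGroup (𝓡 n) ∞ G]

theorem contMDiffAt_chartInv :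
    ContMDiffAt 𝓘(ℝ, EuclideanSpace ℝ (Fin n)) (𝓡 n) ∞ (chartInv G) (chartOrigin n G) :=
  (contMDiffOn_extChartAt_symm (I := 𝓡 n) (n := ∞) (1 : G)).contMDiffAt
    (extChartAt_target_mem_nhds (I := 𝓡 n) (1 : G))

variable (n G) in
theorem tendsto_chartInv : Tendsto (chartInv G) (𝓝 (chartOrigin n G)) (𝓝 1) := by
  simpa only [chartInv_origin] using (contMDiffAt_chartInv (n := n) (G := G)).continuousAt.tendsto

theorem contMDiffAt_chartInv_comp {F : Type*} [NormedAddCommGroup F] [NormedSpace ℝ F]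
    {f : F → EuclideanSpace ℝ (Fin n)} {x : F} (hf : ContDiffAt ℝ ∞ f x)
    (hx : f x = chartOrigin n G) :
    ContMDiffAt 𝓘(ℝ, F) (𝓡 n) ∞ (fun y => chartInv G (f y)) x := by
  have h : ContMDiffAt 𝓘(ℝ, EuclideanSpace ℝ (Fin n)) (𝓡 n) ∞ (chartInv G) (f x) :=
    hx ▸ contMDiffAt_chartInv
  exact h.comp x hf.contMDiffAt

variable (n G) in
theorem contDiffAt_chartMul :
    ContDiffAt ℝ ∞ (chartMul n G) (chartOrigin n G, chartOrigin n G) :=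
  contDiffAt_chartOne_comp ((contMDiffAt_chartInv_comp contDiffAt_fst rfl).mul
    (contMDiffAt_chartInv_comp contDiffAt_snd rfl)) (by simp [chartInv_origin])

variable (n G) in
theorem contDiffAt_chartConj :
    ContDiffAt ℝ ∞ (chartConj n G) (chartOrigin n G, chartOrigin n G) :=
  contDiffAt_chartOne_comp (((contMDiffAt_chartInv_comp contDiffAt_fst rfl).mul
    (contMDiffAt_chartInv_comp contDiffAt_snd rfl)).mul
      (contMDiffAt_chartInv_comp contDiffAt_fst rfl).inv) (by simp [chartInv_origin])

theorem chartMul_chartConj : ∀ᶠ p in 𝓝 (chartOrigin n G, chartOrigin n G),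
    chartMul n G (chartConj n G p, p.1) = chartMul n G p := by
  have : IsTopologicalGroup G := topologicalGroup_of_lieGroup (𝓡 n) ∞
  have hfst : Tendsto (fun p : EuclideanSpace ℝ (Fin n) × EuclideanSpace ℝ (Fin n) =>
      chartInv G p.1) (𝓝 (chartOrigin n G, chartOrigin n G)) (𝓝 1) :=
    (tendsto_chartInv n G).comp continuousAt_fst
  have hsnd : Tendsto (fun p : EuclideanSpace ℝ (Fin n) × EuclideanSpace ℝ (Fin n) =>
      chartInv G p.2) (𝓝 (chartOrigin n G, chartOrigin n G)) (𝓝 1) :=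
    (tendsto_chartInv n G).comp continuousAt_snd
  have hconj := (hfst.mul hsnd).mul hfst.inv
  simp only [mul_one, inv_one] at hconj
  filter_upwards [hconj.eventually (eventually_chartInv_chartOne n G)] with p hp
  simp only [chartMul, chartConj, hp, inv_mul_cancel_right]

variable (n G) in
theorem isLocalConjugation_chartConj :
    IsLocalConjugation (chartMul n G) (chartConj n G) (chartOrigin n G) where
  contDiffAt_mul := (contDiffAt_chartMul n G).of_le ENat.LEInfty.out
  contDiffAt_conj := (contDiffAt_chartConj n G).of_le ENat.LEInfty.out
  mul_one := chartMul_origin_right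
  one_conj := by
    filter_upwards [eventually_chartOne_chartInv n G] with b hb
    simpa [chartConj, chartInv_origin] using hb
  conj_one a := by
    rw [chartConj, chartInv_origin]
    simp [chartOrigin]
  conj_mul := chartMul_chartConj

end ChartCalculus

/-! ### Left-invariant fields in the chart at the identity -/

section InvariantFields

variable {n : ℕ} {G : Type*} [TopologicalSpace G] [ChartedSpace (EuclideanSpace ℝ (Fin n)) G]
  [Group G] {F : Type*} [NormedAddCommGroup F] [NormedSpace ℝ F]

theorem hasFDerivAt_comp_chartInv {f : G → F} (hf : MDifferentiableAt (𝓡 n) 𝓘(ℝ, F) f 1) :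
    HasFDerivAt (fun b => f (chartInv G b))
      (mfderiv (𝓡 n) 𝓘(ℝ, F) f 1 : EuclideanSpace ℝ (Fin n) →L[ℝ] F) (chartOrigin n G) := by
  have h := hf.hasMFDerivAt.2
  rw [ModelWithCorners.range_eq_univ] at h
  exact HasFDerivWithinAt.hasFDerivAt h univ_mem

/-- The differential at `g` of a vector-valued function, read by left translation in the chart at
the identity. -/
noncomputable def leftDeriv (f : G → F) (g : G) : EuclideanSpace ℝ (Fin n) →L[ℝ] F :=
  fderiv ℝ (fun b => f (g * chartInv G b)) (chartOrigin n G)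

variable [LieGroup (𝓡 n) ∞ G]

variable (n) in
theorem mdifferentiable_mul_left (g : G) : MDifferentiable (𝓡 n) (𝓡 n) (fun x : G => g * x) :=
  (contMDiff_mul_left (I := 𝓡 n) (n := ∞) (a := g)).mdifferentiable (by simp)

theorem mdifferentiableAt_comp_mul_left {f : G → F} {g : G}
    (hf : MDifferentiableAt (𝓡 n) 𝓘(ℝ, F) f g) :
    MDifferentiableAt (𝓡 n) 𝓘(ℝ, F) (fun x => f (g * x)) (1 : G) := by
  have hf' : MDifferentiableAt (𝓡 n) 𝓘(ℝ, F) f (g * 1) := by rwa [mul_one]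
  exact hf'.comp (1 : G) (mdifferentiable_mul_left n g 1)

theorem mfderiv_mul_left_mulInvariantVectorField (v : GroupLieAlgebra (𝓡 n) G) (g x : G) :
    (mfderiv (𝓡 n) (𝓡 n) (fun y : G => g * y) x (mulInvariantVectorField (I := 𝓡 n) v x) :
      EuclideanSpace ℝ (Fin n)) = mulInvariantVectorField (I := 𝓡 n) v (g * x) := by
  have hcomp := mfderiv_comp (I' := 𝓡 n) (1 : G) (mdifferentiable_mul_left n g (x * 1))
    (mdifferentiable_mul_left n x 1)
  have hmul : (fun y : G => g * x * y) = (fun y : G => g * y) ∘ fun y : G => x * y := by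
    ext y
    simp [mul_assoc]
  have hbase : ∀ (y : G) (w : EuclideanSpace ℝ (Fin n)), y = x →
      (mfderiv (𝓡 n) (𝓡 n) (fun y : G => g * y) x w : EuclideanSpace ℝ (Fin n)) =
        mfderiv (𝓡 n) (𝓡 n) (fun y : G => g * y) y w := fun y w hy => by rw [hy]
  have hright : (mfderiv (𝓡 n) (𝓡 n) (fun y : G => g * x * y) 1 v : EuclideanSpace ℝ (Fin n)) =
      mfderiv (𝓡 n) (𝓡 n) ((fun y : G => g * y) ∘ fun y : G => x * y) 1 v := by
    rw [hmul]
    rfl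
  exact (hbase (x * 1) _ (mul_one x)).trans
    ((congrArg (fun L => L v) hcomp).symm.trans hright.symm)

theorem mfderiv_apply_mulInvariantVectorField {f : G → F} {g : G}
    (hf : MDifferentiableAt (𝓡 n) 𝓘(ℝ, F) f g) (v : GroupLieAlgebra (𝓡 n) G) :
    (mfderiv (𝓡 n) 𝓘(ℝ, F) f g (mulInvariantVectorField (I := 𝓡 n) v g) : F) =
      mfderiv (𝓡 n) 𝓘(ℝ, F) (fun x => f (g * x)) (1 : G) v := by
  have hf' : MDifferentiableAt (𝓡 n) 𝓘(ℝ, F) f (g * 1) := by rwa [mul_one]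
  have hcomp : (mfderiv (𝓡 n) 𝓘(ℝ, F) (fun x => f (g * x)) (1 : G) v : F) =
      mfderiv (𝓡 n) 𝓘(ℝ, F) f (g * 1) (mfderiv (𝓡 n) (𝓡 n) (fun x : G => g * x) 1 v) :=
    congrArg (fun L => L v) (mfderiv_comp (1 : G) hf' (mdifferentiable_mul_left n g 1))
  have hbase : ∀ (y : G) (w : EuclideanSpace ℝ (Fin n)), y = g →
      (mfderiv (𝓡 n) 𝓘(ℝ, F) f g w : F) = mfderiv (𝓡 n) 𝓘(ℝ, F) f y w :=
    fun y w hy => by rw [hy]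
  exact (hbase (g * 1) _ (mul_one g)).trans hcomp.symm

theorem hasFDerivAt_mul_chartInv {f : G → F} {g : G} (hf : MDifferentiableAt (𝓡 n) 𝓘(ℝ, F) f g) :
    HasFDerivAt (fun b => f (g * chartInv G b)) (leftDeriv (n := n) f g) (chartOrigin n G) :=
  (hasFDerivAt_comp_chartInv (mdifferentiableAt_comp_mul_left hf)).differentiableAt
    (E := EuclideanSpace ℝ (Fin n)) |>.hasFDerivAt

theorem mfderiv_mulInvariantVectorField_eq_leftDeriv {f : G → F} {g : G}
    (hf : MDifferentiableAt (𝓡 n) 𝓘(ℝ, F) f g) (v : GroupLieAlgebra (𝓡 n) G) :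
    (mfderiv (𝓡 n) 𝓘(ℝ, F) f g (mulInvariantVectorField (I := 𝓡 n) v g) : F) =
      leftDeriv (n := n) f g v :=
  (mfderiv_apply_mulInvariantVectorField hf v).trans
    (congrArg (fun L : EuclideanSpace ℝ (Fin n) →L[ℝ] F => L v)
      (HasFDerivAt.fderiv (E := EuclideanSpace ℝ (Fin n))
        (hasFDerivAt_comp_chartInv (mdifferentiableAt_comp_mul_left hf)))).symm

variable (n G) in
theorem eventually_differentiableAt_chartMul :
    ∀ᶠ p in 𝓝 (chartOrigin n G), DifferentiableAt ℝ (chartMul n G) (p, chartOrigin n G) :=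
  (tendsto_prodMk_left _ _).eventually
    (isLocalConjugation_chartConj n G).eventually_differentiableAt_mul

variable (G) in
/-- The left-invariant field with value `v` at the identity, in the chart at the identity. -/
noncomputable def chartField (v p : EuclideanSpace ℝ (Fin n)) : EuclideanSpace ℝ (Fin n) :=
  fderiv ℝ (chartMul n G) (p, chartOrigin n G) (0, v)

theorem chartField_origin (v : EuclideanSpace ℝ (Fin n)) :
    chartField G v (chartOrigin n G) = v :=
  fderiv_apply_snd_of_left_one (eventually_differentiableAt_chartMul n G).self_of_nhds
    chartMul_origin_left v

theorem fderiv_chartField (v w : EuclideanSpace ℝ (Fin n)) :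
    fderiv ℝ (chartField G v) (chartOrigin n G) w =
      fderiv ℝ (fderiv ℝ (chartMul n G)) (chartOrigin n G, chartOrigin n G) (w, 0) (0, v) :=
  congrArg (fun L => L w)
    (hasFDerivAt_fderiv_left (isLocalConjugation_chartConj n G).contDiffAt_mul (0, v)).fderiv

theorem lieBracket_chartField (x v : EuclideanSpace ℝ (Fin n)) :
    VectorField.lieBracket ℝ (chartField G x) (chartField G v) (chartOrigin n G) =
      fderiv ℝ (fderiv ℝ (chartMul n G)) (chartOrigin n G, chartOrigin n G) (x, 0) (0, v) -
        fderiv ℝ (fderiv ℝ (chartMul n G)) (chartOrigin n G, chartOrigin n G) (v, 0) (0, x) := by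
  simp only [VectorField.lieBracket, chartField_origin, fderiv_chartField]

theorem eventually_leftDeriv_chartOne (v : EuclideanSpace ℝ (Fin n)) :
    ∀ᶠ g in 𝓝 (1 : G), leftDeriv (chartOne n G) g v = chartField G v (chartOne n G g) := by
  filter_upwards [eventually_chartInv_chartOne n G,
    (tendsto_chartOne n G).eventually (eventually_differentiableAt_chartMul n G)] with g hg hdiff
  rw [chartField, ← fderiv_partial_snd hdiff v, leftDeriv]
  simp only [chartMul, hg]

theorem eventually_mfderiv_chartOne_mulInvariantVectorField (v : GroupLieAlgebra (𝓡 n) G) :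
    ∀ᶠ g in 𝓝 (1 : G), (mfderiv (𝓡 n) 𝓘(ℝ, EuclideanSpace ℝ (Fin n)) (chartOne n G) g
      (mulInvariantVectorField (I := 𝓡 n) v g) : EuclideanSpace ℝ (Fin n)) =
      chartField G v (chartOne n G g) := by
  filter_upwards [chart_source_mem_nhds (EuclideanSpace ℝ (Fin n)) (1 : G),
    eventually_leftDeriv_chartOne (G := G) v] with g hg hderiv
  exact (mfderiv_mulInvariantVectorField_eq_leftDeriv (mdifferentiableAt_extChartAt hg) v).trans
    hderiv

theorem mpullbackWithin_mulInvariantVectorField_eventuallyEq (v : GroupLieAlgebra (𝓡 n) G) :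
    VectorField.mpullbackWithin 𝓘(ℝ, EuclideanSpace ℝ (Fin n)) (𝓡 n)
        (extChartAt (𝓡 n) (1 : G)).symm (mulInvariantVectorField v) (range (𝓡 n))
      =ᶠ[𝓝 (chartOrigin n G)] chartField G v := by
  filter_upwards [extChartAt_target_mem_nhds (I := 𝓡 n) (1 : G),
    (tendsto_chartInv n G).eventually (eventually_mfderiv_chartOne_mulInvariantVectorField v),
    eventually_chartOne_chartInv n G] with p hp hfield hinv
  rw [hinv] at hfield
  rw [← hfield, VectorField.mpullbackWithin_apply,
    ContinuousLinearMap.inverse_eq (mfderivWithin_extChartAt_symm_comp_mfderiv_extChartAt hp)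
      (mfderiv_extChartAt_comp_mfderivWithin_extChartAt_symm hp)]
  rfl

theorem inverse_mfderiv_extChartAt_one_apply (w : EuclideanSpace ℝ (Fin n)) :
    (mfderiv (𝓡 n) 𝓘(ℝ, EuclideanSpace ℝ (Fin n)) (extChartAt (𝓡 n) (1 : G)) 1).inverse w = w := by
  have hid : mfderiv (𝓡 n) 𝓘(ℝ, EuclideanSpace ℝ (Fin n)) (extChartAt (𝓡 n) (1 : G)) 1 =
    ContinuousLinearMap.id ℝ (EuclideanSpace ℝ (Fin n)) := mfderiv_extChartAt_self
  rw [hid]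
  exact congrArg (fun L : EuclideanSpace ℝ (Fin n) →L[ℝ] EuclideanSpace ℝ (Fin n) => L w)
    ContinuousLinearMap.inverse_id

theorem bracket_eq_lieBracket_chartField (x v : GroupLieAlgebra (𝓡 n) G) :
    (⁅x, v⁆ : GroupLieAlgebra (𝓡 n) G) =
      (VectorField.lieBracket ℝ (chartField G x) (chartField G v) (chartOrigin n G) :
        EuclideanSpace ℝ (Fin n)) := by
  have hset : (extChartAt (𝓡 n) (1 : G)).symm ⁻¹' univ ∩ range (𝓡 n) = univ := by
    rw [ModelWithCorners.range_eq_univ, preimage_univ, inter_univ]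
  refine Eq.trans ?_ (Filter.EventuallyEq.lieBracket_vectorField_eq (𝕜 := ℝ)
    (E := EuclideanSpace ℝ (Fin n)) (mpullbackWithin_mulInvariantVectorField_eventuallyEq x)
    (mpullbackWithin_mulInvariantVectorField_eventuallyEq v))
  refine (inverse_mfderiv_extChartAt_one_apply _).trans ?_
  rw [hset]
  exact congrFun (VectorField.lieBracketWithin_univ (𝕜 := ℝ) (E := EuclideanSpace ℝ (Fin n)))
    (chartOrigin n G)

theorem bracket_eq_fderiv_adjoint (x v : GroupLieAlgebra (𝓡 n) G) :
    (⁅x, v⁆ : GroupLieAlgebra (𝓡 n) G) =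
      (fderiv ℝ (fun a => fderiv ℝ (chartConj n G) (a, chartOrigin n G) (0, v))
        (chartOrigin n G) x : EuclideanSpace ℝ (Fin n)) :=
  (bracket_eq_lieBracket_chartField x v).trans
    ((lieBracket_chartField (G := G) x v).trans
      ((isLocalConjugation_chartConj n G).fderiv_adjoint v x).symm)

end InvariantFields

/-! ### Chow's theorem for length functions -/

theorem eq_top_of_lieSpan_eq_top {R L : Type*} [CommRing R] [LieRing L] [LieAlgebra R L]
    {𝓗 W : Submodule R L} (h𝓗 : LieSubalgebra.lieSpan R L (𝓗 : Set L) = ⊤) (hle : 𝓗 ≤ W)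
    (hW : ∀ x ∈ 𝓗, ∀ w ∈ W, ⁅x, w⁆ ∈ W) : W = ⊤ := by
  let normalizer : LieSubalgebra R L :=
    { carrier := {x | ∀ w ∈ W, ⁅x, w⁆ ∈ W}
      add_mem' := fun {a b} ha hb w hw => by
        rw [add_lie]
        exact W.add_mem (ha w hw) (hb w hw)
      zero_mem' := fun w _ => by
        rw [zero_lie]
        exact W.zero_mem
      smul_mem' := fun c a ha w hw => by
        rw [smul_lie]
        exact W.smul_mem c (ha w hw)
      lie_mem' := fun {a b} ha hb w hw => by
        rw [lie_lie]
        exact W.sub_mem (ha _ (hb w hw)) (hb _ (ha w hw)) }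
  have hnorm : normalizer = ⊤ := by
    rw [eq_top_iff, ← h𝓗, LieSubalgebra.lieSpan_le]
    exact fun x hx w hw => hW x hx w hw
  let subalgebra : LieSubalgebra R L :=
    { W with lie_mem' := fun {a b} _ hb => (hnorm ▸ LieSubalgebra.mem_top a : a ∈ normalizer) b hb }
  have hsub : subalgebra = ⊤ := by
    rw [eq_top_iff, ← h𝓗, LieSubalgebra.lieSpan_le]
    exact fun x hx => hle hx
  exact eq_top_iff.2 fun x _ => (hsub ▸ LieSubalgebra.mem_top x : x ∈ subalgebra)

theorem mem_of_hasDerivAt {E : Type*} [NormedAddCommGroup E] [NormedSpace ℝ E]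
    [FiniteDimensional ℝ E] (W : Submodule ℝ E) {f : ℝ → E} {f' : E} {t : ℝ}
    (hf : HasDerivAt f f' t) (hW : ∀ᶠ s in 𝓝 t, f s ∈ W) : f' ∈ W := by
  refine W.closed_of_finiteDimensional.mem_of_tendsto (hasDerivAt_iff_tendsto_slope.1 hf) ?_
  filter_upwards [hW.filter_mono nhdsWithin_le_nhds] with s hs
  exact W.smul_mem _ (W.sub_mem hs hW.self_of_nhds)

theorem exists_basis_mem_of_span_eq_top {K E : Type*} [Field K] [AddCommGroup E] [Module K E]
    [FiniteDimensional K E] {S : Set E} (hS : Submodule.span K S = ⊤) :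
    ∃ b : Module.Basis (Fin (Module.finrank K E)) K E, ∀ i, b i ∈ S := by
  let b := Module.Basis.ofSpan hS.ge
  have : Fintype _ := FiniteDimensional.fintypeBasisIndex b
  let e := Fintype.equivFinOfCardEq (Module.finrank_eq_card_basis b).symm
  refine ⟨b.reindex e, fun i => ?_⟩
  rw [Module.Basis.reindex_apply]
  exact Module.Basis.ofSpan_subset hS.ge ⟨_, rfl⟩

/-- A symmetric subadditive length on a group; points may be at infinite distance from `1`. -/
structure IsGroupLength {G : Type*} [Group G] (ℓ : G → ℝ≥0∞) : Prop where
  map_one : ℓ 1 = 0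
  map_inv : ∀ x, ℓ x⁻¹ = ℓ x
  map_mul_le : ∀ x y, ℓ (x * y) ≤ ℓ x + ℓ y

theorem IsGroupLength.list_prod_le {G : Type*} [Group G] {ℓ : G → ℝ≥0∞} (hℓ : IsGroupLength ℓ)
    {η : ℝ≥0∞} (l : List G) (hl : ∀ x ∈ l, ℓ x ≤ η) : ℓ l.prod ≤ l.length * η := by
  induction l with
  | nil => simp [hℓ.map_one]
  | cons x l ih =>
    rw [List.forall_mem_cons] at hl
    calc ℓ (x :: l).prod ≤ ℓ x + ℓ l.prod := by
          rw [List.prod_cons]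
          exact hℓ.map_mul_le x l.prod
      _ ≤ η + l.length * η := add_le_add hl.1 (ih hl.2)
      _ = (x :: l).length * η := by
          rw [List.length_cons, Nat.cast_succ, add_mul, one_mul, add_comm]

section Chow

variable {n : ℕ} {G : Type*} [TopologicalSpace G] [ChartedSpace (EuclideanSpace ℝ (Fin n)) G]
  [Group G]

/-- `c` is a curve through the identity, strictly differentiable there with velocity `v`. -/
structure HasVelocityOne (c : ℝ → G) (v : GroupLieAlgebra (𝓡 n) G) : Prop where
  zero : c 0 = 1
  continuousAt : ContinuousAt c 0
  hasStrictDerivAt : HasStrictDerivAt (fun t => chartOne n G (c t))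
    (v : EuclideanSpace ℝ (Fin n)) 0

theorem HasVelocityOne.tendsto {c : ℝ → G} {v : GroupLieAlgebra (𝓡 n) G}
    (hc : HasVelocityOne c v) : Tendsto c (𝓝 0) (𝓝 1) :=
  hc.zero ▸ hc.continuousAt

theorem list_prod_curve_zero {ι : Type*} {c : ι → ℝ → G}
    {v : ι → GroupLieAlgebra (𝓡 n) G} (hc : ∀ i, HasVelocityOne (c i) (v i)) (l : List ι) :
    (l.map fun i => c i 0).prod = 1 := by
  simp [fun i => (hc i).zero]

variable (n) in
/-- The velocities at the identity of the curves whose length `ℓ` stays below some `ε' < ε`. The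
gap between `ε'` and `ε` makes this set stable under conjugation by elements of small length. -/
def tangentDirs (ℓ : G → ℝ≥0∞) (ε : ℝ≥0∞) : Set (GroupLieAlgebra (𝓡 n) G) :=
  {v | ∃ ε' < ε, ∃ c : ℝ → G, HasVelocityOne c v ∧ ∀ᶠ t in 𝓝 0, ℓ (c t) ≤ ε'}

variable [LieGroup (𝓡 n) ∞ G] {ℓ : G → ℝ≥0∞} {ε : ℝ≥0∞}

theorem HasVelocityOne.conj {c : ℝ → G} {v : GroupLieAlgebra (𝓡 n) G} (hc : HasVelocityOne c v)
    {a : EuclideanSpace ℝ (Fin n)}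
    (ha : ContDiffAt ℝ 2 (chartConj n G) (a, chartOrigin n G)) :
    HasVelocityOne (fun t => chartInv G a * c t * (chartInv G a)⁻¹)
      (fderiv ℝ (chartConj n G) (a, chartOrigin n G) (0, v) : EuclideanSpace ℝ (Fin n)) := by
  have : IsTopologicalGroup G := topologicalGroup_of_lieGroup (𝓡 n) ∞
  refine ⟨by simp [hc.zero], (continuousAt_const.mul hc.continuousAt).mul continuousAt_const, ?_⟩
  have hconj : HasStrictFDerivAt (chartConj n G)
      (fderiv ℝ (chartConj n G) (a, chartOrigin n G)) (a, chartOne n G (c 0)) := by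
    rw [hc.zero]
    exact ha.hasStrictFDerivAt two_ne_zero
  refine (hconj.comp_hasStrictDerivAt (0 : ℝ)
    ((hasStrictDerivAt_const (0 : ℝ) a).prodMk hc.hasStrictDerivAt)).congr_of_eventuallyEq ?_
  filter_upwards [hc.tendsto.eventually (eventually_chartInv_chartOne n G)] with t ht
  simp only [Function.comp_apply, chartConj, ht]

theorem IsGroupLength.eventually_adjoint_mem_tangentDirs (hℓ : IsGroupLength ℓ)
    {v : GroupLieAlgebra (𝓡 n) G} {γ : ℝ → G} (hγ : Tendsto γ (𝓝 0) (𝓝 1))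
    (hγℓ : Tendsto (fun t => ℓ (γ t)) (𝓝 0) (𝓝 0)) (hv : v ∈ tangentDirs n ℓ ε) :
    ∀ᶠ t in 𝓝 0, (fderiv ℝ (chartConj n G) (chartOne n G (γ t), chartOrigin n G) (0, v) :
      EuclideanSpace ℝ (Fin n)) ∈ tangentDirs n ℓ ε := by
  obtain ⟨ε', hε', c, hc, hcℓ⟩ := hv
  have hgap : Tendsto (fun t => ℓ (γ t) + ε' + ℓ (γ t)) (𝓝 0) (𝓝 ε') := by
    simpa using (hγℓ.add_const ε').add hγℓ
  have hconj : ∀ᶠ a in 𝓝 (chartOrigin n G),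
      ContDiffAt ℝ 2 (chartConj n G) (a, chartOrigin n G) :=
    (tendsto_prodMk_left _ _).eventually
      ((isLocalConjugation_chartConj n G).contDiffAt_conj.eventually (by simp))
  filter_upwards [((tendsto_chartOne n G).comp hγ).eventually hconj,
    hγ.eventually (eventually_chartInv_chartOne n G),
    hgap.eventually (gt_mem_nhds hε')] with t hsmooth hinv hlt
  refine ⟨_, hlt, _, hc.conj hsmooth, ?_⟩
  filter_upwards [hcℓ] with s hs
  calc ℓ (chartInv G (chartOne n G (γ t)) * c s * (chartInv G (chartOne n G (γ t)))⁻¹)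
      ≤ ℓ (γ t * c s) + ℓ (γ t)⁻¹ := by
        rw [hinv]
        exact hℓ.map_mul_le _ _
    _ ≤ ℓ (γ t) + ε' + ℓ (γ t) := by
        rw [hℓ.map_inv]
        gcongr
        exact (hℓ.map_mul_le _ _).trans (by gcongr)

theorem IsGroupLength.bracket_mem_span_tangentDirs (hℓ : IsGroupLength ℓ)
    {x v : GroupLieAlgebra (𝓡 n) G} {γ : ℝ → G} (hγ : HasVelocityOne γ x)
    (hγℓ : Tendsto (fun t => ℓ (γ t)) (𝓝 0) (𝓝 0)) (hv : v ∈ tangentDirs n ℓ ε) :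
    ⁅x, v⁆ ∈ Submodule.span ℝ (tangentDirs n ℓ ε) := by
  have hAd : HasFDerivAt (fun a => fderiv ℝ (chartConj n G) (a, chartOrigin n G) (0, v))
      (fderiv ℝ (fun a => fderiv ℝ (chartConj n G) (a, chartOrigin n G) (0, v))
        (chartOrigin n G)) (chartOne n G (γ 0)) := by
    rw [hγ.zero]
    exact ((isLocalConjugation_chartConj n G).hasFDerivAt_adjoint v).differentiableAt.hasFDerivAt
  have hderiv : HasDerivAt (fun t => fderiv ℝ (chartConj n G)
      (chartOne n G (γ t), chartOrigin n G) (0, v)) (⁅x, v⁆ : GroupLieAlgebra (𝓡 n) G) 0 := by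
    rw [bracket_eq_fderiv_adjoint]
    exact hAd.comp_hasDerivAt (0 : ℝ) hγ.hasStrictDerivAt.hasDerivAt
  refine mem_of_hasDerivAt (E := EuclideanSpace ℝ (Fin n))
    (Submodule.span ℝ (tangentDirs n ℓ ε)) hderiv ?_
  filter_upwards [hℓ.eventually_adjoint_mem_tangentDirs hγ.tendsto hγℓ hv] with t ht
  exact Submodule.subset_span ht

theorem IsGroupLength.span_tangentDirs_eq_top (hℓ : IsGroupLength ℓ)
    {𝓗 : Submodule ℝ (GroupLieAlgebra (𝓡 n) G)}
    (h𝓗 : LieSubalgebra.lieSpan ℝ (GroupLieAlgebra (𝓡 n) G)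
      (𝓗 : Set (GroupLieAlgebra (𝓡 n) G)) = ⊤)
    (hcurve : ∀ x ∈ 𝓗, ∃ γ : ℝ → G,
      HasVelocityOne γ x ∧ Tendsto (fun t => ℓ (γ t)) (𝓝 0) (𝓝 0))
    (hε : 0 < ε) : Submodule.span ℝ (tangentDirs n ℓ ε) = ⊤ := by
  refine eq_top_of_lieSpan_eq_top h𝓗 (fun x hx => ?_) fun x hx w hw => ?_
  · obtain ⟨γ, hγ, hγℓ⟩ := hcurve x hx
    obtain ⟨ε', hε'0, hε'⟩ := exists_between hε
    exact Submodule.subset_span ⟨ε', hε', γ, hγ, hγℓ.eventually_le_const hε'0⟩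
  · obtain ⟨γ, hγ, hγℓ⟩ := hcurve x hx
    induction hw using Submodule.span_induction with
    | mem v hv => exact hℓ.bracket_mem_span_tangentDirs hγ hγℓ hv
    | zero =>
      rw [lie_zero]
      exact Submodule.zero_mem _
    | add a b _ _ ha hb =>
      rw [lie_add]
      exact Submodule.add_mem _ ha hb
    | smul c a _ ha =>
      rw [lie_smul]
      exact Submodule.smul_mem _ c ha

theorem hasStrictFDerivAt_chartOne_mul {F : Type*} [NormedAddCommGroup F] [NormedSpace ℝ F]
    {f g : F → G} {f' g' : F →L[ℝ] EuclideanSpace ℝ (Fin n)} {x : F}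
    (hfx : Tendsto f (𝓝 x) (𝓝 1)) (hgx : Tendsto g (𝓝 x) (𝓝 1)) (hf1 : f x = 1) (hg1 : g x = 1)
    (hf : HasStrictFDerivAt (fun y => chartOne n G (f y)) f' x)
    (hg : HasStrictFDerivAt (fun y => chartOne n G (g y)) g' x) :
    HasStrictFDerivAt (fun y => chartOne n G (f y * g y)) (f' + g') x := by
  have hlocal := isLocalConjugation_chartConj n G
  have hmul : HasStrictFDerivAt (chartMul n G) (fderiv ℝ (chartMul n G)
      (chartOrigin n G, chartOrigin n G)) (chartOne n G (f x), chartOne n G (g x)) := by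
    rw [hf1, hg1]
    exact hlocal.contDiffAt_mul.hasStrictFDerivAt two_ne_zero
  have hdiff := hlocal.eventually_differentiableAt_mul.self_of_nhds
  have hsum : (fderiv ℝ (chartMul n G) (chartOrigin n G, chartOrigin n G)).comp (f'.prod g')
      = f' + g' := by
    ext1 w
    have hsplit : (f' w, g' w) = (f' w, 0) + (0, g' w) := by simp
    rw [ContinuousLinearMap.comp_apply, ContinuousLinearMap.prod_apply, hsplit, map_add,
      fderiv_apply_fst_of_right_one hdiff chartMul_origin_right,
      fderiv_apply_snd_of_left_one hdiff chartMul_origin_left, add_apply]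
  refine (hsum ▸ hmul.comp x (hf.prodMk hg)).congr_of_eventuallyEq ?_
  filter_upwards [hfx.eventually (eventually_chartInv_chartOne n G),
    hgx.eventually (eventually_chartInv_chartOne n G)] with y hfy hgy
  simp only [chartMul, hfy, hgy]

section ListProd

variable {ι : Type*} {c : ι → ℝ → G} {v : ι → EuclideanSpace ℝ (Fin n)}

theorem tendsto_list_prod_curve (hc : ∀ i, HasVelocityOne (c i) (v i)) (l : List ι) :
    Tendsto (fun t : ι → ℝ => (l.map fun i => c i (t i)).prod) (𝓝 0) (𝓝 1) := by
  have : IsTopologicalGroup G := topologicalGroup_of_lieGroup (𝓡 n) ∞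
  simpa using tendsto_list_prod (f := fun i (t : ι → ℝ) => c i (t i)) l fun i _ =>
    (hc i).tendsto.comp ((continuous_apply i).tendsto (0 : ι → ℝ))

theorem hasStrictFDerivAt_chartOne_list_prod [Finite ι]
    (hc : ∀ i, HasVelocityOne (c i) (v i)) (l : List ι) :
    HasStrictFDerivAt (fun t : ι → ℝ => chartOne n G (l.map fun i => c i (t i)).prod)
      (l.map fun i => (ContinuousLinearMap.proj (R := ℝ) (φ := fun _ : ι => ℝ) i).smulRight
        (v i)).sum 0 := by
  cases nonempty_fintype ι
  induction l with
  | nil => exact hasStrictFDerivAt_const (𝕜 := ℝ) (chartOne n G 1) (0 : ι → ℝ)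
  | cons i l ih =>
    have hcoord : HasStrictFDerivAt (fun t : ι → ℝ => chartOne n G (c i (t i)))
        ((ContinuousLinearMap.proj (R := ℝ) (φ := fun _ : ι => ℝ) i).smulRight (v i)) 0 := by
      refine (HasStrictFDerivAt.comp (f := fun t : ι → ℝ => t i)
        (g := fun s => chartOne n G (c i s)) (0 : ι → ℝ)
        (hc i).hasStrictDerivAt.hasStrictFDerivAt
        (ContinuousLinearMap.proj (R := ℝ) (φ := fun _ : ι => ℝ) i).hasStrictFDerivAt).congr_fderiv
        ?_
      ext w j
      simp
    simp only [List.map_cons, List.prod_cons, List.sum_cons]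
    exact hasStrictFDerivAt_chartOne_mul
      ((hc i).tendsto.comp ((continuous_apply i).tendsto (0 : ι → ℝ)))
      (tendsto_list_prod_curve hc l) (hc i).zero (list_prod_curve_zero hc l) hcoord ih

theorem nhds_one_le_map_list_prod [Fintype ι] (b : Module.Basis ι ℝ (EuclideanSpace ℝ (Fin n)))
    (hc : ∀ i, HasVelocityOne (c i) (b i)) :
    𝓝 (1 : G) ≤
      map (fun t : ι → ℝ => (Finset.univ.toList.map fun i => c i (t i)).prod) (𝓝 0) := by
  set P : (ι → ℝ) → G := fun t => (Finset.univ.toList.map fun i => c i (t i)).prod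
  have hsurj : Function.Surjective ((Finset.univ.toList.map fun i =>
      (ContinuousLinearMap.proj (R := ℝ) (φ := fun _ => ℝ) i).smulRight (b i)).sum) := by
    intro w
    refine ⟨fun i => b.repr w i, ?_⟩
    rw [Finset.sum_map_toList]
    simp [b.sum_repr w]
  have hmap : map (fun t => chartOne n G (P t)) (𝓝 0) = 𝓝 (chartOrigin n G) := by
    rw [(hasStrictFDerivAt_chartOne_list_prod hc Finset.univ.toList).map_nhds_eq_of_surj
      (LinearMap.range_eq_top.2 hsurj)]
    exact congrArg (fun g => 𝓝 (chartOne n G g)) (list_prod_curve_zero hc _)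
  intro S hS
  have hchart : ∀ᶠ p in 𝓝 (chartOrigin n G), chartInv G p ∈ S := by
    rw [← hmap, eventually_map]
    filter_upwards [hS, (tendsto_list_prod_curve hc Finset.univ.toList).eventually
      (eventually_chartInv_chartOne n G)] with t ht hinv
    rwa [hinv]
  filter_upwards [(tendsto_chartOne n G).eventually hchart, eventually_chartInv_chartOne n G]
    with g hg hinv
  rwa [hinv] at hg

end ListProd

/-- **Chow's theorem.** -/
theorem IsGroupLength.tendsto_nhds_one (hℓ : IsGroupLength ℓ)
    {𝓗 : Submodule ℝ (GroupLieAlgebra (𝓡 n) G)}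
    (h𝓗 : LieSubalgebra.lieSpan ℝ (GroupLieAlgebra (𝓡 n) G)
      (𝓗 : Set (GroupLieAlgebra (𝓡 n) G)) = ⊤)
    (hcurve : ∀ x ∈ 𝓗, ∃ γ : ℝ → G,
      HasVelocityOne γ x ∧ Tendsto (fun t => ℓ (γ t)) (𝓝 0) (𝓝 0)) :
    Tendsto ℓ (𝓝 1) (𝓝 0) := by
  refine ENNReal.tendsto_nhds_zero.2 fun ε hε => ?_
  let S : Set (EuclideanSpace ℝ (Fin n)) := tangentDirs n ℓ (ε / n)
  have hS : Submodule.span ℝ S = ⊤ :=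
    hℓ.span_tangentDirs_eq_top h𝓗 hcurve (ENNReal.div_pos hε.ne' (ENNReal.natCast_ne_top n))
  obtain ⟨b, hb⟩ := exists_basis_mem_of_span_eq_top hS
  choose ε' hε' c hc hcℓ using hb
  refine nhds_one_le_map_list_prod b hc (mem_map.2 ?_)
  have hsmall : ∀ᶠ t : Fin (Module.finrank ℝ (EuclideanSpace ℝ (Fin n))) → ℝ in 𝓝 0,
      ∀ i, ℓ (c i (t i)) ≤ ε' i := by
    refine eventually_all.2 fun i => ?_
    have hi : Tendsto (fun t : Fin (Module.finrank ℝ (EuclideanSpace ℝ (Fin n))) → ℝ => t i)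
        (𝓝 0) (𝓝 0) := (continuous_apply i).tendsto 0
    exact hi.eventually (hcℓ i)
  filter_upwards [hsmall] with t ht
  refine (hℓ.list_prod_le _ (η := ε / n) ?_).trans ?_
  · simp only [List.mem_map, forall_exists_index, and_imp, forall_apply_eq_imp_iff₂]
    exact fun i _ => (ht i).trans (hε' i).le
  · rw [List.length_map, Finset.length_toList, Finset.card_univ, Fintype.card_fin,
      finrank_euclideanSpace_fin]
    exact ENNReal.mul_div_le

end Chow

/-! ### Absolute continuity and affine changes of the parameter -/

section AbsolutelyContinuous

variable {f g : ℝ → ℝ} {a b c α : ℝ}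

theorem absolutelyContinuousOnInterval_of_dist_le (hg : AbsolutelyContinuousOnInterval g a b)
    (h : ∀ x ∈ uIcc a b, ∀ y ∈ uIcc a b, dist (f x) (f y) ≤ dist (g x) (g y)) :
    AbsolutelyContinuousOnInterval f a b := by
  refine squeeze_zero' (Eventually.of_forall fun E => Finset.sum_nonneg fun _ _ => dist_nonneg)
    ?_ hg
  filter_upwards [mem_inf_of_right (mem_principal_self _)] with E hE
  exact Finset.sum_le_sum fun i hi => h _ (hE.1 i hi).1 _ (hE.1 i hi).2

theorem absolutelyContinuousOnInterval_congr (hg : AbsolutelyContinuousOnInterval g a b)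
    (h : EqOn f g (uIcc a b)) : AbsolutelyContinuousOnInterval f a b :=
  absolutelyContinuousOnInterval_of_dist_le hg fun x hx y hy => by rw [h hx, h hy]

theorem absolutelyContinuousOnInterval_of_integral (hg : IntervalIntegrable g volume a b)
    (h : ∀ x ∈ uIcc a b, ∫ t in a..x, g t = f x - f a) : AbsolutelyContinuousOnInterval f a b := by
  refine absolutelyContinuousOnInterval_of_dist_le
    (hg.absolutelyContinuousOnInterval_intervalIntegral left_mem_uIcc) fun x hx y hy => ?_
  rw [h x hx, h y hy, dist_sub_right]

theorem integral_deriv_eq_sub_of_mem (hf : AbsolutelyContinuousOnInterval f a b) {x y : ℝ}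
    (hx : x ∈ uIcc a b) (hy : y ∈ uIcc a b) : ∫ t in x..y, deriv f t = f y - f x :=
  (hf.mono (uIcc_subset_uIcc hx hy)).integral_deriv_eq_sub

theorem absolutelyContinuousOnInterval_trans (hab : a ≤ b) (hbc : b ≤ c)
    (h₁ : AbsolutelyContinuousOnInterval f a b) (h₂ : AbsolutelyContinuousOnInterval f b c) :
    AbsolutelyContinuousOnInterval f a c := by
  refine absolutelyContinuousOnInterval_of_integral
    (h₁.intervalIntegrable_deriv.trans h₂.intervalIntegrable_deriv) fun x hx => ?_
  rw [uIcc_of_le (hab.trans hbc)] at hx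
  rcases le_total x b with hxb | hbx
  · exact integral_deriv_eq_sub_of_mem h₁ left_mem_uIcc (Icc_subset_uIcc ⟨hx.1, hxb⟩)
  · have hx' : x ∈ uIcc b c := Icc_subset_uIcc ⟨hbx, hx.2⟩
    rw [← intervalIntegral.integral_add_adjacent_intervals h₁.intervalIntegrable_deriv
      (h₂.mono (uIcc_subset_uIcc left_mem_uIcc hx')).intervalIntegrable_deriv,
      h₁.integral_deriv_eq_sub, integral_deriv_eq_sub_of_mem h₂ left_mem_uIcc hx']
    ring

theorem image_affine_uIcc (α β a b : ℝ) :
    (fun t => α * t + β) '' uIcc a b = uIcc (α * a + β) (α * b + β) := by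
  rw [← image_add_const_uIcc, ← image_const_mul_uIcc, image_image]

theorem affine_mem_uIcc (α β : ℝ) {t : ℝ} (ht : t ∈ uIcc a b) :
    α * t + β ∈ uIcc (α * a + β) (α * b + β) :=
  image_affine_uIcc α β a b ▸ mem_image_of_mem _ ht

theorem ae_restrict_uIcc_affine (hα : α ≠ 0) (β : ℝ) {p : ℝ → Prop}
    (h : ∀ᵐ t ∂volume.restrict (uIcc (α * a + β) (α * b + β)), p t) :
    ∀ᵐ t ∂volume.restrict (uIcc a b), p (α * t + β) := by
  rw [ae_restrict_iff' measurableSet_uIcc] at h ⊢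
  have hqmp : Measure.QuasiMeasurePreserving (fun t => α * t + β) volume volume :=
    (measurePreserving_add_right volume β).quasiMeasurePreserving.comp
      (Measure.quasiMeasurePreserving_smul volume hα)
  filter_upwards [hqmp.ae h] with t ht htab
  exact ht (affine_mem_uIcc α β htab)

theorem hasDerivAt_affine (α β t : ℝ) : HasDerivAt (fun s => α * s + β) α t := by
  simpa using ((hasDerivAt_id t).const_mul α).add_const β

theorem injective_affine (hα : α ≠ 0) (β : ℝ) : Function.Injective fun t : ℝ => α * t + β :=
  fun _ _ h => mul_left_cancel₀ hα (add_right_cancel h)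

theorem lintegral_uIcc_affine (hα : α ≠ 0) (β : ℝ) (F : ℝ → ℝ≥0∞) :
    ∫⁻ t in uIcc (α * a + β) (α * b + β), F t =
      ∫⁻ t in uIcc a b, ENNReal.ofReal |α| * F (α * t + β) := by
  rw [← image_affine_uIcc]
  exact lintegral_image_eq_lintegral_abs_deriv_mul measurableSet_uIcc
    (fun t _ => (hasDerivAt_affine α β t).hasDerivWithinAt) (injective_affine hα β).injOn F

theorem intervalIntegrable_comp_affine (hα : α ≠ 0) (β : ℝ)
    (hg : IntervalIntegrable g volume (α * a + β) (α * b + β)) :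
    IntervalIntegrable (fun t => g (α * t + β)) volume a b := by
  rw [intervalIntegrable_iff', ← image_affine_uIcc,
    integrableOn_image_iff_integrableOn_abs_deriv_smul measurableSet_uIcc
      (fun t _ => (hasDerivAt_affine α β t).hasDerivWithinAt) (injective_affine hα β).injOn] at hg
  rw [intervalIntegrable_iff']
  exact (integrable_smul_iff (abs_ne_zero.2 hα) _).1 hg

theorem absolutelyContinuousOnInterval_comp_affine (hα : α ≠ 0) (β : ℝ)
    (hf : AbsolutelyContinuousOnInterval f (α * a + β) (α * b + β)) :
    AbsolutelyContinuousOnInterval (fun t => f (α * t + β)) a b := by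
  refine absolutelyContinuousOnInterval_of_integral (g := fun t => α * deriv f (α * t + β))
    ((intervalIntegrable_comp_affine hα β hf.intervalIntegrable_deriv).const_mul α) fun x hx => ?_
  rw [intervalIntegral.integral_const_mul, ← smul_eq_mul,
    intervalIntegral.smul_integral_comp_mul_add]
  exact integral_deriv_eq_sub_of_mem hf left_mem_uIcc (affine_mem_uIcc α β hx)

end AbsolutelyContinuous

/-! ### Horizontal curves -/

section Curves

variable {n : ℕ} {G : Type*} [TopologicalSpace G] [ChartedSpace (EuclideanSpace ℝ (Fin n)) G]
  [Group G] {γ γ' : ℝ → G} {t : ℝ} {v : GroupLieAlgebra (𝓡 n) G}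

/-- The curve `γ` is differentiable at `t`, with velocity the value at `γ t` of the left-invariant
field generated by `v`. -/
def HasVel (γ : ℝ → G) (t : ℝ) (v : GroupLieAlgebra (𝓡 n) G) : Prop :=
  HasMFDerivAt 𝓘(ℝ, ℝ) (𝓡 n) γ t
    ((1 : ℝ →L[ℝ] ℝ).smulRight (mulInvariantVectorField (I := 𝓡 n) v (γ t)))

theorem HasVel.congr (h : HasVel γ t v) (he : γ' =ᶠ[𝓝 t] γ) : HasVel γ' t v := by
  have hfield : (mulInvariantVectorField (I := 𝓡 n) v (γ t) : EuclideanSpace ℝ (Fin n)) =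
    mulInvariantVectorField (I := 𝓡 n) v (γ' t) := by rw [he.eq_of_nhds]
  refine HasMFDerivAt.congr_mfderiv
    (HasMFDerivAt.congr_of_eventuallyEq (f := γ) (f₁ := γ') h he) ?_
  exact congrArg (fun w : EuclideanSpace ℝ (Fin n) => (1 : ℝ →L[ℝ] ℝ).smulRight w) hfield

theorem HasVel.comp_affine {α β : ℝ} (h : HasVel γ (α * t + β) v) :
    HasVel (fun s => γ (α * s + β)) t (α • v) := by
  have haffine : HasMFDerivAt 𝓘(ℝ, ℝ) 𝓘(ℝ, ℝ) (fun s : ℝ => α * s + β) t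
      (ContinuousLinearMap.toSpanSingleton ℝ α) :=
    (hasDerivAt_affine α β t).hasFDerivAt.hasMFDerivAt
  refine HasMFDerivAt.congr_mfderiv
    (HasMFDerivAt.comp (g := γ) (f := fun s : ℝ => α * s + β) t h haffine) ?_
  rw [mulInvariantVectorField_smul]
  let w : EuclideanSpace ℝ (Fin n) := mulInvariantVectorField (I := 𝓡 n) v (γ (α * t + β))
  refine ContinuousLinearMap.ext fun s : ℝ => ?_
  change (s * α) • w = s • α • w
  rw [smul_smul]

theorem hasVel_const (x : G) (t : ℝ) : HasVel (n := n) (fun _ => x) t 0 := by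
  refine HasMFDerivAt.congr_mfderiv (hasMFDerivAt_const x t) ?_
  have hfield : (mulInvariantVectorField (I := 𝓡 n) (0 : GroupLieAlgebra (𝓡 n) G) x :
      EuclideanSpace ℝ (Fin n)) = 0 :=
    map_zero (mfderiv (𝓡 n) (𝓡 n) (fun y => x * y) (1 : G))
  refine ContinuousLinearMap.ext fun s : ℝ => ?_
  exact ((congrArg (fun w : EuclideanSpace ℝ (Fin n) => s • w) hfield).trans (smul_zero s)).symm

variable [LieGroup (𝓡 n) ∞ G]

theorem HasVel.mul_left (h : HasVel γ t v) (g : G) : HasVel (fun s => g * γ s) t v := by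
  refine HasMFDerivAt.congr_mfderiv (HasMFDerivAt.comp (g := fun y : G => g * y) (f := γ) t
    (mdifferentiable_mul_left n g (γ t)).hasMFDerivAt h) ?_
  refine ContinuousLinearMap.ext fun s : ℝ => ?_
  let w : EuclideanSpace ℝ (Fin n) := mulInvariantVectorField (I := 𝓡 n) v (γ t)
  refine (map_smul (mfderiv (𝓡 n) (𝓡 n) (fun y : G => g * y) (γ t)) s w).trans ?_
  exact congrArg (fun w : EuclideanSpace ℝ (Fin n) => s • w)
    (mfderiv_mul_left_mulInvariantVectorField v g (γ t))

theorem HasVel.hasDerivAt {F : Type*} [NormedAddCommGroup F] [NormedSpace ℝ F] {φ : G → F}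
    (h : HasVel γ t v) (hφ : MDifferentiableAt (𝓡 n) 𝓘(ℝ, F) φ (γ t)) :
    HasDerivAt (fun s => φ (γ s)) (leftDeriv (n := n) φ (γ t) v) t := by
  have hcomp : HasFDerivAt (fun s => φ (γ s))
      ((1 : ℝ →L[ℝ] ℝ).smulRight (leftDeriv (n := n) φ (γ t) v)) t := by
    refine HasMFDerivAt.hasFDerivAt (HasMFDerivAt.congr_mfderiv
      (HasMFDerivAt.comp (g := φ) (f := γ) t hφ.hasMFDerivAt h) ?_)
    refine ContinuousLinearMap.ext fun s : ℝ => ?_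
    let w : EuclideanSpace ℝ (Fin n) := mulInvariantVectorField (I := 𝓡 n) v (γ t)
    refine (map_smul (mfderiv (𝓡 n) 𝓘(ℝ, F) φ (γ t)) s w).trans ?_
    exact congrArg (fun w : F => s • w) (mfderiv_mulInvariantVectorField_eq_leftDeriv hφ v)
  simpa using hcomp.hasDerivAt

theorem continuous_leftDeriv {F : Type*} [NormedAddCommGroup F] [NormedSpace ℝ F] {φ : G → F}
    (hφ : ContMDiff (𝓡 n) 𝓘(ℝ, F) ∞ φ) : Continuous fun x => leftDeriv (n := n) φ x := by
  refine continuous_clm_apply.2 fun v => ?_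
  have htangent := hφ.continuous_tangentMap (by simp)
  have hfield := (contMDiff_mulInvariantVectorField (I := 𝓡 n) (G := G) v).continuous
  have hmodel := (tangentBundleModelSpaceHomeomorph 𝓘(ℝ, F)).continuous
  refine (continuous_snd.comp (hmodel.comp (htangent.comp hfield))).congr fun x => ?_
  exact mfderiv_mulInvariantVectorField_eq_leftDeriv (hφ.mdifferentiable (by simp) x) v

theorem hasVelocityOne_of_hasVel (hγ : γ 0 = 1) (h : ∀ᶠ t in 𝓝 0, HasVel γ t v) :
    HasVelocityOne γ v := by
  have hcont : ContinuousAt γ 0 := HasMFDerivAt.continuousAt h.self_of_nhds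
  have htend : Tendsto γ (𝓝 0) (𝓝 1) := hγ ▸ hcont
  have hchart : Tendsto (fun t => chartOne n G (γ t)) (𝓝 0) (𝓝 (chartOne n G (γ 0))) := by
    rw [hγ]
    exact (tendsto_chartOne n G).comp htend
  have hderiv : ∀ᶠ t in 𝓝 0,
      HasDerivAt (fun s => chartOne n G (γ s)) (chartField G v (chartOne n G (γ t))) t := by
    filter_upwards [h, htend.eventually (chart_source_mem_nhds (EuclideanSpace ℝ (Fin n)) 1),
      htend.eventually (eventually_leftDeriv_chartOne v)] with t hvel hsource hfield
    rw [← hfield]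
    exact hvel.hasDerivAt (mdifferentiableAt_extChartAt hsource)
  have horigin : chartOne n G (γ 0) = chartOrigin n G := by rw [hγ]; rfl
  have hfield : ContinuousAt (chartField G v) (chartOne n G (γ 0)) := by
    rw [horigin]
    exact (hasFDerivAt_fderiv_left (isLocalConjugation_chartConj n G).contDiffAt_mul
      (0, v)).continuousAt
  refine ⟨hγ, hcont, (hasStrictDerivAt_of_hasDerivAt_of_continuousAt hderiv
    (hfield.tendsto.comp hchart)).congr_deriv ?_⟩
  rw [horigin]
  exact chartField_origin v

theorem exists_eventually_hasVel (v : GroupLieAlgebra (𝓡 n) G) :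
    ∃ γ : ℝ → G, γ 0 = 1 ∧ ∀ᶠ t in 𝓝 0, HasVel γ t v := by
  have hfield : ContMDiffAt (𝓡 n) ((𝓡 n).prod 𝓘(ℝ, EuclideanSpace ℝ (Fin n))) 1
      (fun x => (⟨x, mulInvariantVectorField (I := 𝓡 n) v x⟩ : TangentBundle (𝓡 n) G)) 1 :=
    (contMDiffAt_mulInvariantVectorField (I := 𝓡 n) v).of_le
      (by rw [minSmoothness_of_isRCLikeNormedField]; norm_num)
  have : IsManifold (𝓡 n) 1 G := IsManifold.of_le (n := ∞) (by simp)
  exact exists_isMIntegralCurveAt_of_contMDiffAt_boundaryless (t₀ := (0 : ℝ)) hfield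

end Curves

section HorizontalCurves

variable {n : ℕ} {G : Type*} [TopologicalSpace G] [ChartedSpace (EuclideanSpace ℝ (Fin n)) G]
  [Group G] {𝓗 : Submodule ℝ (GroupLieAlgebra (𝓡 n) G)}
  {ip : InnerProductSpace.Core ℝ (GroupLieAlgebra (𝓡 n) G)} {γ γ' : ℝ → G}
  {u u' : ℝ → GroupLieAlgebra (𝓡 n) G} {a b c : ℝ}

/-- The version of `IsHorizontalCurve` on the interval with endpoints `a` and `b`, in either
order. -/
structure IsHorizontalOn (𝓗 : Submodule ℝ (GroupLieAlgebra (𝓡 n) G)) (γ : ℝ → G)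
    (u : ℝ → GroupLieAlgebra (𝓡 n) G) (a b : ℝ) : Prop where
  continuousOn : ContinuousOn γ (uIcc a b)
  absolutelyContinuous : ∀ φ : G → ℝ, ContMDiff (𝓡 n) 𝓘(ℝ, ℝ) ∞ φ →
    AbsolutelyContinuousOnInterval (φ ∘ γ) a b
  velocity : ∀ᵐ t ∂volume.restrict (uIcc a b), u t ∈ 𝓗 ∧ HasVel γ t (u t)

theorem isHorizontalOn_zero_one : IsHorizontalOn 𝓗 γ u 0 1 ↔ IsHorizontalCurve 𝓗 γ u := by
  constructor
  · rintro ⟨hcont, hac, hvel⟩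
    rw [uIcc_of_le zero_le_one] at hcont hvel
    exact ⟨hcont, hac, hvel⟩
  · rintro ⟨hcont, hac, hvel⟩
    rw [← uIcc_of_le zero_le_one] at hcont hvel
    exact ⟨hcont, hac, hvel⟩

theorem IsHorizontalOn.mono (h : IsHorizontalOn 𝓗 γ u a b) {a' b' : ℝ}
    (hsub : uIcc a' b' ⊆ uIcc a b) : IsHorizontalOn 𝓗 γ u a' b' :=
  ⟨h.continuousOn.mono hsub, fun φ hφ => (h.absolutelyContinuous φ hφ).mono hsub,
    ae_restrict_of_ae_restrict_of_subset hsub h.velocity⟩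

theorem IsHorizontalOn.comp_affine {α β : ℝ} (hα : α ≠ 0)
    (h : IsHorizontalOn 𝓗 γ u (α * a + β) (α * b + β)) :
    IsHorizontalOn 𝓗 (fun t => γ (α * t + β)) (fun t => α • u (α * t + β)) a b := by
  refine ⟨h.continuousOn.comp (by fun_prop) fun t ht => affine_mem_uIcc α β ht, fun φ hφ =>
    absolutelyContinuousOnInterval_comp_affine (f := φ ∘ γ) hα β (h.absolutelyContinuous φ hφ), ?_⟩
  filter_upwards [ae_restrict_uIcc_affine hα β h.velocity] with t ht
  exact ⟨𝓗.smul_mem α ht.1, ht.2.comp_affine⟩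

theorem uIoo_ae_eq_uIcc (a b : ℝ) : (uIoo a b : Set ℝ) =ᵐ[volume] uIcc a b :=
  Ioo_ae_eq_Icc

theorem IsHorizontalOn.congr (h : IsHorizontalOn 𝓗 γ u a b) (hγ : EqOn γ' γ (uIcc a b))
    (hu : EqOn u' u (uIoo a b)) : IsHorizontalOn 𝓗 γ' u' a b := by
  refine ⟨h.continuousOn.congr hγ, fun φ hφ => absolutelyContinuousOnInterval_congr
    (h.absolutelyContinuous φ hφ) fun t ht => congrArg φ (hγ ht), ?_⟩
  have hvel := h.velocity
  rw [← Measure.restrict_congr_set (uIoo_ae_eq_uIcc a b)] at hvel ⊢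
  filter_upwards [hvel, ae_restrict_mem measurableSet_Ioo] with t ht hmem
  rw [hu hmem]
  exact ⟨ht.1, ht.2.congr (hγ.eventuallyEq_of_mem (Icc_mem_nhds hmem.1 hmem.2))⟩

theorem IsHorizontalOn.trans (hab : a ≤ b) (hbc : b ≤ c) (h₁ : IsHorizontalOn 𝓗 γ u a b)
    (h₂ : IsHorizontalOn 𝓗 γ u b c) : IsHorizontalOn 𝓗 γ u a c := by
  have hunion : uIcc a c = uIcc a b ∪ uIcc b c := by
    rw [uIcc_of_le hab, uIcc_of_le hbc, uIcc_of_le (hab.trans hbc), Icc_union_Icc_eq_Icc hab hbc]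
  refine ⟨?_, fun φ hφ => absolutelyContinuousOnInterval_trans hab hbc
    (h₁.absolutelyContinuous φ hφ) (h₂.absolutelyContinuous φ hφ), ?_⟩
  · rw [hunion]
    exact h₁.continuousOn.union_of_isClosed h₂.continuousOn isClosed_Icc isClosed_Icc
  · rw [hunion]
    exact ae_restrict_union_iff _ _ _ |>.2 ⟨h₁.velocity, h₂.velocity⟩

/-- The speed `|γ'(t)|` of a curve whose velocity is the left-invariant field generated by `v`. -/
noncomputable def speed (ip : InnerProductSpace.Core ℝ (GroupLieAlgebra (𝓡 n) G))
    (v : GroupLieAlgebra (𝓡 n) G) : ℝ≥0∞ :=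
  ENNReal.ofReal √(ip.inner v v)

theorem speed_smul (α : ℝ) (v : GroupLieAlgebra (𝓡 n) G) :
    speed ip (α • v) = ENNReal.ofReal |α| * speed ip v := by
  have hinner : ip.inner (α • v) (α • v) = α ^ 2 * ip.inner v v := by
    have hleft : ∀ w, ip.inner (α • v) w = α * ip.inner v w := fun w => ip.smul_left v w α
    have hsymm : ip.inner v (α • v) = ip.inner (α • v) v := (ip.conj_inner_symm v (α • v)).symm
    rw [hleft, hsymm, hleft, sq, mul_assoc]
  rw [speed, speed, hinner, Real.sqrt_mul (sq_nonneg α), Real.sqrt_sq_eq_abs,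
    ENNReal.ofReal_mul (abs_nonneg α)]

theorem ccDist_eq_iInf (x y : G) : ccDist ip 𝓗 x y =
    ⨅ (γ : ℝ → G) (u : ℝ → GroupLieAlgebra (𝓡 n) G)
      (_ : IsHorizontalOn 𝓗 γ u 0 1 ∧ γ 0 = x ∧ γ 1 = y), ∫⁻ t in uIcc 0 1, speed ip (u t) := by
  simp only [isHorizontalOn_zero_one, uIcc_of_le zero_le_one]
  rfl

theorem isHorizontalOn_const (x : G) (a b : ℝ) :
    IsHorizontalOn 𝓗 (fun _ => x) (fun _ => 0) a b := by
  refine ⟨continuousOn_const, fun φ _ => ?_, ae_of_all _ fun t => ⟨𝓗.zero_mem, hasVel_const x t⟩⟩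
  exact absolutelyContinuousOnInterval_of_integral (g := 0) intervalIntegrable_const
    fun t _ => by simp

theorem ccDist_self (x : G) : ccDist ip 𝓗 x x = 0 := by
  have hzero : speed ip (0 : GroupLieAlgebra (𝓡 n) G) = 0 := by
    simpa using speed_smul (ip := ip) 0 0
  refine nonpos_iff_eq_zero.1 ?_
  rw [ccDist_eq_iInf]
  exact iInf_le_of_le (fun _ => x) <| iInf_le_of_le (fun _ => 0) <|
    iInf_le_of_le ⟨isHorizontalOn_const x 0 1, rfl, rfl⟩ (by simp [hzero])

theorem IsHorizontalOn.ccDist_le (h : IsHorizontalOn 𝓗 γ u a b) :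
    ccDist ip 𝓗 (γ a) (γ b) ≤ ∫⁻ t in uIcc a b, speed ip (u t) := by
  rcases eq_or_ne a b with rfl | hab
  · simp [ccDist_self]
  have hα : b - a ≠ 0 := sub_ne_zero.2 hab.symm
  have h0 : (b - a) * 0 + a = a := by ring
  have h1 : (b - a) * 1 + a = b := by ring
  have hunit : IsHorizontalOn 𝓗 (fun t => γ ((b - a) * t + a))
      (fun t => (b - a) • u ((b - a) * t + a)) 0 1 :=
    IsHorizontalOn.comp_affine hα (by rwa [h0, h1])
  rw [ccDist_eq_iInf]
  refine iInf_le_of_le _ (iInf_le_of_le _ (iInf_le_of_le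
    ⟨hunit, congrArg γ h0, congrArg γ h1⟩ (le_of_eq ?_)))
  have hlength := lintegral_uIcc_affine (a := 0) (b := 1) hα a fun t => speed ip (u t)
  rw [h0, h1] at hlength
  simp only [speed_smul, hlength]

theorem le_ccDist_iff {x y : G} {r : ℝ≥0∞} : r ≤ ccDist ip 𝓗 x y ↔
    ∀ γ u, IsHorizontalOn 𝓗 γ u 0 1 → γ 0 = x → γ 1 = y → r ≤ ∫⁻ t in uIcc 0 1, speed ip (u t) := by
  simp only [ccDist_eq_iInf, le_iInf_iff, and_imp]

theorem ccDist_comm (x y : G) : ccDist ip 𝓗 x y = ccDist ip 𝓗 y x := by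
  have hle : ∀ x y : G, ccDist ip 𝓗 x y ≤ ccDist ip 𝓗 y x := fun x y => by
    refine le_ccDist_iff.2 fun γ u h h0 h1 => ?_
    rw [← h0, ← h1, uIcc_comm]
    exact (h.mono (uIcc_comm (1 : ℝ) 0).le).ccDist_le
  exact (hle x y).antisymm (hle y x)

theorem exists_isHorizontalOn_glue {γ₁ γ₂ : ℝ → G} {u₁ u₂ : ℝ → GroupLieAlgebra (𝓡 n) G}
    (hab : a ≤ b) (hbc : b ≤ c) (h₁ : IsHorizontalOn 𝓗 γ₁ u₁ a b)
    (h₂ : IsHorizontalOn 𝓗 γ₂ u₂ b c) (h : γ₁ b = γ₂ b) :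
    ∃ γ u, IsHorizontalOn 𝓗 γ u a c ∧ γ a = γ₁ a ∧ γ c = γ₂ c ∧
      ∫⁻ t in uIcc a c, speed ip (u t) ≤
        (∫⁻ t in uIcc a b, speed ip (u₁ t)) + ∫⁻ t in uIcc b c, speed ip (u₂ t) := by
  set γ : ℝ → G := fun t => if t ≤ b then γ₁ t else γ₂ t
  set u : ℝ → GroupLieAlgebra (𝓡 n) G := fun t => if t ≤ b then u₁ t else u₂ t
  have hγ₁ : EqOn γ γ₁ (uIcc a b) := fun t ht => if_pos (uIcc_of_le hab ▸ ht).2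
  have hγ₂ : EqOn γ γ₂ (uIcc b c) := fun t ht => by
    rcases (uIcc_of_le hbc ▸ ht).1.eq_or_lt with rfl | hlt
    · exact (if_pos le_rfl).trans h
    · exact if_neg hlt.not_ge
  have hu₁ : EqOn u u₁ (uIoo a b) := fun t ht => if_pos (uIoo_of_le hab ▸ ht).2.le
  have hu₂ : EqOn u u₂ (uIoo b c) := fun t ht => if_neg (uIoo_of_le hbc ▸ ht).1.not_ge
  have hlength : ∀ {p q : ℝ} {w : ℝ → GroupLieAlgebra (𝓡 n) G}, EqOn u w (uIoo p q) →
      ∫⁻ t in uIcc p q, speed ip (u t) = ∫⁻ t in uIcc p q, speed ip (w t) := fun {p q _} hw => by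
    simp only [← setLIntegral_congr (uIoo_ae_eq_uIcc p q)]
    exact setLIntegral_congr_fun measurableSet_Ioo fun t ht => congrArg (speed ip) (hw ht)
  refine ⟨γ, u, (h₁.congr hγ₁ hu₁).trans hab hbc (h₂.congr hγ₂ hu₂), hγ₁ left_mem_uIcc,
    hγ₂ right_mem_uIcc, ?_⟩
  rw [← hlength hu₁, ← hlength hu₂]
  exact (lintegral_mono_set uIcc_subset_uIcc_union_uIcc).trans (lintegral_union_le _ _ _)

theorem ccDist_triangle (x y z : G) :
    ccDist ip 𝓗 x z ≤ ccDist ip 𝓗 x y + ccDist ip 𝓗 y z := by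
  rw [ccDist_eq_iInf x y, ccDist_eq_iInf y z]
  simp only [ENNReal.iInf_add, ENNReal.add_iInf, le_iInf_iff, and_imp]
  intro γ₂ u₂ h₂ hy hz γ₁ u₁ h₁ hx hy'
  have h0 : (1 : ℝ) * 1 + -1 = 0 := by norm_num
  have h1 : (1 : ℝ) * 2 + -1 = 1 := by norm_num
  have hshift : IsHorizontalOn 𝓗 (fun t => γ₂ (1 * t + -1)) (fun t => (1 : ℝ) • u₂ (1 * t + -1))
      1 2 := IsHorizontalOn.comp_affine one_ne_zero (by rwa [h0, h1])
  have hlength := lintegral_uIcc_affine (a := 1) (b := 2) one_ne_zero (-1)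
    fun t => speed ip (u₂ t)
  simp only [← speed_smul] at hlength
  obtain ⟨γ, u, hγ, hγ0, hγ2, hle⟩ := exists_isHorizontalOn_glue (ip := ip) zero_le_one
    one_le_two h₁ hshift (by rw [hy', h0, hy])
  rw [← hlength, h0, h1] at hle
  calc ccDist ip 𝓗 x z = ccDist ip 𝓗 (γ 0) (γ 2) := by rw [hγ0, hγ2, hx, h1, hz]
    _ ≤ _ := hγ.ccDist_le.trans hle

end HorizontalCurves

/-! ### Balls of the Carnot–Carathéodory distance -/

section Balls

open scoped Pointwise

variable {n : ℕ} {G : Type*} [TopologicalSpace G] [ChartedSpace (EuclideanSpace ℝ (Fin n)) G]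
  [Group G] [LieGroup (𝓡 n) ∞ G] {𝓗 : Submodule ℝ (GroupLieAlgebra (𝓡 n) G)}
  {ip : InnerProductSpace.Core ℝ (GroupLieAlgebra (𝓡 n) G)} {γ : ℝ → G}
  {u : ℝ → GroupLieAlgebra (𝓡 n) G} {a b : ℝ}

theorem IsHorizontalOn.mul_left (h : IsHorizontalOn 𝓗 γ u a b) (g : G) :
    IsHorizontalOn 𝓗 (fun t => g * γ t) u a b := by
  have : IsTopologicalGroup G := topologicalGroup_of_lieGroup (𝓡 n) ∞
  refine ⟨continuousOn_const.mul h.continuousOn, fun φ hφ => ?_, ?_⟩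
  · exact h.absolutelyContinuous (fun x => φ (g * x)) (hφ.comp (contMDiff_mul_left (a := g)))
  · filter_upwards [h.velocity] with t ht
    exact ⟨ht.1, ht.2.mul_left g⟩

theorem ccDist_mul_left (g x y : G) : ccDist ip 𝓗 (g * x) (g * y) = ccDist ip 𝓗 x y := by
  have hle : ∀ g x y : G, ccDist ip 𝓗 (g * x) (g * y) ≤ ccDist ip 𝓗 x y := fun g x y => by
    refine le_ccDist_iff.2 fun γ u h h0 h1 => ?_
    rw [← h0, ← h1]
    exact (h.mul_left g).ccDist_le
  refine (hle g x y).antisymm ?_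
  simpa only [inv_mul_cancel_left] using hle g⁻¹ (g * x) (g * y)

theorem ccBall_eq_smul (x : G) (r : ℝ) : ccBall ip 𝓗 x r = x • ccBall ip 𝓗 1 r := by
  ext y
  rw [mem_smul_set_iff_inv_smul_mem, smul_eq_mul]
  change ccDist ip 𝓗 x y < _ ↔ ccDist ip 𝓗 1 (x⁻¹ * y) < _
  rw [← ccDist_mul_left x 1, mul_one, mul_inv_cancel_left]

theorem isGroupLength_ccDist : IsGroupLength (ccDist ip 𝓗 (1 : G)) where
  map_one := ccDist_self 1
  map_inv x := by rw [← ccDist_mul_left x, mul_one, mul_inv_cancel, ccDist_comm]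
  map_mul_le x y := by
    rw [← ccDist_mul_left x 1 y, mul_one]
    exact ccDist_triangle 1 x (x * y)

theorem isHorizontalOn_of_forall_hasVel {v : GroupLieAlgebra (𝓡 n) G} (hv : v ∈ 𝓗)
    (h : ∀ t ∈ uIcc a b, HasVel γ t v) : IsHorizontalOn 𝓗 γ (fun _ => v) a b := by
  have hcont : ContinuousOn γ (uIcc a b) := fun t ht =>
    (HasMFDerivAt.continuousAt (h t ht)).continuousWithinAt
  refine ⟨hcont, fun φ hφ => ?_, ?_⟩
  · have hint : ContinuousOn (fun t => leftDeriv (n := n) φ (γ t) v) (uIcc a b) :=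
      ((continuous_leftDeriv hφ).clm_apply continuous_const).comp_continuousOn hcont
    refine absolutelyContinuousOnInterval_of_integral hint.intervalIntegrable fun x hx => ?_
    have hsub : uIcc a x ⊆ uIcc a b := uIcc_subset_uIcc left_mem_uIcc hx
    exact intervalIntegral.integral_eq_sub_of_hasDerivAt
      (fun t ht => (h t (hsub ht)).hasDerivAt (hφ.mdifferentiable (by simp) _))
      (hint.mono hsub).intervalIntegrable
  · filter_upwards [ae_restrict_mem measurableSet_uIcc] with t ht
    exact ⟨hv, h t ht⟩

theorem tendsto_ccDist_one {v : GroupLieAlgebra (𝓡 n) G} (hv : v ∈ 𝓗) (hγ : γ 0 = 1)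
    (h : ∀ᶠ t in 𝓝 0, HasVel γ t v) :
    Tendsto (fun t => ccDist ip 𝓗 1 (γ t)) (𝓝 0) (𝓝 0) := by
  have hbound : ∀ᶠ t : ℝ in 𝓝 0, ccDist ip 𝓗 1 (γ t) ≤ speed ip v * ENNReal.ofReal |t| := by
    filter_upwards [(tendsto_const_nhds.uIcc tendsto_id).eventually h.smallSets] with t ht
    have hle := (isHorizontalOn_of_forall_hasVel hv ht).ccDist_le (ip := ip)
    rwa [hγ, setLIntegral_const, Real.volume_interval, id_eq, sub_zero] at hle
  refine tendsto_of_tendsto_of_tendsto_of_le_of_le' tendsto_const_nhds ?_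
    (Eventually.of_forall fun _ => zero_le) hbound
  have hlim : Tendsto (fun t : ℝ => ENNReal.ofReal |t|) (𝓝 0) (𝓝 0) := by
    simpa using ENNReal.tendsto_ofReal (continuous_abs.tendsto (0 : ℝ))
  simpa only [mul_zero] using
    ENNReal.Tendsto.const_mul (a := speed ip v) hlim (Or.inr ENNReal.ofReal_ne_top)

theorem ccBall_one_mem_nhds (h𝓗 : LieSubalgebra.lieSpan ℝ (GroupLieAlgebra (𝓡 n) G)
      (𝓗 : Set (GroupLieAlgebra (𝓡 n) G)) = ⊤) {r : ℝ} (hr : 0 < r) :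
    ccBall ip 𝓗 (1 : G) r ∈ 𝓝 (1 : G) := by
  refine (isGroupLength_ccDist.tendsto_nhds_one h𝓗 fun v hv => ?_).eventually
    (gt_mem_nhds (ENNReal.ofReal_pos.2 hr))
  obtain ⟨γ, hγ, hvel⟩ := exists_eventually_hasVel v
  exact ⟨γ, hasVelocityOne_of_hasVel hγ hvel, tendsto_ccDist_one hv hγ hvel⟩

theorem leftDeriv_eq_zero {F : Type*} [NormedAddCommGroup F] [NormedSpace ℝ F] {φ : G → F} {x : G}
    (hx : x ∉ tsupport φ) : leftDeriv (n := n) φ x = 0 := by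
  have : IsTopologicalGroup G := topologicalGroup_of_lieGroup (𝓡 n) ∞
  have hzero : φ =ᶠ[𝓝 x] fun _ => 0 := notMem_tsupport_iff_eventuallyEq.1 hx
  have htend : Tendsto (fun b => x * chartInv G b) (𝓝 (chartOrigin n G)) (𝓝 x) := by
    simpa using (tendsto_chartInv n G).const_mul x
  have hcomp : (fun b => φ (x * chartInv G b)) =ᶠ[𝓝 (chartOrigin n G)] fun _ => (0 : F) :=
    htend.eventually hzero
  rw [leftDeriv, hcomp.fderiv_eq, fderiv_fun_const, Pi.zero_apply]

theorem hasCompactSupport_leftDeriv {F : Type*} [NormedAddCommGroup F] [NormedSpace ℝ F]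
    {φ : G → F} (hc : HasCompactSupport φ) :
    HasCompactSupport fun x => leftDeriv (n := n) φ x :=
  hc.mono' fun _ hx => not_not.1 fun hx' => hx (leftDeriv_eq_zero hx')

theorem exists_norm_le_sqrt_inner {W E : Type*} [AddCommGroup W] [Module ℝ W]
    [FiniteDimensional ℝ W] [NormedAddCommGroup E] [NormedSpace ℝ E]
    (ip : InnerProductSpace.Core ℝ W) (L : W →ₗ[ℝ] E) :
    ∃ C, ∀ w, ‖L w‖ ≤ C * √(ip.inner w w) := by
  let _ : NormedAddCommGroup W := ip.toNormedAddCommGroup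
  let _ : InnerProductSpace ℝ W := InnerProductSpace.ofCore ip.toCore
  exact ⟨‖L.toContinuousLinearMap‖, L.toContinuousLinearMap.le_opNorm⟩

theorem exists_enorm_leftDeriv_le (ip : InnerProductSpace.Core ℝ (GroupLieAlgebra (𝓡 n) G))
    {φ : G → ℝ} (hφ : ContMDiff (𝓡 n) 𝓘(ℝ, ℝ) ∞ φ) (hc : HasCompactSupport φ) :
    ∃ C > 0, ∀ (x : G) (v : GroupLieAlgebra (𝓡 n) G),
      ‖leftDeriv (n := n) φ x v‖ₑ ≤ ENNReal.ofReal C * speed ip v := by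
  obtain ⟨C₁, hC₁⟩ := (continuous_leftDeriv hφ).bounded_above_of_compact_support
    (hasCompactSupport_leftDeriv hc)
  have : FiniteDimensional ℝ (GroupLieAlgebra (𝓡 n) G) :=
    inferInstanceAs (FiniteDimensional ℝ (EuclideanSpace ℝ (Fin n)))
  let toModel : GroupLieAlgebra (𝓡 n) G →ₗ[ℝ] EuclideanSpace ℝ (Fin n) :=
    (LinearMap.id : EuclideanSpace ℝ (Fin n) →ₗ[ℝ] EuclideanSpace ℝ (Fin n))
  obtain ⟨C₂, hC₂⟩ := exists_norm_le_sqrt_inner ip toModel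
  have hC₁_nonneg : 0 ≤ C₁ := (norm_nonneg _).trans (hC₁ 1)
  refine ⟨max (C₁ * C₂) 1, lt_max_of_lt_right one_pos, fun x v => ?_⟩
  rw [speed, ← ENNReal.ofReal_mul' (Real.sqrt_nonneg _), ← ofReal_norm]
  refine ENNReal.ofReal_le_ofReal ?_
  calc ‖leftDeriv (n := n) φ x v‖ ≤ ‖leftDeriv (n := n) φ x‖ * ‖toModel v‖ :=
        (leftDeriv (n := n) φ x).le_opNorm (toModel v)
    _ ≤ C₁ * (C₂ * √(ip.inner v v)) := mul_le_mul (hC₁ x) (hC₂ v) (norm_nonneg _) hC₁_nonneg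
    _ = C₁ * C₂ * √(ip.inner v v) := by ring
    _ ≤ max (C₁ * C₂) 1 * √(ip.inner v v) := by gcongr; exact le_max_left _ _

theorem IsHorizontalOn.enorm_sub_le (h : IsHorizontalOn 𝓗 γ u 0 1) {φ : G → ℝ}
    (hφ : ContMDiff (𝓡 n) 𝓘(ℝ, ℝ) ∞ φ) {C : ℝ≥0∞} (hC : C ≠ ⊤)
    (hbound : ∀ x v, ‖leftDeriv (n := n) φ x v‖ₑ ≤ C * speed ip v) :
    ‖φ (γ 1) - φ (γ 0)‖ₑ ≤ C * ∫⁻ t in uIcc 0 1, speed ip (u t) := by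
  have hFTC : ∫ t in (0 : ℝ)..1, deriv (φ ∘ γ) t = φ (γ 1) - φ (γ 0) :=
    (h.absolutelyContinuous φ hφ).integral_deriv_eq_sub
  rw [← hFTC, intervalIntegral.integral_of_le zero_le_one, ← integral_Icc_eq_integral_Ioc,
    ← uIcc_of_le zero_le_one, ← lintegral_const_mul' _ _ hC]
  refine (enorm_integral_le_lintegral_enorm _).trans (lintegral_mono_ae ?_)
  filter_upwards [h.velocity] with t ht
  rw [HasDerivAt.deriv (f := φ ∘ γ) (ht.2.hasDerivAt (hφ.mdifferentiable (by simp) _))]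
  exact hbound _ _

theorem exists_enorm_sub_le_ccDist (ip : InnerProductSpace.Core ℝ (GroupLieAlgebra (𝓡 n) G))
    (𝓗 : Submodule ℝ (GroupLieAlgebra (𝓡 n) G)) {φ : G → ℝ}
    (hφ : ContMDiff (𝓡 n) 𝓘(ℝ, ℝ) ∞ φ) (hc : HasCompactSupport φ) :
    ∃ C > 0, ∀ x y : G, ‖φ y - φ x‖ₑ ≤ ENNReal.ofReal C * ccDist ip 𝓗 x y := by
  obtain ⟨C, hC_pos, hC⟩ := exists_enorm_leftDeriv_le ip hφ hc
  refine ⟨C, hC_pos, fun x y => ?_⟩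
  have hC_ne_zero : ENNReal.ofReal C ≠ 0 := (ENNReal.ofReal_pos.2 hC_pos).ne'
  simp only [ccDist_eq_iInf, ENNReal.mul_iInf_of_ne hC_ne_zero ENNReal.ofReal_ne_top, le_iInf_iff,
    and_imp]
  rintro γ u h rfl rfl
  exact h.enorm_sub_le hφ ENNReal.ofReal_ne_top hC

theorem exists_measureReal_Icc_eq {ν : Measure ℝ} [IsFiniteMeasure ν] [NullSingletonClass ν]
    {a b c : ℝ} (hab : a ≤ b) (hc : c ∈ Icc 0 (ν.real (Icc a b))) :
    ∃ s ∈ Icc a b, ν.real (Icc a s) = c ∧ ν.real (Icc s b) = ν.real (Icc a b) - c := by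
  have hcont : ContinuousOn (fun t => ν.real (Icc a t)) (Icc a b) := by
    simpa using intervalIntegral.continuousOn_primitive_Icc (μ := ν) (f := fun _ => (1 : ℝ))
      (a := a) (b := b) (integrable_const 1).integrableOn
  have hzero : ν.real (Icc a a) = 0 := by simp [measureReal_def]
  obtain ⟨s, hs, hsc⟩ : c ∈ (fun t => ν.real (Icc a t)) '' Icc a b :=
    intermediate_value_Icc hab hcont (by rwa [hzero])
  refine ⟨s, hs, hsc, eq_sub_of_add_eq' ?_⟩
  rw [← hsc, ← measureReal_congr (Ioc_ae_eq_Icc (μ := ν) (a := s)), ← measureReal_union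
    (Set.disjoint_left.2 fun t ht ht' => ht'.1.not_ge ht.2) measurableSet_Ioc,
    Icc_union_Ioc_eq_Icc hs.1 hs.2]

theorem exists_setLIntegral_Icc_lt {f : ℝ → ℝ≥0∞} {a b : ℝ} (ha : 0 < a) (hb : 0 < b)
    (h : ∫⁻ t in Icc (0 : ℝ) 1, f t < ENNReal.ofReal (a + b)) :
    ∃ s ∈ Icc (0 : ℝ) 1, ∫⁻ t in Icc 0 s, f t < ENNReal.ofReal a ∧
      ∫⁻ t in Icc s 1, f t < ENNReal.ofReal b := by
  set ν : Measure ℝ := (volume.restrict (Icc 0 1)).withDensity f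
  have : IsFiniteMeasure ν := isFiniteMeasure_withDensity h.ne_top
  have hν : ∀ s t, 0 ≤ s → t ≤ 1 → ν (Icc s t) = ∫⁻ τ in Icc s t, f τ := fun s t hs ht => by
    rw [withDensity_apply f measurableSet_Icc, Measure.restrict_restrict measurableSet_Icc,
      inter_eq_left.2 (Icc_subset_Icc hs ht)]
  have hlt : ∀ {A : Set ℝ} {c : ℝ}, ν.real A < c ↔ ν A < ENNReal.ofReal c := fun {A c} => by
    rw [measureReal_def, ENNReal.lt_ofReal_iff_toReal_lt (measure_ne_top ν A)]
  set T : ℝ := ν.real (Icc 0 1)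
  have hT : T < a + b := hlt.2 (by rwa [hν 0 1 le_rfl le_rfl])
  have hT_nonneg : 0 ≤ T := measureReal_nonneg
  have hmem : T * a / (a + b) ∈ Icc 0 T := by
    refine ⟨by positivity, ?_⟩
    rw [div_le_iff₀ (add_pos ha hb)]
    nlinarith
  obtain ⟨s, hs, hleft, hright⟩ := exists_measureReal_Icc_eq zero_le_one hmem
  refine ⟨s, hs, ?_, ?_⟩
  · rw [← hν 0 s le_rfl hs.2, ← hlt, hleft, div_lt_iff₀ (add_pos ha hb)]
    nlinarith
  · have hdiv : T - T * a / (a + b) = T * b / (a + b) := by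
      field_simp
      ring
    rw [← hν s 1 hs.1 le_rfl, ← hlt, hright, hdiv, div_lt_iff₀ (add_pos ha hb)]
    nlinarith

theorem ccBall_add_subset (x : G) {a b : ℝ} (ha : 0 < a) (hb : 0 < b) :
    ccBall ip 𝓗 x (a + b) ⊆ ccBall ip 𝓗 x a * ccBall ip 𝓗 1 b := by
  intro y hy
  have hdist : ccDist ip 𝓗 x y < ENNReal.ofReal (a + b) := hy
  simp only [ccDist_eq_iInf, iInf_lt_iff, uIcc_of_le zero_le_one] at hdist
  obtain ⟨γ, u, ⟨h, rfl, rfl⟩, hlength⟩ := hdist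
  obtain ⟨s, hs, hleft, hright⟩ := exists_setLIntegral_Icc_lt ha hb hlength
  have hs' : s ∈ uIcc 0 1 := Icc_subset_uIcc hs
  rw [← uIcc_of_le hs.1] at hleft
  rw [← uIcc_of_le hs.2] at hright
  refine ⟨γ s, ((h.mono (uIcc_subset_uIcc left_mem_uIcc hs')).ccDist_le).trans_lt hleft,
    (γ s)⁻¹ * γ 1, ?_, mul_inv_cancel_left _ _⟩
  change ccDist ip 𝓗 1 _ < _
  rw [← ccDist_mul_left (γ s), mul_one, mul_inv_cancel_left]
  exact ((h.mono (uIcc_subset_uIcc hs' right_mem_uIcc)).ccDist_le).trans_lt hright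

theorem exists_ccBall_subset_isCompact [T2Space G]
    (ip : InnerProductSpace.Core ℝ (GroupLieAlgebra (𝓡 n) G))
    (𝓗 : Submodule ℝ (GroupLieAlgebra (𝓡 n) G)) :
    ∃ r > 0, ∃ K : Set G, IsCompact K ∧ ccBall ip 𝓗 1 r ⊆ K := by
  obtain ⟨φ⟩ : Nonempty (SmoothBumpFunction (𝓡 n) (1 : G)) := inferInstance
  obtain ⟨C, hC_pos, hC⟩ := exists_enorm_sub_le_ccDist ip 𝓗 φ.contMDiff φ.hasCompactSupport
  refine ⟨1 / C, by positivity, tsupport φ, φ.hasCompactSupport, fun x hx => ?_⟩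
  by_contra hsupport
  have hle : 1 ≤ ENNReal.ofReal C * ccDist ip 𝓗 1 x := by
    simpa [image_eq_zero_of_notMem_tsupport hsupport, φ.eq_one] using hC 1 x
  have hlt : ENNReal.ofReal C * ccDist ip 𝓗 1 x < 1 := by
    calc ENNReal.ofReal C * ccDist ip 𝓗 1 x < ENNReal.ofReal C * ENNReal.ofReal (1 / C) :=
          ENNReal.mul_lt_mul_right (ENNReal.ofReal_pos.2 hC_pos).ne' ENNReal.ofReal_ne_top hx
      _ = 1 := by rw [← ENNReal.ofReal_mul hC_pos.le, mul_one_div_cancel hC_pos.ne',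
          ENNReal.ofReal_one]
  exact hlt.not_ge hle

theorem exists_isCompact_ccBall_one_subset [T2Space G]
    (ip : InnerProductSpace.Core ℝ (GroupLieAlgebra (𝓡 n) G))
    (𝓗 : Submodule ℝ (GroupLieAlgebra (𝓡 n) G)) (r : ℝ) :
    ∃ K : Set G, IsCompact K ∧ ccBall ip 𝓗 1 r ⊆ K := by
  have : IsTopologicalGroup G := topologicalGroup_of_lieGroup (𝓡 n) ∞
  obtain ⟨ρ, hρ, K, hK, hρK⟩ := exists_ccBall_subset_isCompact ip 𝓗
  have hcover : ∀ k : ℕ, ∃ L : Set G, IsCompact L ∧ ccBall ip 𝓗 (1 : G) ((k + 1) * ρ) ⊆ L := by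
    intro k
    induction k with
    | zero => exact ⟨K, hK, by simpa using hρK⟩
    | succ k ih =>
      obtain ⟨L, hL, hsub⟩ := ih
      have hadd : ((k + 1 : ℕ) + 1) * ρ = (k + 1) * ρ + ρ := by push_cast; ring
      refine ⟨L * K, hL.mul hK, ?_⟩
      rw [hadd]
      exact (ccBall_add_subset 1 (by positivity) hρ).trans (mul_subset_mul hsub hρK)
  obtain ⟨k, hk⟩ := exists_nat_ge (r / ρ)
  have hr : r ≤ (k + 1) * ρ := by
    rw [div_le_iff₀ hρ] at hk
    linarith
  obtain ⟨L, hL, hsub⟩ := hcover k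
  refine ⟨L, hL, fun x hx => hsub ?_⟩
  exact (show ccDist ip 𝓗 1 x < _ from hx).trans_le (ENNReal.ofReal_le_ofReal hr)

end Balls

/-! ### Integration by parts -/

section MaurerCartan

variable {n : ℕ} {G : Type*} [TopologicalSpace G] [ChartedSpace (EuclideanSpace ℝ (Fin n)) G]
  [Group G]

variable (n G) in
/-- Left division `(a, b) ↦ a⁻¹ b` in the chart at the identity. -/
noncomputable def chartLDiv (p : EuclideanSpace ℝ (Fin n) × EuclideanSpace ℝ (Fin n)) :
    EuclideanSpace ℝ (Fin n) := chartOne n G ((chartInv G p.1)⁻¹ * chartInv G p.2)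

variable (n G) in
/-- The Maurer–Cartan form in the chart at the identity: the differential at `b = z` of
`b ↦ z⁻¹ b`. -/
noncomputable def chartMaurerCartan (z : EuclideanSpace ℝ (Fin n)) :
    EuclideanSpace ℝ (Fin n) →L[ℝ] EuclideanSpace ℝ (Fin n) :=
  (fderiv ℝ (chartLDiv n G) (z, z)).comp (ContinuousLinearMap.inr ℝ _ _)

variable [LieGroup (𝓡 n) ∞ G]

variable (n G) in
theorem contDiffAt_chartLDiv :
    ContDiffAt ℝ ∞ (chartLDiv n G) (chartOrigin n G, chartOrigin n G) :=
  contDiffAt_chartOne_comp ((contMDiffAt_chartInv_comp contDiffAt_fst rfl).inv.mul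
    (contMDiffAt_chartInv_comp contDiffAt_snd rfl)) (by simp [chartInv_origin])

variable (n G) in
theorem continuousAt_chartMaurerCartan :
    ContinuousAt (chartMaurerCartan n G) (chartOrigin n G) := by
  have hfderiv : ContinuousAt (fderiv ℝ (chartLDiv n G)) (chartOrigin n G, chartOrigin n G) :=
    ((contDiffAt_chartLDiv n G).fderiv_right (m := 0) (by simp)).continuousAt
  have hdiag : ContinuousAt (fun z => fderiv ℝ (chartLDiv n G) (z, z)) (chartOrigin n G) :=
    hfderiv.comp (f := fun z => (z, z)) (continuousAt_id.prodMk continuousAt_id)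
  exact hdiag.clm_comp continuousAt_const

variable (n G) in
theorem eventually_hasFDerivAt_chartLDiv : ∀ᶠ z in 𝓝 (chartOrigin n G),
    HasFDerivAt (fun b => chartLDiv n G (z, b)) (chartMaurerCartan n G z) z := by
  have hdiff : ∀ᶠ p in 𝓝 (chartOrigin n G, chartOrigin n G),
      ContDiffAt ℝ 1 (chartLDiv n G) p :=
    ((contDiffAt_chartLDiv n G).of_le (by simp)).eventually (by simp)
  filter_upwards [(tendsto_id.prodMk_nhds tendsto_id).eventually hdiff] with z hz
  exact (hz.differentiableAt one_ne_zero).hasFDerivAt.comp z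
    ((hasFDerivAt_const z z).prodMk (hasFDerivAt_id z))

variable (n G) in
theorem eventually_eventually_chartInv_chartLDiv : ∀ᶠ z in 𝓝 (chartOrigin n G), ∀ᶠ b in 𝓝 z,
    chartInv G (chartLDiv n G (z, b)) = (chartInv G z)⁻¹ * chartInv G b := by
  have : IsTopologicalGroup G := topologicalGroup_of_lieGroup (𝓡 n) ∞
  have hldiv : Tendsto (fun p : EuclideanSpace ℝ (Fin n) × EuclideanSpace ℝ (Fin n) =>
      (chartInv G p.1)⁻¹ * chartInv G p.2) (𝓝 (chartOrigin n G, chartOrigin n G)) (𝓝 1) := by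
    simpa using ((tendsto_chartInv n G).comp (continuous_fst.tendsto _)).inv.mul
      ((tendsto_chartInv n G).comp (continuous_snd.tendsto (chartOrigin n G, chartOrigin n G)))
  filter_upwards [(tendsto_id.prodMk_nhds tendsto_id).eventually
    (hldiv.eventually (eventually_chartInv_chartOne n G)).eventually_nhds] with z hz
  exact (tendsto_prodMk_right z z).eventually hz

theorem eventually_hasFDerivAt_mul_chartInv {F : Type*} [NormedAddCommGroup F] [NormedSpace ℝ F]
    {φ : G → F} (hφ : MDifferentiable (𝓡 n) 𝓘(ℝ, F) φ) :
    ∀ᶠ z in 𝓝 (chartOrigin n G), ∀ x, HasFDerivAt (fun b => φ (x * chartInv G b))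
      ((leftDeriv (n := n) φ (x * chartInv G z)).comp (chartMaurerCartan n G z)) z := by
  filter_upwards [eventually_hasFDerivAt_chartLDiv n G,
    eventually_eventually_chartInv_chartLDiv n G] with z hderiv hinv x
  have horigin : chartLDiv n G (z, z) = chartOrigin n G := by simp [chartLDiv, chartOrigin]
  have hleft := hasFDerivAt_mul_chartInv (hφ (x * chartInv G z))
  rw [← horigin] at hleft
  refine (hleft.comp z hderiv).congr_of_eventuallyEq ?_
  filter_upwards [hinv] with b hb
  rw [Function.comp_apply, hb, ← mul_assoc, mul_inv_cancel_right]

end MaurerCartan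

section Modular

variable {n : ℕ} {G : Type*} [TopologicalSpace G] [ChartedSpace (EuclideanSpace ℝ (Fin n)) G]
  [Group G] [LieGroup (𝓡 n) ∞ G]

theorem modularFun_one : modularFun n (1 : G) = 1 := by
  have : IsTopologicalGroup G := topologicalGroup_of_lieGroup (𝓡 n) ∞
  have : LocallyCompactSpace G := Manifold.locallyCompact_of_finiteDimensional (𝓡 n)
  rw [modularFun, inv_one, Measure.modularCharacterFun_map_one, NNReal.coe_one]

variable [T2Space G]

theorem exists_contMDiff_bump {U : Set G} (hU : U ∈ 𝓝 (1 : G)) :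
    ∃ φ : G → ℝ, ContMDiff (𝓡 n) 𝓘(ℝ, ℝ) ∞ φ ∧ HasCompactSupport φ ∧ φ 1 = 1 ∧
      tsupport φ ⊆ U ∧ ∀ x, φ x ∈ Icc (0 : ℝ) 1 := by
  obtain ⟨f, -, hf⟩ := (SmoothBumpFunction.nhds_basis_tsupport (I := 𝓡 n) (1 : G)).mem_iff.1 hU
  exact ⟨f, f.contMDiff, f.hasCompactSupport, f.eq_one, hf, fun x => ⟨f.nonneg, f.le_one⟩⟩

variable [MeasurableSpace G] [BorelSpace G] (μ : Measure G) [μ.IsHaarMeasure]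
  {F : Type*} [NormedAddCommGroup F] [NormedSpace ℝ F] {φ : G → F}

open scoped Pointwise in
theorem exists_bound_leftDeriv_comp_chartMaurerCartan (hφ : ContMDiff (𝓡 n) 𝓘(ℝ, F) ∞ φ)
    (hc : HasCompactSupport φ) :
    ∃ bound : G → ℝ, Integrable bound μ ∧ ∀ᶠ z in 𝓝 (chartOrigin n G), ∀ x,
      ‖(leftDeriv (n := n) φ (x * chartInv G z)).comp (chartMaurerCartan n G z)‖ ≤ bound x := by
  have : IsTopologicalGroup G := topologicalGroup_of_lieGroup (𝓡 n) ∞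
  have : LocallyCompactSpace G := Manifold.locallyCompact_of_finiteDimensional (𝓡 n)
  obtain ⟨W, hWc, hW⟩ := exists_compact_mem_nhds (1 : G)
  obtain ⟨C, hC⟩ := (continuous_leftDeriv (n := n) hφ).bounded_above_of_compact_support
    (hasCompactSupport_leftDeriv hc)
  have hC_nonneg : 0 ≤ C := (norm_nonneg _).trans (hC 1)
  have hK : IsCompact (tsupport φ * W⁻¹) := hc.isCompact.mul hWc.inv
  set M : ℝ := ‖chartMaurerCartan n G (chartOrigin n G)‖ + 1
  refine ⟨(tsupport φ * W⁻¹).indicator fun _ => C * M,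
    (integrableOn_const hK.measure_ne_top).integrable_indicator hK.measurableSet, ?_⟩
  filter_upwards [(continuousAt_chartMaurerCartan n G).norm.eventually_lt_const (lt_add_one _),
    (tendsto_chartInv n G).eventually hW] with z hM hzW x
  by_cases hx : x ∈ tsupport φ * W⁻¹
  · rw [indicator_of_mem hx]
    exact (ContinuousLinearMap.opNorm_comp_le _ _).trans
      (mul_le_mul (hC _) hM.le (norm_nonneg _) hC_nonneg)
  · have hsupport : x * chartInv G z ∉ tsupport φ := fun h =>
      hx ⟨_, h, (chartInv G z)⁻¹, inv_mem_inv.2 hzW, mul_inv_cancel_right _ _⟩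
    rw [indicator_of_notMem hx, leftDeriv_eq_zero hsupport, ContinuousLinearMap.zero_comp,
      norm_zero]

theorem hasFDerivAt_integral_mul_chartInv (hφ : ContMDiff (𝓡 n) 𝓘(ℝ, F) ∞ φ)
    (hc : HasCompactSupport φ) :
    HasFDerivAt (fun z => ∫ x, φ (x * chartInv G z) ∂μ)
      (∫ x, leftDeriv (n := n) φ x ∂μ) (chartOrigin n G) := by
  have : IsTopologicalGroup G := topologicalGroup_of_lieGroup (𝓡 n) ∞
  obtain ⟨bound, hbound_int, hbound⟩ := exists_bound_leftDeriv_comp_chartMaurerCartan μ hφ hc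
  have hφ' : MDifferentiable (𝓡 n) 𝓘(ℝ, F) φ := hφ.mdifferentiable (by simp)
  have hderiv := eventually_hasFDerivAt_mul_chartInv hφ'
  have hderiv_origin : ∀ x, (leftDeriv (n := n) φ (x * chartInv G (chartOrigin n G))).comp
      (chartMaurerCartan n G (chartOrigin n G)) = leftDeriv (n := n) φ x := fun x =>
    (hderiv.self_of_nhds x).unique (hasFDerivAt_mul_chartInv (hφ' x))
  have hint : ∀ z : EuclideanSpace ℝ (Fin n), Integrable (fun x => φ (x * chartInv G z)) μ :=
    fun z => (hφ.continuous.comp (continuous_mul_const _)).integrable_of_hasCompactSupport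
      (hc.comp_homeomorph (Homeomorph.mulRight _))
  have hint_deriv : Integrable (fun x => leftDeriv (n := n) φ x) μ :=
    (continuous_leftDeriv hφ).integrable_of_hasCompactSupport (hasCompactSupport_leftDeriv hc)
  have hmain := hasFDerivAt_integral_of_dominated_of_fderiv_le (𝕜 := ℝ) (μ := μ)
    (F := fun z x => φ (x * chartInv G z)) (F' := fun z x =>
      (leftDeriv (n := n) φ (x * chartInv G z)).comp (chartMaurerCartan n G z))
    (hderiv.and hbound) (Eventually.of_forall fun z => (hint z).aestronglyMeasurable) (hint _)
    (by simpa only [hderiv_origin] using hint_deriv.aestronglyMeasurable)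
    (Eventually.of_forall fun x z hz => hz.2 x) hbound_int
    (Eventually.of_forall fun x z hz => hz.1 x)
  simpa only [hderiv_origin] using hmain

variable [SecondCountableTopology G]

theorem modularFun_smul_integral_mul_right (φ : G → F) (g : G) :
    modularFun n g • ∫ x, φ (x * g) ∂μ = ∫ x, φ x ∂μ := by
  have : IsTopologicalGroup G := topologicalGroup_of_lieGroup (𝓡 n) ∞
  have : LocallyCompactSpace G := Manifold.locallyCompact_of_finiteDimensional (𝓡 n)
  have hmap : ∫ x, φ (x * g) ∂μ = ∫ x, φ x ∂(μ.map (· * g)) :=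
    (MeasureTheory.integral_map_equiv (MeasurableEquiv.mulRight g) φ).symm
  have hinv : (Measure.modularCharacterFun g⁻¹ : ℝ) * Measure.modularCharacterFun g = 1 := by
    rw [← NNReal.coe_mul, ← Measure.modularCharacterFun_map_mul, inv_mul_cancel,
      Measure.modularCharacterFun_map_one, NNReal.coe_one]
  rw [hmap, Measure.map_right_mul_eq_modularCharacterFun_smul, integral_smul_nnreal_measure,
    NNReal.smul_def, smul_smul, modularFun, hinv, one_smul]

theorem differentiableAt_modularFun_chartInv :
    DifferentiableAt ℝ (fun z => modularFun n (chartInv G z)) (chartOrigin n G) := by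
  have : IsTopologicalGroup G := topologicalGroup_of_lieGroup (𝓡 n) ∞
  have : LocallyCompactSpace G := Manifold.locallyCompact_of_finiteDimensional (𝓡 n)
  set μ : Measure G := Measure.haar
  obtain ⟨φ, hφ, hc, hφ_one, -, hφ_mem⟩ := exists_contMDiff_bump (n := n) (G := G) univ_mem
  have hpos : 0 < ∫ x, φ x ∂μ :=
    hφ.continuous.integral_pos_of_hasCompactSupport_nonneg_nonzero hc (fun x => (hφ_mem x).1)
      (x := 1) (by simp [hφ_one])
  have hquot : ∀ g : G, modularFun n g = (∫ x, φ x ∂μ) * (∫ x, φ (x * g) ∂μ)⁻¹ := fun g => by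
    have hmul := modularFun_smul_integral_mul_right (n := n) μ φ g
    have hne : ∫ x, φ (x * g) ∂μ ≠ 0 := right_ne_zero_of_smul (hmul ▸ hpos.ne')
    rw [← hmul, smul_eq_mul, mul_inv_cancel_right₀ hne]
  simp only [hquot]
  exact ((hasFDerivAt_integral_mul_chartInv μ hφ hc).differentiableAt.inv
    (by simpa [chartInv_origin] using hpos.ne')).const_mul _

theorem mdifferentiableAt_modularFun :
    MDifferentiableAt (𝓡 n) 𝓘(ℝ, ℝ) (modularFun n : G → ℝ) 1 := by
  have hcomp : MDifferentiableAt (𝓡 n) 𝓘(ℝ, ℝ)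
      ((fun z => modularFun n (chartInv G z)) ∘ chartOne n G) (1 : G) :=
    differentiableAt_modularFun_chartInv.mdifferentiableAt.comp
      (I' := 𝓘(ℝ, EuclideanSpace ℝ (Fin n))) (1 : G)
      (contMDiffAt_chartOne.mdifferentiableAt (by simp))
  refine hcomp.congr_of_eventuallyEq ?_
  filter_upwards [eventually_chartInv_chartOne n G] with x hx
  rw [Function.comp_apply, hx]

theorem hasFDerivAt_modularFun_chartInv :
    HasFDerivAt (fun b => modularFun n (chartInv G b))
      (mfderiv (𝓡 n) 𝓘(ℝ, ℝ) (modularFun n : G → ℝ) 1 : EuclideanSpace ℝ (Fin n) →L[ℝ] ℝ)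
      (chartOrigin n G) :=
  hasFDerivAt_comp_chartInv mdifferentiableAt_modularFun

/- Differentiate the constant `δ(z) ∫ φ(x z) dμ(x)` at `z = 1`. -/
theorem integral_leftDeriv [CompleteSpace F] (hφ : ContMDiff (𝓡 n) 𝓘(ℝ, F) ∞ φ)
    (hc : HasCompactSupport φ) (v : GroupLieAlgebra (𝓡 n) G) :
    ∫ x, leftDeriv (n := n) φ x v ∂μ = -(modularDeriv v • ∫ x, φ x ∂μ) := by
  have : IsTopologicalGroup G := topologicalGroup_of_lieGroup (𝓡 n) ∞
  let w : EuclideanSpace ℝ (Fin n) := v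
  have hconst : (fun z : EuclideanSpace ℝ (Fin n) => modularFun n (chartInv G z)) •
      (fun z => ∫ x, φ (x * chartInv G z) ∂μ) = fun _ => ∫ x, φ x ∂μ :=
    funext fun z => by rw [Pi.smul_apply', modularFun_smul_integral_mul_right]
  have hprod := HasFDerivAt.smul (E := EuclideanSpace ℝ (Fin n)) hasFDerivAt_modularFun_chartInv
    (hasFDerivAt_integral_mul_chartInv μ hφ hc)
  rw [hconst] at hprod
  have hunique := hprod.unique (hasFDerivAt_const _ _)
  simp only [chartInv_origin, mul_one] at hunique
  have hzero : modularFun n (1 : G) • (∫ x, leftDeriv (n := n) φ x ∂μ) w +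
      modularDeriv v • ∫ x, φ x ∂μ = 0 :=
    congrArg (fun L : EuclideanSpace ℝ (Fin n) →L[ℝ] F => L w) hunique
  rw [modularFun_one, one_smul, ContinuousLinearMap.integral_apply
    ((continuous_leftDeriv hφ).integrable_of_hasCompactSupport
      (hasCompactSupport_leftDeriv hc))] at hzero
  exact eq_neg_of_add_eq_zero_left hzero

end Modular

namespace IsTestFun

variable {n : ℕ} {G : Type*} [TopologicalSpace G] [ChartedSpace (EuclideanSpace ℝ (Fin n)) G]
  {φ ψ : G → ℂ}

theorem mul (hφ : IsTestFun n φ) (hψ : IsTestFun n ψ) : IsTestFun n fun x => φ x * ψ x :=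
  ⟨(contDiff_mul (𝕜 := ℝ) (𝔸 := ℂ)).contMDiff.comp (hφ.1.prodMk_space hψ.1), hφ.2.mul_right⟩

variable [Group G] [LieGroup (𝓡 n) ∞ G]

theorem fieldDeriv_eq (h : IsTestFun n φ) (v : GroupLieAlgebra (𝓡 n) G) (x : G) :
    fieldDeriv v φ x = leftDeriv (n := n) φ x v :=
  mfderiv_mulInvariantVectorField_eq_leftDeriv (h.1.mdifferentiable (by simp) x) v

theorem fieldDeriv_mul (hφ : IsTestFun n φ) (hψ : IsTestFun n ψ)
    (v : GroupLieAlgebra (𝓡 n) G) (x : G) :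
    fieldDeriv v (fun y => φ y * ψ y) x = φ x * fieldDeriv v ψ x + ψ x * fieldDeriv v φ x := by
  rw [(hφ.mul hψ).fieldDeriv_eq, hφ.fieldDeriv_eq, hψ.fieldDeriv_eq]
  let w : EuclideanSpace ℝ (Fin n) := v
  have hproduct := ((hasFDerivAt_mul_chartInv (hφ.1.mdifferentiable (by simp) x)).mul
    (hasFDerivAt_mul_chartInv (hψ.1.mdifferentiable (by simp) x))).fderiv
  simp only [chartInv_origin, mul_one] at hproduct
  exact congrArg (fun L : EuclideanSpace ℝ (Fin n) →L[ℝ] ℂ => L w) hproduct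

variable [T2Space G] [MeasurableSpace G] [BorelSpace G] (μ : Measure G) [μ.IsHaarMeasure]
  [SecondCountableTopology G]

theorem integral_fieldDeriv_mul (hφ : IsTestFun n φ) (hψ : IsTestFun n ψ)
    (v : GroupLieAlgebra (𝓡 n) G) :
    ∫ x, fieldDeriv v φ x * ψ x ∂μ =
      -∫ x, φ x * (fieldDeriv v ψ x + modularDeriv v * ψ x) ∂μ := by
  have hint₁ : Integrable (fun x => φ x * fieldDeriv v ψ x) μ :=
    (hφ.continuous.mul (hψ.continuous_fieldDeriv v)).integrable_of_hasCompactSupport hφ.2.mul_right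
  have hint₂ : Integrable (fun x => fieldDeriv v φ x * ψ x) μ :=
    ((hφ.continuous_fieldDeriv v).mul hψ.continuous).integrable_of_hasCompactSupport hψ.2.mul_left
  have hint₃ : Integrable (fun x => modularDeriv v * (φ x * ψ x)) μ :=
    ((hφ.mul hψ).continuous.integrable_of_hasCompactSupport (hφ.mul hψ).2).const_mul _
  have hdiv : ∫ x, (φ x * fieldDeriv v ψ x + fieldDeriv v φ x * ψ x) ∂μ =
      -(modularDeriv v * ∫ x, φ x * ψ x ∂μ) := by
    rw [← Complex.real_smul, ← integral_leftDeriv μ (hφ.mul hψ).1 (hφ.mul hψ).2 v]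
    refine integral_congr_ae (Eventually.of_forall fun x => ?_)
    simp only
    rw [← (hφ.mul hψ).fieldDeriv_eq v x, hφ.fieldDeriv_mul hψ, mul_comm (ψ x)]
  rw [integral_add hint₁ hint₂] at hdiv
  simp only [mul_add, mul_left_comm (φ _) (modularDeriv v : ℂ)]
  rw [integral_add hint₁ hint₃, integral_const_mul]
  linear_combination hdiv

end IsTestFun

/-! ### The form and its operator -/

section L2

variable {α : Type*} [MeasurableSpace α] (μ : Measure α)

theorem integral_lp_zero_mul (φ : α → ℂ) : ∫ x, (0 : Lp ℂ 2 μ) x * φ x ∂μ = 0 := by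
  rw [← integral_zero α ℂ (μ := μ)]
  refine integral_congr_ae ?_
  filter_upwards [Lp.coeFn_zero ℂ 2 μ] with x hx
  rw [hx, Pi.zero_apply, zero_mul]

variable {μ}

theorem integrable_norm_sq_lp (f : Lp ℂ 2 μ) : Integrable (fun x => ‖f x‖ ^ 2) μ :=
  (memLp_two_iff_integrable_sq_norm (Lp.aestronglyMeasurable f)).1 (Lp.memLp f)

theorem integral_norm_sq_lp (f : Lp ℂ 2 μ) : ∫ x, ‖f x‖ ^ 2 ∂μ = ‖f‖ ^ 2 := by
  have hinner : ∫ x, ((‖f x‖ ^ 2 : ℝ) : ℂ) ∂μ = ((‖f‖ ^ 2 : ℝ) : ℂ) := by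
    have hself := inner_self_eq_norm_sq_to_K (𝕜 := ℂ) f
    rw [L2.inner_def] at hself
    simp only [inner_self_eq_norm_sq_to_K] at hself
    exact_mod_cast hself
  rw [integral_complex_ofReal] at hinner
  exact_mod_cast hinner

end L2

section TestFun

variable {n : ℕ} {G : Type*} [TopologicalSpace G] [ChartedSpace (EuclideanSpace ℝ (Fin n)) G]

theorem isTestFun_ofReal {φ : G → ℝ} (hφ : ContMDiff (𝓡 n) 𝓘(ℝ, ℝ) ∞ φ)
    (hc : HasCompactSupport φ) : IsTestFun n fun x => (φ x : ℂ) :=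
  ⟨Complex.ofRealCLM.contDiff.contMDiff.comp hφ, hc.comp_left (g := Complex.ofReal) rfl⟩

variable [T2Space G] [MeasurableSpace G] [BorelSpace G] {μ : Measure G} {V : G → ℝ}
  (hV : LocallyIntegrable V μ)

include hV

theorem IsTestFun.integrable_mul_norm_sq {φ : G → ℂ} (hφ : IsTestFun n φ) :
    Integrable (fun x => V x * ‖φ x‖ ^ 2) μ :=
  hV.integrable_smul_right_of_hasCompactSupport (hφ.continuous.norm.pow 2)
    (hφ.2.comp_left (g := fun z : ℂ => ‖z‖ ^ 2) (by simp))

variable [SecondCountableTopology G]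

theorem IsTestFun.memLp_sqrt_abs_mul {φ : G → ℂ} (hφ : IsTestFun n φ) :
    MemLp (fun x => (√|V x| : ℂ) * φ x) 2 μ := by
  have hmeas : AEStronglyMeasurable (fun x => (√|V x| : ℂ) * φ x) μ :=
    ((show Continuous fun t : ℝ => (√|t| : ℂ) by fun_prop).comp_aestronglyMeasurable
      hV.aestronglyMeasurable).mul hφ.continuous.aestronglyMeasurable
  rw [memLp_two_iff_integrable_sq_norm hmeas]
  refine (hφ.integrable_mul_norm_sq hV).norm.congr (Eventually.of_forall fun x => ?_)
  simp [mul_pow]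

end TestFun

section Operator

variable {n : ℕ} {G : Type*} [TopologicalSpace G] [ChartedSpace (EuclideanSpace ℝ (Fin n)) G]
  [Group G] [MeasurableSpace G] [BorelSpace G] (μ : Measure G) [μ.IsHaarMeasure]

/-- The class in `L²` of a test function. -/
noncomputable def IsTestFun.toLp {φ : G → ℂ} (hφ : IsTestFun n φ) : Lp ℂ 2 μ :=
  (hφ.continuous.memLp_of_hasCompactSupport hφ.2 : MemLp φ 2 μ).toLp

theorem IsTestFun.coeFn_toLp {φ : G → ℂ} (hφ : IsTestFun n φ) : hφ.toLp μ =ᵐ[μ] φ :=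
  MemLp.coeFn_toLp _

section Form

variable [LieGroup (𝓡 n) ∞ G] {ν : ℕ} (X : Fin ν → GroupLieAlgebra (𝓡 n) G) {V : G → ℝ}

theorem form_conj_symm (f g : formDomain μ X V) : conj (form μ X V f g) = form μ X V g f := by
  rw [form, form, ← integral_conj]
  refine integral_congr_ae (Eventually.of_forall fun x => ?_)
  simp [mul_comm, mul_assoc]

theorem re_form_smul_self (c : ℂ) (f : formDomain μ X V) :
    (form μ X V (c • f) (c • f)).re = ‖c‖ ^ 2 * (form μ X V f f).re := by
  have hform : form μ X V (c • f) (c • f) = (‖c‖ ^ 2 : ℝ) * form μ X V f f := by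
    rw [form_smul_left, ← form_conj_symm, form_smul_left, map_mul, form_conj_symm, ← mul_assoc,
      Complex.mul_conj, Complex.normSq_eq_norm_sq]
  rw [hform, Complex.re_ofReal_mul]

theorem re_sum_mul_conj_add {ι : Type*} [Fintype ι] (a : ι → ℂ) (v : ℝ) (b : ℂ) :
    (∑ j, a j * conj (a j) + v * b * conj b).re = ∑ j, ‖a j‖ ^ 2 + v * ‖b‖ ^ 2 := by
  simp only [mul_assoc, Complex.mul_conj, Complex.normSq_eq_norm_sq]
  norm_cast

theorem integrable_form_self (hV : AEStronglyMeasurable V μ) (f : formDomain μ X V) :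
    Integrable (fun x => ∑ j, ‖weakGrad μ X V j f x‖ ^ 2 + V x * ‖(f : Lp ℂ 2 μ) x‖ ^ 2) μ :=
  (form_integrable μ X V hV f f).re.congr
    (Eventually.of_forall fun x => re_sum_mul_conj_add (fun j => weakGrad μ X V j f x) (V x) _)

theorem re_form_self (hV : AEStronglyMeasurable V μ) (f : formDomain μ X V) :
    (form μ X V f f).re =
      ∫ x, (∑ j, ‖weakGrad μ X V j f x‖ ^ 2 + V x * ‖(f : Lp ℂ 2 μ) x‖ ^ 2) ∂μ := by
  rw [form, ← RCLike.re_eq_complex_re, ← integral_re (form_integrable μ X V hV f f)]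
  exact integral_congr_ae
    (Eventually.of_forall fun x => re_sum_mul_conj_add (fun j => weakGrad μ X V j f x) (V x) _)

theorem le_re_form_self (hV : AEStronglyMeasurable V μ) {c : ℝ} (hc : ∀ᵐ x ∂μ, c ≤ V x)
    (f : formDomain μ X V) : c * ‖f‖ ^ 2 ≤ (form μ X V f f).re := by
  rw [re_form_self μ X hV f, Submodule.coe_norm, ← integral_norm_sq_lp, ← integral_const_mul]
  refine integral_mono_ae ((integrable_norm_sq_lp _).const_mul c)
    (integrable_form_self μ X hV f) ?_
  filter_upwards [hc] with x hx
  exact (mul_le_mul_of_nonneg_right hx (sq_nonneg _)).trans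
    (le_add_of_nonneg_left (Finset.sum_nonneg fun _ _ => sq_nonneg _))

/-- The shifted form `Q - z` as a scalar product on the form domain, for `z` below the potential;
Mathlib's scalar products being conjugate linear on the left, the arguments are exchanged. -/
noncomputable abbrev shiftedFormCore (hV : AEStronglyMeasurable V μ) {z : ℝ}
    (hz : ∀ᵐ x ∂μ, z ≤ V x) : PreInnerProductSpace.Core ℂ (formDomain μ X V) where
  inner f g := form μ X V g f - z * inner ℂ (f : Lp ℂ 2 μ) g
  conj_inner_symm f g := by
    rw [map_sub, map_mul, form_conj_symm, inner_conj_symm, Complex.conj_ofReal]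
  re_inner_nonneg f := by
    rw [RCLike.re_eq_complex_re, Complex.sub_re, Complex.re_ofReal_mul, ← RCLike.re_eq_complex_re,
      inner_self_eq_norm_sq]
    exact sub_nonneg.2 (le_re_form_self μ X hV hz f)
  add_left f f' g := by
    rw [← form_conj_symm, form_add_left μ X V hV, map_add, form_conj_symm, form_conj_symm,
      Submodule.coe_add, inner_add_left]
    ring
  smul_left f g a := by
    rw [← form_conj_symm, form_smul_left, map_mul, form_conj_symm, Submodule.coe_smul,
      inner_smul_left]
    ring

theorem norm_sq_form_sub_inner_le (hV : AEStronglyMeasurable V μ) {z : ℝ}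
    (hz : ∀ᵐ x ∂μ, z ≤ V x) (f g : formDomain μ X V) :
    ‖form μ X V f g - z * inner ℂ (g : Lp ℂ 2 μ) f‖ ^ 2 ≤
      (form μ X V f f - z * inner ℂ (f : Lp ℂ 2 μ) f).re *
        (form μ X V g g - z * inner ℂ (g : Lp ℂ 2 μ) g).re := by
  let core := shiftedFormCore μ X hV hz
  have hsymm : ‖core.inner f g‖ = ‖core.inner g f‖ := by
    rw [← core.conj_inner_symm, RCLike.norm_conj]
  have hcs : ‖core.inner f g‖ * ‖core.inner g f‖ ≤ _ :=
    InnerProductSpace.Core.inner_mul_inner_self_le (c := core) f g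
  rw [hsymm, ← sq] at hcs
  exact hcs

end Form

section WeakDeriv

variable [LieGroup (𝓡 n) ∞ G]

theorem IsTestFun.memLp_fieldDeriv {φ : G → ℂ} (hφ : IsTestFun n φ)
    (v : GroupLieAlgebra (𝓡 n) G) : MemLp (fieldDeriv v φ) 2 μ :=
  (hφ.continuous_fieldDeriv v).memLp_of_hasCompactSupport (hφ.hasCompactSupport_fieldDeriv v)

variable [T2Space G] [SecondCountableTopology G]

theorem IsTestFun.mem_weakDerivGraph {φ : G → ℂ} (hφ : IsTestFun n φ)
    (v : GroupLieAlgebra (𝓡 n) G) :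
    (hφ.toLp μ, (hφ.memLp_fieldDeriv μ v).toLp) ∈ weakDerivGraph μ v := fun ψ hψ =>
  calc ∫ x, (hφ.memLp_fieldDeriv μ v).toLp (fieldDeriv v φ) x * ψ x ∂μ =
        ∫ x, fieldDeriv v φ x * ψ x ∂μ :=
      integral_congr_ae ((hφ.memLp_fieldDeriv μ v).coeFn_toLp.mul .rfl)
    _ = -∫ x, φ x * (fieldDeriv v ψ x + modularDeriv v * ψ x) ∂μ :=
      hφ.integral_fieldDeriv_mul μ hψ v
    _ = -∫ x, hφ.toLp μ x * (fieldDeriv v ψ x + modularDeriv v * ψ x) ∂μ :=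
      congrArg Neg.neg (integral_congr_ae ((hφ.coeFn_toLp μ).symm.mul .rfl))

theorem lp_eq_zero_of_integral_mul_eq_zero {g : Lp ℂ 2 μ}
    (h : ∀ φ : G → ℝ, ContMDiff (𝓡 n) 𝓘(ℝ, ℝ) ∞ φ → HasCompactSupport φ →
      ∫ x, g x * (φ x : ℂ) ∂μ = 0) : g = 0 := by
  have : LocallyCompactSpace G := Manifold.locallyCompact_of_finiteDimensional (𝓡 n)
  have hg : LocallyIntegrable g μ := (Lp.memLp g).locallyIntegrable (by norm_num)
  refine (Lp.eq_zero_iff_ae_eq_zero).2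
    (ae_eq_zero_of_integral_contMDiff_smul_eq_zero (𝓡 n) hg fun φ hφ hc => ?_)
  simpa only [Complex.real_smul, mul_comm] using h φ hφ hc

theorem weakDerivGraph_snd_eq_zero (v : GroupLieAlgebra (𝓡 n) G) (p : Lp ℂ 2 μ × Lp ℂ 2 μ)
    (hp : p ∈ weakDerivGraph μ v) (hzero : p.1 = 0) : p.2 = 0 := by
  refine lp_eq_zero_of_integral_mul_eq_zero (n := n) μ fun φ hφ hc => ?_
  rw [hp _ (isTestFun_ofReal hφ hc), hzero, integral_lp_zero_mul, neg_zero]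

theorem mem_weakDeriv_graph {v : GroupLieAlgebra (𝓡 n) G} {p : Lp ℂ 2 μ × Lp ℂ 2 μ} :
    p ∈ (weakDeriv μ v).graph ↔ p ∈ weakDerivGraph μ v := by
  rw [weakDeriv, Submodule.toLinearPMap_graph_eq _ (weakDerivGraph_snd_eq_zero μ v)]

theorem IsTestFun.mem_weakDeriv_domain {φ : G → ℂ} (hφ : IsTestFun n φ)
    (v : GroupLieAlgebra (𝓡 n) G) : hφ.toLp μ ∈ (weakDeriv μ v).domain :=
  LinearPMap.mem_domain_of_mem_graph
    ((mem_weakDeriv_graph μ).2 (hφ.mem_weakDerivGraph μ v))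

variable {ν : ℕ} (X : Fin ν → GroupLieAlgebra (𝓡 n) G) {V : G → ℝ} (hV : LocallyIntegrable V μ)

theorem weakGrad_eq_of_mem {j : Fin ν} {f : formDomain μ X V} {g : Lp ℂ 2 μ}
    (h : ((f : Lp ℂ 2 μ), g) ∈ weakDerivGraph μ (X j)) : weakGrad μ X V j f = g :=
  ((weakDeriv μ (X j)).mem_graph_snd_inj ((weakDeriv μ (X j)).mem_graph ⟨f, f.2.1 j⟩)
    ((mem_weakDeriv_graph μ).2 h) rfl :)

include hV

theorem IsTestFun.mem_formDomain {φ : G → ℂ} (hφ : IsTestFun n φ) :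
    hφ.toLp μ ∈ formDomain μ X V := by
  refine ⟨fun j => hφ.mem_weakDeriv_domain μ (X j),
    (memLp_congr_ae ?_).2 (hφ.memLp_sqrt_abs_mul hV)⟩
  filter_upwards [hφ.coeFn_toLp μ] with x hx
  rw [hx]

end WeakDeriv

section Schrodinger

variable [LieGroup (𝓡 n) ∞ G] [T2Space G] [SecondCountableTopology G]
  {ν : ℕ} (X : Fin ν → GroupLieAlgebra (𝓡 n) G) {V : G → ℝ} (hV : LocallyIntegrable V μ)

theorem schrodingerGraph_snd_eq_zero (p : Lp ℂ 2 μ × Lp ℂ 2 μ)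
    (hp : p ∈ schrodingerGraph μ X hV) (hzero : p.1 = 0) : p.2 = 0 := by
  obtain ⟨f, hf, hfp⟩ := hp
  have hf_zero : f = (0 : ℂ) • f := (Subtype.ext (hf.trans hzero)).trans (zero_smul ℂ f).symm
  refine lp_eq_zero_of_integral_mul_eq_zero (n := n) μ fun φ hφ hc => ?_
  have hinner := hfp ⟨_, (isTestFun_ofReal hφ hc).mem_formDomain μ X hV⟩
  rw [hf_zero, form_smul_left, zero_mul, L2.inner_def] at hinner
  rw [hinner]
  refine integral_congr_ae ?_
  filter_upwards [(isTestFun_ofReal hφ hc).coeFn_toLp μ] with x hx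
  simp [hx]

theorem exists_form_eq_inner_schrodinger (f : (schrodinger μ X hV).domain) :
    ∃ u : formDomain μ X V, (u : Lp ℂ 2 μ) = f ∧
      ∀ g : formDomain μ X V, form μ X V u g = inner ℂ (g : Lp ℂ 2 μ) (schrodinger μ X hV f) := by
  have hgraph : (schrodinger μ X hV).graph = schrodingerGraph μ X hV :=
    Submodule.toLinearPMap_graph_eq _ (schrodingerGraph_snd_eq_zero μ X hV)
  have hmem := (schrodinger μ X hV).mem_graph f
  rwa [hgraph] at hmem

theorem schrodinger_symmetric (f g : (schrodinger μ X hV).domain) :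
    inner ℂ (schrodinger μ X hV f) (g : Lp ℂ 2 μ) =
      inner ℂ (f : Lp ℂ 2 μ) (schrodinger μ X hV g) := by
  obtain ⟨u, hu, hform_u⟩ := exists_form_eq_inner_schrodinger μ X hV f
  obtain ⟨w, hw, hform_w⟩ := exists_form_eq_inner_schrodinger μ X hV g
  rw [← hu, ← hform_w u, ← form_conj_symm, hform_u w, hw, inner_conj_symm]

variable {X hV}

theorem exists_isResolvent_of_lt (hdisc : (schrodinger μ X hV).HasPurelyDiscreteSpectrum)
    {c z : ℝ} (hc : ∀ᵐ x ∂μ, c ≤ V x) (hz : z < c) :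
    ∃ R, IsResolvent (schrodinger μ X hV) (z : ℂ) R := by
  by_contra hspectrum
  obtain ⟨f, hf, hf_ne⟩ := Submodule.exists_mem_ne_zero_of_ne_bot (hdisc.2 z hspectrum).1
  have heigen : schrodinger μ X hV f = (z : ℂ) • (f : Lp ℂ 2 μ) := sub_eq_zero.1 hf
  obtain ⟨u, hu, hform⟩ := exists_form_eq_inner_schrodinger μ X hV f
  have hform_self : (form μ X V u u).re = z * ‖u‖ ^ 2 := by
    rw [hform, heigen, ← hu, inner_smul_right, Complex.re_ofReal_mul,
      ← RCLike.re_eq_complex_re, inner_self_eq_norm_sq, Submodule.coe_norm]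
  have hle := le_re_form_self μ X hV.aestronglyMeasurable hc u
  have hu_ne : u ≠ 0 := fun h => hf_ne (Subtype.ext (hu.symm.trans (congrArg Subtype.val h)))
  rw [hform_self] at hle
  exact hz.not_ge (le_of_mul_le_mul_right hle (pow_pos (norm_pos_iff.2 hu_ne) 2))

theorem one_le_form_sub_mul_inner_resolvent {z : ℝ} (hz : ∀ᵐ x ∂μ, z ≤ V x)
    {R : Lp ℂ 2 μ →L[ℂ] Lp ℂ 2 μ} (hR : IsResolvent (schrodinger μ X hV) (z : ℂ) R)
    {f : formDomain μ X V} (hf : ‖(f : Lp ℂ 2 μ)‖ = 1) :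
    1 ≤ ((form μ X V f f).re - z) * (inner ℂ (f : Lp ℂ 2 μ) (R f)).re := by
  obtain ⟨hmem, hRf⟩ := hR.1 f
  obtain ⟨u, hu, hform⟩ := exists_form_eq_inner_schrodinger μ X hV ⟨R f, hmem⟩
  have hweak : ∀ g : formDomain μ X V,
      form μ X V u g - z * inner ℂ (g : Lp ℂ 2 μ) u = inner ℂ (g : Lp ℂ 2 μ) f := fun g => by
    rw [hform, hu, ← inner_smul_right, ← inner_sub_right, hRf]
  have hf_inner : inner ℂ (f : Lp ℂ 2 μ) f = 1 := by simp [inner_self_eq_norm_sq_to_K, hf]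
  have hcs := norm_sq_form_sub_inner_le μ X hV.aestronglyMeasurable hz u f
  rw [hweak, hweak, hf_inner, Complex.sub_re, hu,
    ← inner_conj_symm, Complex.conj_re] at hcs
  simpa [mul_comm] using hcs

theorem tendsto_form_atTop (hdisc : (schrodinger μ X hV).HasPurelyDiscreteSpectrum)
    {c : ℝ} (hc : ∀ᵐ x ∂μ, c ≤ V x) {f : ℕ → formDomain μ X V}
    (hf : Orthonormal ℂ fun k => (f k : Lp ℂ 2 μ)) :
    Tendsto (fun k => (form μ X V (f k) (f k)).re) atTop atTop := by
  obtain ⟨R, hR⟩ := exists_isResolvent_of_lt μ hdisc hc (sub_one_lt c)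
  have hc' : ∀ᵐ x ∂μ, c - 1 ≤ V x := hc.mono fun x hx => (sub_one_lt c).le.trans hx
  have hweight : ∀ k, 1 ≤ ((form μ X V (f k) (f k)).re - (c - 1)) *
      (inner ℂ (f k : Lp ℂ 2 μ) (R (f k))).re := fun k =>
    one_le_form_sub_mul_inner_resolvent μ hc' hR (hf.1 k)
  have hinner_pos : ∀ k, 0 < (inner ℂ (f k : Lp ℂ 2 μ) (R (f k))).re := fun k => by
    have hle := le_re_form_self μ X hV.aestronglyMeasurable hc' (f k)
    rw [Submodule.coe_norm, hf.1 k, one_pow, mul_one] at hle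
    exact pos_of_mul_pos_right (one_pos.trans_le (hweight k)) (sub_nonneg.2 hle)
  have hinner : Tendsto (fun k => (inner ℂ (f k : Lp ℂ 2 μ) (R (f k))).re) atTop (𝓝 0) := by
    simpa [Function.comp_def] using (Complex.continuous_re.tendsto _).comp
      (tendsto_inner_apply_of_finiteRank_approx hf fun ε hε =>
        hR.exists_finiteRank_approx (schrodinger_symmetric μ X hV) hdisc hε)
  have hinv := (tendsto_nhdsWithin_iff.2
    ⟨hinner, Eventually.of_forall hinner_pos⟩).inv_tendsto_nhdsGT_zero
  have hsub : Tendsto (fun k => (form μ X V (f k) (f k)).re - (c - 1)) atTop atTop :=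
    tendsto_atTop_mono (fun k => (inv_le_iff_one_le_mul₀ (hinner_pos k)).2 (hweight k)) hinv
  simpa using tendsto_atTop_add_const_right _ (c - 1) hsub

end Schrodinger

end Operator

/-! ### Translates of a test function -/

section Translates

open scoped Pointwise

theorem integral_mul_le_setIntegral {α : Type*} [MeasurableSpace α] {μ : Measure α}
    {W φ : α → ℝ} {U : Set α} (hWU : IntegrableOn W U μ) (hW : ∀ᵐ x ∂μ, 0 ≤ W x)
    (hWφ : Integrable (fun x => W x * φ x) μ) (hφ : ∀ x, φ x ≤ 1) (hφU : ∀ x ∉ U, φ x = 0) :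
    ∫ x, W x * φ x ∂μ ≤ ∫ x in U, W x ∂μ := by
  rw [← setIntegral_eq_integral_of_forall_compl_eq_zero fun x hx => by rw [hφU x hx, mul_zero]]
  refine setIntegral_mono_ae hWφ.integrableOn hWU ?_
  filter_upwards [hW] with x hx
  exact mul_le_of_le_one_right hx (hφ x)

theorem eventually_disjoint_smul {G : Type*} [TopologicalSpace G] [Group G] [IsTopologicalGroup G]
    {K : Set G} (hK : IsCompact K) (a : G) :
    ∀ᶠ b in cocompact G, Disjoint (a • K) (b • K) := by
  filter_upwards [((hK.smul a).mul hK.inv).compl_mem_cocompact] with b hb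
  refine disjoint_left.2 ?_
  rintro _ ha ⟨l, hl, rfl⟩
  exact hb ⟨b * l, ha, l⁻¹, inv_mem_inv.2 hl, mul_inv_cancel_right b l⟩

theorem exists_seq_pairwise_disjoint_smul {G : Type*} [TopologicalSpace G] [Group G]
    [IsTopologicalGroup G] {P : G → Prop} (hP : ∃ᶠ x in cocompact G, P x) {K : Set G}
    (hK : IsCompact K) :
    ∃ x : ℕ → G, (∀ k, P (x k)) ∧ Pairwise fun k l => Disjoint (x k • K) (x l • K) := by
  have : Std.Symm fun a b : G => Disjoint (a • K) (b • K) := ⟨fun _ _ h => h.symm⟩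
  exact exists_seq_of_forall_finset_exists' P (fun a b => Disjoint (a • K) (b • K)) fun s _ =>
    (hP.and_eventually
      ((Finset.eventually_all s).2 fun a _ => eventually_disjoint_smul hK a)).exists

namespace IsTestFun

variable {n : ℕ} {G : Type*} [TopologicalSpace G] [ChartedSpace (EuclideanSpace ℝ (Fin n)) G]
  [Group G] {φ ψ : G → ℂ}

section L2

variable [MeasurableSpace G] [BorelSpace G] (μ : Measure G) [μ.IsHaarMeasure]

theorem norm_toLp_sq (hφ : IsTestFun n φ) : ‖hφ.toLp μ‖ ^ 2 = ∫ x, ‖φ x‖ ^ 2 ∂μ := by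
  rw [← integral_norm_sq_lp (hφ.toLp μ)]
  refine integral_congr_ae ?_
  filter_upwards [hφ.coeFn_toLp μ] with x hx
  rw [hx]

theorem toLp_ne_zero (hφ : IsTestFun n φ) {x : G} (hx : φ x ≠ 0) : hφ.toLp μ ≠ 0 := fun h => by
  have hpos : 0 < ∫ x, ‖φ x‖ ^ 2 ∂μ :=
    (hφ.continuous.norm.pow 2).integral_pos_of_hasCompactSupport_nonneg_nonzero
      (hφ.2.comp_left (g := fun z : ℂ => ‖z‖ ^ 2) (by simp)) (fun _ => sq_nonneg _) (x := x)
      (by simpa using hx)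
  rw [← hφ.norm_toLp_sq μ, h] at hpos
  simp at hpos

theorem inner_toLp_eq_zero (hφ : IsTestFun n φ) (hψ : IsTestFun n ψ)
    (h : Disjoint (Function.support φ) (Function.support ψ)) :
    inner ℂ (hφ.toLp μ) (hψ.toLp μ) = 0 := by
  rw [L2.inner_def, ← integral_zero G ℂ (μ := μ)]
  refine integral_congr_ae ?_
  filter_upwards [hφ.coeFn_toLp μ, hψ.coeFn_toLp μ] with x hxφ hxψ
  rw [hxφ, hxψ]
  by_cases hx : φ x = 0
  · rw [hx, inner_zero_left]
  · rw [Function.notMem_support.1 (disjoint_left.1 h hx), inner_zero_right]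

end L2

variable [LieGroup (𝓡 n) ∞ G]

theorem comp_mul_left (hφ : IsTestFun n φ) (g : G) : IsTestFun n fun y => φ (g * y) := by
  have : IsTopologicalGroup G := topologicalGroup_of_lieGroup (𝓡 n) ∞
  exact ⟨hφ.1.comp (contMDiff_mul_left (a := g)), hφ.2.comp_homeomorph (Homeomorph.mulLeft g)⟩

theorem fieldDeriv_comp_mul_left (hφ : IsTestFun n φ) (g : G)
    (v : GroupLieAlgebra (𝓡 n) G) (y : G) :
    fieldDeriv v (fun y => φ (g * y)) y = fieldDeriv v φ (g * y) := by
  rw [(hφ.comp_mul_left g).fieldDeriv_eq, hφ.fieldDeriv_eq]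
  simp only [leftDeriv, mul_assoc]

variable [MeasurableSpace G] [BorelSpace G] (μ : Measure G) [μ.IsHaarMeasure]

theorem norm_toLp_comp_mul_left (hφ : IsTestFun n φ) (g : G) :
    ‖(hφ.comp_mul_left g).toLp μ‖ = ‖hφ.toLp μ‖ := by
  have : IsTopologicalGroup G := topologicalGroup_of_lieGroup (𝓡 n) ∞
  refine (sq_eq_sq₀ (norm_nonneg _) (norm_nonneg _)).1 ?_
  rw [norm_toLp_sq, norm_toLp_sq, integral_mul_left_eq_self (fun y => ‖φ y‖ ^ 2)]

theorem orthonormal_normalize_translates (hφ : IsTestFun n φ) (hφ_ne : hφ.toLp μ ≠ 0) {x : ℕ → G}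
    (hx : Pairwise fun k l => Disjoint (x k • tsupport φ) (x l • tsupport φ)) :
    Orthonormal ℂ fun k => (‖hφ.toLp μ‖⁻¹ : ℂ) • (hφ.comp_mul_left (x k)⁻¹).toLp μ := by
  have hsupport : ∀ g : G, Function.support (fun y => φ (g⁻¹ * y)) ⊆ g • tsupport φ :=
    fun g y hy => mem_smul_set_iff_inv_smul_mem.2 (subset_tsupport φ hy)
  refine ⟨fun k => ?_, fun k l hkl => ?_⟩
  · rw [norm_smul, norm_toLp_comp_mul_left μ hφ, norm_inv, Complex.norm_real, norm_norm]
    exact inv_mul_cancel₀ (norm_ne_zero_iff.2 hφ_ne)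
  · simp only [inner_smul_left, inner_smul_right]
    rw [inner_toLp_eq_zero μ _ _ ((hx hkl).mono (hsupport _) (hsupport _)), mul_zero, mul_zero]

variable [T2Space G] [SecondCountableTopology G] {ν : ℕ} (X : Fin ν → GroupLieAlgebra (𝓡 n) G)
  {V : G → ℝ} (hV : LocallyIntegrable V μ)

/-- The class of a test function, as an element of the form domain. -/
noncomputable def toFormDomain (hφ : IsTestFun n φ) : formDomain μ X V :=
  ⟨hφ.toLp μ, hφ.mem_formDomain μ X hV⟩

theorem coeFn_weakGrad (hφ : IsTestFun n φ) (j : Fin ν) :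
    weakGrad μ X V j (hφ.toFormDomain μ X hV) =ᵐ[μ] fieldDeriv (X j) φ := by
  rw [weakGrad_eq_of_mem μ X (hφ.mem_weakDerivGraph μ (X j))]
  exact MemLp.coeFn_toLp _

theorem re_form (hφ : IsTestFun n φ) :
    (form μ X V (hφ.toFormDomain μ X hV) (hφ.toFormDomain μ X hV)).re =
      ∫ x, ∑ j, ‖fieldDeriv (X j) φ x‖ ^ 2 ∂μ + ∫ x, V x * ‖φ x‖ ^ 2 ∂μ := by
  have hgrad : Integrable (fun x => ∑ j, ‖fieldDeriv (X j) φ x‖ ^ 2) μ :=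
    integrable_finsetSum _ fun j _ => (memLp_two_iff_integrable_sq_norm
      (hφ.memLp_fieldDeriv μ (X j)).1).1 (hφ.memLp_fieldDeriv μ (X j))
  rw [re_form_self μ X hV.aestronglyMeasurable, ← integral_add hgrad (hφ.integrable_mul_norm_sq hV)]
  refine integral_congr_ae ?_
  filter_upwards [ae_all_iff.2 (hφ.coeFn_weakGrad μ X hV), hφ.coeFn_toLp μ] with x hgrad_x hx
  have hx' : ((hφ.toFormDomain μ X hV : formDomain μ X V) : Lp ℂ 2 μ) x = φ x := hx
  simp only [hgrad_x, hx']

theorem re_form_le_setIntegral (hφ : IsTestFun n φ) {c : ℝ} (hc : ∀ᵐ x ∂μ, c ≤ V x)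
    (hφ_le : ∀ x, ‖φ x‖ ≤ 1) {U : Set G} (hφU : Function.support φ ⊆ U)
    (hVU : IntegrableOn V U μ) (hU : μ U ≠ ⊤) :
    (form μ X V (hφ.toFormDomain μ X hV) (hφ.toFormDomain μ X hV)).re ≤
      ∫ x in U, V x ∂μ + (∫ x, ∑ j, ‖fieldDeriv (X j) φ x‖ ^ 2 ∂μ +
        c * (∫ x, ‖φ x‖ ^ 2 ∂μ - μ.real U)) := by
  have hφ_int : Integrable (fun x => ‖φ x‖ ^ 2) μ :=
    (memLp_two_iff_integrable_sq_norm hφ.continuous.aestronglyMeasurable).1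
      (hφ.continuous.memLp_of_hasCompactSupport hφ.2)
  have hVφ_int := hφ.integrable_mul_norm_sq hV
  have hcU : IntegrableOn (fun _ => c) U μ := integrableOn_const hU
  have hVcφ_int : Integrable (fun x => (V x - c) * ‖φ x‖ ^ 2) μ :=
    (hVφ_int.sub (hφ_int.const_mul c)).congr (Eventually.of_forall fun x => (sub_mul ..).symm)
  have hsub : ∫ x, (V x - c) * ‖φ x‖ ^ 2 ∂μ ≤ ∫ x in U, (V x - c) ∂μ :=
    integral_mul_le_setIntegral (W := fun x => V x - c) (φ := fun x => ‖φ x‖ ^ 2) (hVU.sub hcU)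
      (hc.mono fun x hx => sub_nonneg.2 hx) hVcφ_int
      (fun x => pow_le_one₀ (norm_nonneg _) (hφ_le x)) fun x hx => by
        simp [Function.notMem_support.1 fun h => hx (hφU h)]
  simp only [sub_mul] at hsub
  rw [integral_sub hVφ_int (hφ_int.const_mul c), integral_const_mul, integral_sub hVU hcU,
    setIntegral_const, smul_eq_mul] at hsub
  rw [hφ.re_form μ X hV]
  linarith

theorem re_form_comp_mul_left_le (hφ : IsTestFun n φ) {c : ℝ} (hc : ∀ᵐ x ∂μ, c ≤ V x)
    (hφ_le : ∀ x, ‖φ x‖ ≤ 1) {U K : Set G} (hφU : Function.support φ ⊆ U) (hUK : U ⊆ K)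
    (hK : IsCompact K) (g : G) :
    (form μ X V ((hφ.comp_mul_left g⁻¹).toFormDomain μ X hV)
      ((hφ.comp_mul_left g⁻¹).toFormDomain μ X hV)).re ≤
      ∫ x in g • U, V x ∂μ + (∫ x, ∑ j, ‖fieldDeriv (X j) φ x‖ ^ 2 ∂μ +
        c * (∫ x, ‖φ x‖ ^ 2 ∂μ - μ.real U)) := by
  have : IsTopologicalGroup G := topologicalGroup_of_lieGroup (𝓡 n) ∞
  have hsupport : Function.support (fun y => φ (g⁻¹ * y)) ⊆ g • U :=
    fun y hy => mem_smul_set_iff_inv_smul_mem.2 (hφU hy)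
  have hgU : g • U ⊆ g • K := smul_set_mono hUK
  have hle := (hφ.comp_mul_left g⁻¹).re_form_le_setIntegral μ X hV hc (fun y => hφ_le _) hsupport
    ((hV.integrableOn_isCompact (hK.smul g)).mono_set hgU)
    (measure_ne_top_of_subset hgU (hK.smul g).measure_ne_top)
  simp only [hφ.fieldDeriv_comp_mul_left] at hle
  rwa [integral_mul_left_eq_self (fun y => ∑ j, ‖fieldDeriv (X j) φ y‖ ^ 2),
    integral_mul_left_eq_self (fun y => ‖φ y‖ ^ 2), measureReal_def, measure_smul] at hle

theorem tendsto_form_translate_atTop (hφ : IsTestFun n φ) (hφ_ne : hφ.toLp μ ≠ 0)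
    (hdisc : (schrodinger μ X hV).HasPurelyDiscreteSpectrum) {c : ℝ} (hc : ∀ᵐ x ∂μ, c ≤ V x) :
    Tendsto (fun g : G => (form μ X V ((hφ.comp_mul_left g⁻¹).toFormDomain μ X hV)
      ((hφ.comp_mul_left g⁻¹).toFormDomain μ X hV)).re) (cocompact G) atTop := by
  have : IsTopologicalGroup G := topologicalGroup_of_lieGroup (𝓡 n) ∞
  refine tendsto_atTop.2 fun M => ?_
  by_contra hM
  simp only [not_eventually, not_le] at hM
  obtain ⟨x, hx_lt, hx⟩ := exists_seq_pairwise_disjoint_smul hM hφ.2.isCompact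
  have htend := tendsto_form_atTop (X := X) (hV := hV) μ hdisc hc
    (f := fun k => (‖hφ.toLp μ‖⁻¹ : ℂ) • (hφ.comp_mul_left (x k)⁻¹).toFormDomain μ X hV)
    (orthonormal_normalize_translates μ hφ hφ_ne hx)
  simp only [re_form_smul_self] at htend
  obtain ⟨k, hk⟩ := (htend.eventually_ge_atTop (‖(‖hφ.toLp μ‖⁻¹ : ℂ)‖ ^ 2 * M)).exists
  have hscale : 0 < ‖(‖hφ.toLp μ‖⁻¹ : ℂ)‖ ^ 2 := by
    simpa using pow_pos (norm_pos_iff.2 hφ_ne) 2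
  exact (hx_lt k).not_ge (le_of_mul_le_mul_left hk hscale)

end IsTestFun

variable {n : ℕ} {G : Type*} [TopologicalSpace G] [T2Space G] [SecondCountableTopology G]
  [ChartedSpace (EuclideanSpace ℝ (Fin n)) G] [Group G] [LieGroup (𝓡 n) ∞ G] [MeasurableSpace G]
  [BorelSpace G] {μ : Measure G} [μ.IsHaarMeasure] {ν : ℕ}
  {X : Fin ν → GroupLieAlgebra (𝓡 n) G} {V : G → ℝ}

theorem tendsto_setIntegral_smul_atTop {hV : LocallyIntegrable V μ} {c : ℝ}
    (hc : ∀ᵐ x ∂μ, c ≤ V x) (hdisc : (schrodinger μ X hV).HasPurelyDiscreteSpectrum)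
    {U K : Set G} (hU : U ∈ 𝓝 1) (hUK : U ⊆ K) (hK : IsCompact K) :
    Tendsto (fun x : G => ∫ y in x • U, V y ∂μ) (cocompact G) atTop := by
  have : IsTopologicalGroup G := topologicalGroup_of_lieGroup (𝓡 n) ∞
  obtain ⟨ψ, hψ, hψc, hψ_one, hψU, hψ_mem⟩ := exists_contMDiff_bump (n := n) hU
  have hφ := isTestFun_ofReal hψ hψc
  set φ : G → ℂ := fun x => (ψ x : ℂ)
  have hφ_le : ∀ x, ‖φ x‖ ≤ 1 := fun x => by
    simpa [φ, abs_of_nonneg (hψ_mem x).1] using (hψ_mem x).2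
  have hφU : Function.support φ ⊆ U := fun x hx =>
    hψU (subset_tsupport ψ fun h => hx (by simp [φ, h]))
  refine tendsto_atTop_mono (fun x => sub_le_iff_le_add.2
    (hφ.re_form_comp_mul_left_le μ X hV hc hφ_le hφU hUK hK x)) ?_
  exact tendsto_atTop_add_const_right _ _ (hφ.tendsto_form_translate_atTop μ X hV
    (hφ.toLp_ne_zero μ (x := 1) (by simp [φ, hψ_one])) hdisc hc)

end Translates

end SubRiem

theorem corollary4p2_general
    {n : ℕ} {G : Type*} [TopologicalSpace G] [T2Space G] [SecondCountableTopology G]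
    [ChartedSpace (EuclideanSpace ℝ (Fin n)) G] [Group G] [LieGroup (𝓡 n) ∞ G]
    [MeasurableSpace G] [BorelSpace G] (μ : Measure G) [μ.IsHaarMeasure]
    (ip : InnerProductSpace.Core ℝ (GroupLieAlgebra (𝓡 n) G))
    (𝓗 : Submodule ℝ (GroupLieAlgebra (𝓡 n) G))
    (h𝓗 : LieSubalgebra.lieSpan ℝ (GroupLieAlgebra (𝓡 n) G)
      (𝓗 : Set (GroupLieAlgebra (𝓡 n) G)) = ⊤)
    {ν : ℕ} (X : Fin ν → GroupLieAlgebra (𝓡 n) G)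
    (V : G → ℝ) (hV : LocallyIntegrable V μ) (hVbdd : ∃ c : ℝ, ∀ᵐ x ∂μ, c ≤ V x)
    (hdisc : (SubRiem.schrodinger μ X hV).HasPurelyDiscreteSpectrum) {r : ℝ} (hr : 0 < r) :
    Tendsto (fun x : G => ∫ y in SubRiem.ccBall ip 𝓗 x r, V y ∂μ) (cocompact G) atTop := by
  obtain ⟨c, hc⟩ := hVbdd
  obtain ⟨K, hK, hball⟩ := SubRiem.exists_isCompact_ccBall_one_subset ip 𝓗 r
  have hnhds := SubRiem.ccBall_one_mem_nhds (ip := ip) h𝓗 hr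
  refine (SubRiem.tendsto_setIntegral_smul_atTop hc hdisc hnhds hball hK).congr fun x => ?_
  rw [SubRiem.ccBall_eq_smul x r]

theorem corollary4p2
    {n : ℕ} {G : Type*} [TopologicalSpace G] [T2Space G] [SecondCountableTopology G]
    [ChartedSpace (EuclideanSpace ℝ (Fin n)) G] [Group G] [LieGroup (𝓡 n) ∞ G]
    [ConnectedSpace G] [NoncompactSpace G]
    [MeasurableSpace G] [BorelSpace G]
    -- a left Haar measure
    (μ : Measure G) [μ.IsHaarMeasure]
    -- a scalar product on the Lie algebra, and a subspace generating it as a Lie algebra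
    (ip : InnerProductSpace.Core ℝ (GroupLieAlgebra (𝓡 n) G))
    (𝓗 : Submodule ℝ (GroupLieAlgebra (𝓡 n) G))
    (h𝓗 : LieSubalgebra.lieSpan ℝ (GroupLieAlgebra (𝓡 n) G) (𝓗 : Set (GroupLieAlgebra (𝓡 n) G)) = ⊤)
    -- an orthonormal basis of the subspace
    {ν : ℕ} (X : Fin ν → GroupLieAlgebra (𝓡 n) G)
    (hX : ∀ i j, ip.inner (X i) (X j) = if i = j then 1 else 0)
    (hXspan : Submodule.span ℝ (Set.range X) = 𝓗)
    -- a locally integrable potential, essentially bounded from below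
    (V : G → ℝ) (hV : LocallyIntegrable V μ) (hVbdd : ∃ c : ℝ, ∀ᵐ x ∂μ, c ≤ V x)
    (hdisc : (SubRiem.schrodinger μ X hV).HasPurelyDiscreteSpectrum) :
    ∀ r : ℝ, 0 < r →
      Tendsto (fun x : G => ∫ y in SubRiem.ccBall ip 𝓗 x r, V y ∂μ) (cocompact G) atTop :=
  fun _ hr => corollary4p2_general μ ip 𝓗 h𝓗 X V hV hVbdd hdisc hr
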